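/- **Setting.** For $m\ge 1$ let $\mathbb S_m$ be the set of rankings (permutations) of $m$ items; $\pi(i)$ is the position of item $i$. For $\pi_1,\pi_2\in\mathbb S_m$ let $K(\pi_1,\pi_2)=|\{(i,j):\pi_1(i)<\pi_1(j),\ \pi_2(i)>\pi_2(j)\}|$, and for a data set $\Pi=(\pi_1,\dots,\pi_n)$, $n\ge 1$, let $\bar K(\sigma,\Pi)=\frac1n\sum_{k}K(\sigma,\pi_k)$ and $\mathrm{OPT}(\Pi)=\min_\sigma\bar K(\sigma,\Pi)$. A randomized algorithm is an $(\alpha,\beta)$-approximation if on every $\Pi$ its output ranking $\sigma$ satisfies $\mathbb E[\bar K(\sigma,\Pi)]\le\alpha\,\mathrm{OPT}(\Pi)+\beta$. A weight matrix $w=(w_{ij})_{i,j\in[m]}$ satisfies the probability constraint if $w_{ij}\ge 0$, $w_{ij}+w_{ji}=1$ for $i\ne j$, and $w_{ii}=0$. A query algorithm $\mathcal A$ gets $m$ and can query entries of $w$; it is an $\alpha$-approximation if for all $m\ge1$ and all $w$ satisfying the probability constraint its output satisfies $\mathbb E[\bar K(\sigma,w)]\le\alpha\min_{\sigma'}\bar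 K(\sigma',w)$, where $\bar K(\sigma,w)=\sum_{\sigma(i)<\sigma(j)}w_{ji}$. In the (fully interactive) local model, a server without access to the data repeatedly sends a message to a user, who replies with a randomized function of that message and of its own ranking; finally the server outputs a ranking. The protocol is $\epsilon$-DP in the local model if $\Pr[T(\Pi)\in S]\le e^{\epsilon}\Pr[T(\Pi')\in S]$ for all sets $S$ of transcripts and all $\Pi,\Pi'$ that differ in the ranking of one user, where the transcript $T$ consists of all exchanged messages and the output. Polynomial time means: on a randomized real RAM (unit-cost arithmetic on reals without rounding; $+$, $-$, $<$ on natural numbers; arrays; biased coins; no real constants other than natural numbers), the number of steps is always at most a polynomial, in $m$ for $\mathcal A$, and in $n+m$ (counting the server and all users together) for $\mathcal B$. **Theorem.** For every $\alpha>0$ there is a constant $C=C(\alpha)>0$ such that the following holds. Let $\mathcal A$ be a polynomial-time (not necessarily private) query algorithm that is an $\alpha$-approximation for rank aggregation. Then there is a polynomial-time protocol $\mathcal B$ in the local model, taking $n,m,q\in\mathbb N$ and $\epsilon>0$ as parameters, which is $\epsilon$-DP in the local model for all $n,m\ge 1$, $q\in\mathbb N$, $\epsilon>0$, and which has the following property.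 Let $n,m\ge1$, $q\in\mathbb N$, $0<\zeta\le1$ and $0<\epsilon\le\max\{1,q/m\}$ be such that $q\ge 10\,m\log(m/\zeta)$ and such that, on every weight matrix on $m$ items satisfying the probability constraint, $\mathcal A$ makes at most $q$ queries with probability at least $1-\zeta/m^4$. Then for every data set $\Pi$ of $n$ rankings of $m$ items the output $\sigma$ of $\mathcal B$ satisfies $$\mathbb E[\bar K(\sigma,\Pi)]\le(\alpha+\zeta)\,\mathrm{OPT}(\Pi)+C\cdot\frac{m^{1.5}q}{\epsilon\sqrt n}.$$ -/

import Mathlib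

open scoped ENNReal

namespace RankAgg

/-! ### Rankings, Kendall tau distance, Kemeny score -/

/-- A ranking of the items `0, …, m - 1`: `π i` is the position of item `i`
(a smaller position means more preferred). -/
abbrev Ranking (m : ℕ) := Equiv.Perm (Fin m)

/-- Kendall tau distance: the number of pairwise disagreements. -/
def kendallTau {m : ℕ} (π₁ π₂ : Ranking m) : ℕ :=
  (Finset.univ.filter fun p : Fin m × Fin m => π₁ p.1 < π₁ p.2 ∧ π₂ p.2 < π₂ p.1).card

/-- Average Kendall tau distance (Kemeny score) of `σ` to the rankings `D 0, …, D (n - 1)`. -/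
noncomputable def kemeny {n m : ℕ} (D : Fin n → Ranking m) (σ : Ranking m) : ℝ :=
  (∑ k, (kendallTau σ (D k) : ℝ)) / n

/-- Cost of the ranking `σ` with respect to a weight matrix `w`, where `w j i` is the (fractional)
preference for putting `j` before `i`. -/
def weightCost {m : ℕ} (w : Fin m → Fin m → ℝ) (σ : Ranking m) : ℝ :=
  ∑ i, ∑ j, if σ i < σ j then w j i else 0

/-- The probability constraint on weight matrices. The diagonal carries no information and is
set to zero. -/
structure IsProbWeight {m : ℕ} (w : Fin m → Fin m → ℝ) : Prop where
  nonneg : ∀ i j, 0 ≤ w i j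
  add_eq_one : ∀ i j, i ≠ j → w i j + w j i = 1
  diag : ∀ i, w i i = 0

/-- The optimum (minimum over all rankings) of a cost function. -/
noncomputable def opt {m : ℕ} (cost : Ranking m → ℝ) : ℝ := ⨅ σ, cost σ

/-- Expected cost of a random output. Failing to output a ranking has infinite cost, so a finite
expected cost implies that the output is a ranking with probability one. -/
noncomputable def expectedCost {m : ℕ} (μ : PMF (Option (Ranking m))) (cost : Ranking m → ℝ) :
    ℝ≥0∞ :=
  ∑' o, μ o * (match o with
    | none => ⊤
    | some σ => ENNReal.ofReal (cost σ))

/-- The random output `μ` is an `(α, β)`-approximation of the optimum of `cost`. -/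
def IsApprox {m : ℕ} (μ : PMF (Option (Ranking m))) (cost : Ranking m → ℝ) (α β : ℝ) : Prop :=
  expectedCost μ cost ≤ ENNReal.ofReal (α * opt cost + β)

/-! ### The machine model: randomized real RAM programs, one time unit per executed command

Memory consists of arrays of natural numbers and arrays of real numbers; a program mentions
finitely many of them, and indices may be computed (indirect addressing). Natural numbers support
`+`, truncated `-` and `<` (no multiplication), reals support the field operations (with
`x / 0 = 0`) and `<`. The only numerical constants are natural numbers, and reals cannot be rounded
to naturals. Expressions are fixed by the program text, so evaluating one costs a constant. -/

structure Mem where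
  nat : ℕ → ℕ → ℕ
  real : ℕ → ℕ → ℝ

/-- A message: a list of natural words and a list of real words. -/
abbrev Msg := List ℕ × List ℝ

/-- A reply: one natural word and one real word. -/
abbrev Reply := ℕ × ℝ

/-- Initial memory: the input words are in the arrays number `0`, and all other cells are `0`. -/
def Mem.init (x : Msg) : Mem where
  nat a i := if a = 0 then x.1.getD i 0 else 0
  real a i := if a = 0 then x.2.getD i 0 else 0

def Mem.setNat (μ : Mem) (a i v : ℕ) : Mem where
  nat b j := if b = a ∧ j = i then v else μ.nat b j
  real := μ.real

def Mem.setReal (μ : Mem) (a i : ℕ) (v : ℝ) : Mem where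
  nat := μ.nat
  real b j := if b = a ∧ j = i then v else μ.real b j

inductive NExp where
  | const (c : ℕ)
  | get (a : ℕ) (i : NExp)
  | add (e f : NExp)
  | sub (e f : NExp)

def NExp.eval (μ : Mem) : NExp → ℕ
  | const c => c
  | get a i => μ.nat a (i.eval μ)
  | add e f => e.eval μ + f.eval μ
  | sub e f => e.eval μ - f.eval μ

inductive RExp where
  | ofNat (e : NExp)
  | get (a : ℕ) (i : NExp)
  | add (e f : RExp)
  | sub (e f : RExp)
  | mul (e f : RExp)
  | div (e f : RExp)

noncomputable def RExp.eval (μ : Mem) : RExp → ℝ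
  | ofNat e => (e.eval μ : ℝ)
  | get a i => μ.real a (i.eval μ)
  | add e f => e.eval μ + f.eval μ
  | sub e f => e.eval μ - f.eval μ
  | mul e f => e.eval μ * f.eval μ
  | div e f => e.eval μ / f.eval μ

inductive BExp where
  | natLt (e f : NExp)
  | realLt (e f : RExp)
  | not (b : BExp)
  | and (b c : BExp)

def BExp.eval (μ : Mem) : BExp → Prop
  | natLt e f => e.eval μ < f.eval μ
  | realLt e f => e.eval μ < f.eval μ
  | not b => ¬ b.eval μ
  | and b c => b.eval μ ∧ c.eval μ

/-- Programs. `flip a i p` writes to the natural cell `a[i]` a fresh random bit that is `1` with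
probability `p` (clamped to `[0, 1]`). `call xs rs a i b j` sends the message consisting of the
values of `xs` and `rs` to the environment and stores the two words of the reply in the natural
cell `a[i]` and the real cell `b[j]`. -/
inductive Cmd where
  | skip
  | setNat (a : ℕ) (i e : NExp)
  | setReal (a : ℕ) (i : NExp) (e : RExp)
  | flip (a : ℕ) (i : NExp) (p : RExp)
  | call (xs : List NExp) (rs : List RExp) (a : ℕ) (i : NExp) (b : ℕ) (j : NExp)
  | seq (s t : Cmd)
  | ite (c : BExp) (s t : Cmd)
  | while (c : BExp) (s : Cmd)

/-- A coin that is `true` with probability `p`, clamped to `[0, 1]`. -/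
noncomputable def coin (p : ℝ) : PMF Bool :=
  PMF.ofFintype (fun b => ENNReal.ofReal (if b then max 0 (min p 1) else 1 - max 0 (min p 1)))
    (by
      have h0 : 0 ≤ max 0 (min p 1) := le_max_left _ _
      have h1 : max 0 (min p 1) ≤ 1 := max_le zero_le_one (min_le_right _ _)
      rw [Fintype.sum_bool, ← ENNReal.ofReal_add (by simp) (by simp)]
      simp)

/-- A configuration: the stack of commands still to be executed (empty: halted), the memory, and
the number of calls made so far. -/
structure Config where
  code : List Cmd
  mem : Mem
  calls : ℕ

def Config.start (s : Cmd) (x : Msg) : Config := ⟨[s], Mem.init x, 0⟩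

/-- The message that a `call` with arguments `xs`, `rs` sends. -/
noncomputable def message (μ : Mem) (xs : List NExp) (rs : List RExp) : Msg :=
  (xs.map (NExp.eval μ), rs.map (RExp.eval μ))

/-- Store a reply. -/
def Mem.store (μ : Mem) (r : Reply) (a : ℕ) (i : NExp) (b : ℕ) (j : NExp) : Mem :=
  (μ.setNat a (i.eval μ) r.1).setReal b (j.eval μ) r.2

open Classical in
/-- One step of a program whose calls are answered by the function `env`. -/
noncomputable def step (env : Msg → Reply) : Config → PMF Config
  | ⟨[], μ, c⟩ => PMF.pure ⟨[], μ, c⟩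
  | ⟨.skip :: k, μ, c⟩ => PMF.pure ⟨k, μ, c⟩
  | ⟨.setNat a i e :: k, μ, c⟩ => PMF.pure ⟨k, μ.setNat a (i.eval μ) (e.eval μ), c⟩
  | ⟨.setReal a i e :: k, μ, c⟩ => PMF.pure ⟨k, μ.setReal a (i.eval μ) (e.eval μ), c⟩
  | ⟨.flip a i p :: k, μ, c⟩ =>
      (coin (p.eval μ)).map fun h => ⟨k, μ.setNat a (i.eval μ) (if h then 1 else 0), c⟩
  | ⟨.call xs rs a i b j :: k, μ, c⟩ =>
      PMF.pure ⟨k, μ.store (env (message μ xs rs)) a i b j, c + 1⟩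
  | ⟨.seq s t :: k, μ, c⟩ => PMF.pure ⟨s :: t :: k, μ, c⟩
  | ⟨.ite b s t :: k, μ, c⟩ => PMF.pure ⟨(if b.eval μ then s else t) :: k, μ, c⟩
  | ⟨.while b s :: k, μ, c⟩ =>
      PMF.pure ⟨if b.eval μ then s :: .while b s :: k else k, μ, c⟩

/-- Distribution of the state of a Markov chain after `T` steps. -/
noncomputable def iter {S : Type} (f : S → PMF S) : ℕ → S → PMF S
  | 0, s => PMF.pure s
  | T + 1, s => (f s).bind (iter f T)

open Classical in
/-- The ranking stored in natural array `0` (position of item `i` in cell `i`), if there is one. -/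
noncomputable def readRanking (m : ℕ) (μ : Mem) : Option (Ranking m) :=
  if h : ∃ σ : Ranking m, ∀ i : Fin m, μ.nat 0 i = (σ i : ℕ) then some h.choose else none

/-! ### Rank aggregation algorithms with query access to the weights -/

/-- The query oracle: the message `i, j` is answered by `w i j`. -/
def weightOracle {m : ℕ} (w : Fin m → Fin m → ℝ) (x : Msg) : Reply :=
  (0, if h : x.1.getD 0 0 < m ∧ x.1.getD 1 0 < m then
    w ⟨x.1.getD 0 0, h.1⟩ ⟨x.1.getD 1 0, h.2⟩ else 0)

/-- `T` steps of the algorithm `A`, given `m` as its input and query access to `w`. -/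
noncomputable def runQuery (A : Cmd) {m : ℕ} (w : Fin m → Fin m → ℝ) (T : ℕ) : PMF Config :=
  iter (step (weightOracle w)) T (Config.start A ([m], []))

/-- `A` makes at most `t m` steps on every instance with `m` items, for all its coin tosses. -/
def QueryRunsIn (A : Cmd) (t : ℕ → ℕ) : Prop :=
  ∀ m, 1 ≤ m → ∀ w : Fin m → Fin m → ℝ, IsProbWeight w →
    ∀ c ∈ (runQuery A w (t m)).support, c.code = []

/-- The output of an algorithm that runs in time `t`. -/
noncomputable def queryOutput (A : Cmd) (t : ℕ → ℕ) {m : ℕ} (w : Fin m → Fin m → ℝ) :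
    PMF (Option (Ranking m)) :=
  (runQuery A w (t m)).map fun c => readRanking m c.mem

/-- The number of queries of an algorithm that runs in time `t` (repetitions count). -/
noncomputable def queryCount (A : Cmd) (t : ℕ → ℕ) {m : ℕ} (w : Fin m → Fin m → ℝ) : PMF ℕ :=
  (runQuery A w (t m)).map Config.calls

/-- `A`, which runs in time `t`, is an `α`-approximation algorithm for rank aggregation. -/
def QueryApprox (A : Cmd) (t : ℕ → ℕ) (α : ℝ) : Prop :=
  ∀ m, 1 ≤ m → ∀ w : Fin m → Fin m → ℝ, IsProbWeight w →
    IsApprox (queryOutput A t w) (weightCost w) α 0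

/-! ### Interactive protocols in the local model -/

/-- A protocol: the program of the server, which has no access to the rankings, and the program
with which a user computes its reply to a message from the server. -/
structure Protocol where
  server : Cmd
  user : Cmd

/-- A user's access to its own ranking: the message `i` is answered by the position of item `i`. -/
def rankingOracle {m : ℕ} (π : Ranking m) (x : Msg) : Reply :=
  (if h : x.1.getD 0 0 < m then (π ⟨x.1.getD 0 0, h⟩ : ℕ) else 0, 0)

/-- One exchange: the user addressed, the server's message, the user's reply. -/
abbrev Exchange (n : ℕ) := Fin n × Msg × Reply

/-- A running computation of a user: who, on which message, in which configuration, and the cells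
in which the server will store the reply. -/
structure UserRun (n : ℕ) where
  user : Fin n
  msg : Msg
  config : Config
  natArray : ℕ
  natIndex : NExp
  realArray : ℕ
  realIndex : NExp

/-- The global state of a protocol execution. -/
structure PState (n : ℕ) where
  server : Config
  active : Option (UserRun n)
  exchanges : List (Exchange n)

/-- One step of a protocol; exactly one party makes a step. A `call` of the server whose first
natural word is `k` sends the rest of the message to user `k`, who runs the user program on it from
a blank memory, with fresh coins and access to the user's own ranking only; when that halts,
the contents of the user's cells `0` of the arrays `0` are the reply. If there is no user `k` the
reply is `(0, 0)`. -/
noncomputable def Protocol.step (B : Protocol) {n m : ℕ} (D : Fin n → Ranking m) :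
    PState n → PMF (PState n)
  | ⟨S, some u, E⟩ =>
      if u.config.code.isEmpty then
        let r : Reply := (u.config.mem.nat 0 0, u.config.mem.real 0 0)
        PMF.pure ⟨{ S with mem := S.mem.store r u.natArray u.natIndex u.realArray u.realIndex },
          none, E ++ [(u.user, u.msg, r)]⟩
      else
        (RankAgg.step (rankingOracle (D u.user)) u.config).map fun c =>
          ⟨S, some { u with config := c }, E⟩
  | ⟨⟨.call xs rs a i b j :: k, μ, c⟩, none, E⟩ =>
      let x := message μ xs rs
      if h : x.1.headD 0 < n then
        let y : Msg := (x.1.tail, x.2)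
        PMF.pure ⟨⟨k, μ, c + 1⟩,
          some ⟨⟨x.1.headD 0, h⟩, y, Config.start B.user y, a, i, b, j⟩, E⟩
      else PMF.pure ⟨⟨k, μ.store (0, 0) a i b j, c + 1⟩, none, E⟩
  | ⟨S, none, E⟩ => (RankAgg.step (fun _ => (0, 0)) S).map fun c => ⟨c, none, E⟩

/-- The protocol has terminated. -/
def PState.Halted {n : ℕ} (s : PState n) : Prop := s.server.code = [] ∧ s.active = none

/-- `T` steps of the protocol for the rankings `D`. The server's input is `m, n, q, ε`. -/
noncomputable def Protocol.run (B : Protocol) {n m : ℕ} (q : ℕ) (ε : ℝ) (D : Fin n → Ranking m)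
    (T : ℕ) : PMF (PState n) :=
  iter (B.step D) T ⟨Config.start B.server ([m, n, q], [ε]), none, []⟩

/-- The protocol, with all users together, makes at most `t (n + m)` steps for `n` users
and `m` items, for all parameters, rankings and coin tosses. -/
def Protocol.RunsIn (B : Protocol) (t : ℕ → ℕ) : Prop :=
  ∀ n m q : ℕ, 1 ≤ n → 1 ≤ m → ∀ ε : ℝ, 0 < ε → ∀ D : Fin n → Ranking m,
    ∀ s ∈ (B.run q ε D (t (n + m))).support, s.Halted

/-- The output ranking of a protocol that runs in time `t`. -/
noncomputable def Protocol.output (B : Protocol) (t : ℕ → ℕ) {n m : ℕ} (q : ℕ) (ε : ℝ)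
    (D : Fin n → Ranking m) : PMF (Option (Ranking m)) :=
  (B.run q ε D (t (n + m))).map fun s => readRanking m s.server.mem

/-- The transcript of a protocol that runs in time `t`: everything exchanged between the
server and the users, and the published ranking. -/
noncomputable def Protocol.transcript (B : Protocol) (t : ℕ → ℕ) {n m : ℕ} (q : ℕ) (ε : ℝ)
    (D : Fin n → Ranking m) : PMF (List (Exchange n) × Option (Ranking m)) :=
  (B.run q ε D (t (n + m))).map fun s => (s.exchanges, readRanking m s.server.mem)

/-- Two data sets are neighboring if they differ in (at most) the ranking of one user. -/
def Neighboring {n m : ℕ} (D D' : Fin n → Ranking m) : Prop :=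
  ∃ k, ∀ l, l ≠ k → D l = D' l

/-- Pure `ε`-differential privacy of a randomized function of the data set. -/
def IsPureDP {n m : ℕ} {R : Type} (M : (Fin n → Ranking m) → PMF R) (ε : ℝ) : Prop :=
  ∀ D D', Neighboring D D' → ∀ S : Set R,
    (M D).toOuterMeasure S ≤ ENNReal.ofReal (Real.exp ε) * (M D').toOuterMeasure S

end RankAgg

open RankAgg

/-! The server runs the query algorithm on estimated weights. The Kemeny score is the `weightCost`
of the matrix `prefWeight D` (`kemeny_eq_weightCost`), so a query asks for the fraction of users who
prefer one item to another. The users are split at random into m groups, and each pair queried for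
the first time is put to one random group by randomized response. As long as no group is polled more
than 4q/m times, every answer may use the privacy parameter εm/(8q). The mean error of an entry is
then of order q/(εm)·√(m/n) (`expected_entry_error_le`), which over m² pairs sums to m^1.5·q/(ε√n).
Entries are clamped, remembered and mirrored by w_ji = 1 - w_ij, so the algorithm always sees a
legal matrix. The cost of a ranking is 1-Lipschitz in the matrix, so an α-approximation for the
estimates loses at most α+1 times the total error (`expectedCost_le_of_isApprox`).

The simulation fails if a group is overloaded, which has probability O(ζ/m⁴) within q queries by an
exponential potential (`potential_step`, `potential_zero_le`), and it may also fail if the algorithm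
makes more than q queries. An arbitrary output after a failure would cost up to m², which need not
be small compared with OPT. Hence the server prepares a fallback: all users are asked about all
ordered pairs with parameter ε/(2m²), and the items are sorted by estimated average position. An
average position differs from the position in a ranking by at most the cost of that ranking
(`abs_avgPos_sub_le`), so this finds the optimum if both OPT and the noise are small, and costs
O(m²)(OPT + noise) in any case (`weightCost_lexPerm_le`). The fallback is independent of the
simulation, so its expected cost is multiplied by the failure probability, which leaves at most
ζ·OPT and a lower-order error.

The analysis defers decisions: choices made when a pair is first queried have the same effect as
choices made in advance for all pairs (`prodExp_coord`, `tableWeight_update`), and for choices fixed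
in advance the guarantee of the algorithm applies to a fixed matrix. `spec_simulate` carries this
through the run of the program.

Programs are treated by upper bounds `W` on expected final values, in the manner of a Hoare logic.
Runs that have not halted or have exceeded the privacy budget get the value ⊤, so the single
estimate `ev_serverProg_le` yields the running time and the privacy budget (with cost zero,
`halted_and_private`) as well as the expected cost (`tsum_output_le`). Privacy of the transcript
follows from the budget by `isPureDP_transcript`. -/

namespace RankAgg

/-! ### Expectations over finite product spaces -/

section ProdExp

variable {ι Ω R : Type*} [Fintype ι] [DecidableEq ι] [Fintype Ω] [CommSemiring R]

/-- The expectation of `f` when the coordinates of `ω` are independent with weights `μ i`. -/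
def prodExp (μ : ι → Ω → R) (f : (ι → Ω) → R) : R := ∑ ω, (∏ i, μ i (ω i)) * f ω

theorem prodExp_add (μ : ι → Ω → R) (f g : (ι → Ω) → R) :
    prodExp μ (fun ω => f ω + g ω) = prodExp μ f + prodExp μ g := by
  simp [prodExp, mul_add, Finset.sum_add_distrib]

theorem prodExp_mul_left (μ : ι → Ω → R) (c : R) (f : (ι → Ω) → R) :
    prodExp μ (fun ω => c * f ω) = c * prodExp μ f := by
  simp only [prodExp, Finset.mul_sum]
  exact Finset.sum_congr rfl fun ω _ => by ring

theorem prodExp_sum {κ : Type*} (s : Finset κ) (μ : ι → Ω → R) (f : κ → (ι → Ω) → R) :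
    prodExp μ (fun ω => ∑ a ∈ s, f a ω) = ∑ a ∈ s, prodExp μ (f a) := by
  simp only [prodExp, Finset.mul_sum]
  exact Finset.sum_comm

theorem prodExp_weights (μ : ι → Ω → R) (h : ∀ i, ∑ v, μ i v = 1) :
    ∑ ω : ι → Ω, ∏ i, μ i (ω i) = 1 := by
  rw [← Fintype.prod_sum]; simp [h]

theorem prodExp_const (μ : ι → Ω → R) (h : ∀ i, ∑ v, μ i v = 1) (c : R) :
    prodExp μ (fun _ => c) = c := by
  rw [prodExp, ← Finset.sum_mul, prodExp_weights μ h, one_mul]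

/-- Drawing coordinate `i` separately from the others is harmless by independence. This is the
principle of deferred decisions: a choice fixed in advance may be replaced by one made when it is
needed. -/
theorem prodExp_coord (μ : ι → Ω → R) (i : ι) (h : ∑ v, μ i v = 1) (f : (ι → Ω) → R) :
    prodExp μ f = ∑ v, μ i v * prodExp μ (fun ω => f (Function.update ω i v)) := by
  -- Fubini: a point of the product is a value at `i` together with a point of the remaining
  -- product.
  have split : ∀ F : (ι → Ω) → R, prodExp μ F =
      ∑ v, ∑ τ : {j // j ≠ i} → Ω, μ i v * (∏ j, μ j.1 (τ j)) *
        F ((Equiv.funSplitAt i Ω).symm (v, τ)) := by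
    intro F
    rw [prodExp, ← (Equiv.funSplitAt i Ω).symm.sum_comp, Fintype.sum_prod_type]
    refine Finset.sum_congr rfl fun v _ => Finset.sum_congr rfl fun τ _ => ?_
    congr 1
    rw [Fintype.prod_eq_mul_prod_compl i,
      Finset.prod_subtype ({i}ᶜ : Finset ι) (p := fun j => j ≠ i) (by simp)]
    congr 1
    · simp [Equiv.funSplitAt, Equiv.piSplitAt]
    · refine Finset.prod_congr rfl fun j _ => ?_
      have := j.2
      simp [Equiv.funSplitAt, Equiv.piSplitAt, this]
  have upd : ∀ v v' (τ : {j // j ≠ i} → Ω),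
      Function.update ((Equiv.funSplitAt i Ω).symm (v', τ)) i v
        = (Equiv.funSplitAt i Ω).symm (v, τ) := by
    intro v v' τ
    ext j
    by_cases hj : j = i
    · subst hj; simp [Equiv.funSplitAt, Equiv.piSplitAt]
    · simp [Equiv.funSplitAt, Equiv.piSplitAt, hj]
  rw [split f]
  refine Finset.sum_congr rfl fun v _ => ?_
  rw [split, Finset.mul_sum]
  simp only [upd]
  have : ∀ v', ∑ τ : {j // j ≠ i} → Ω, μ i v' * (∏ j, μ j.1 (τ j)) *
        f ((Equiv.funSplitAt i Ω).symm (v, τ)) = μ i v' * ∑ τ : {j // j ≠ i} → Ω,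
          (∏ j, μ j.1 (τ j)) * f ((Equiv.funSplitAt i Ω).symm (v, τ)) := by
    intro v'; rw [Finset.mul_sum]; exact Finset.sum_congr rfl fun _ _ => by ring
  simp only [this]
  rw [← Finset.mul_sum, ← Finset.sum_mul, h, one_mul]

theorem prodExp_marginal (μ : ι → Ω → R) (h : ∀ i, ∑ v, μ i v = 1) (i : ι) (f : Ω → R) :
    prodExp μ (fun ω => f (ω i)) = ∑ v, μ i v * f v := by
  rw [prodExp_coord μ i (h i)]
  simp [prodExp_const μ h]

/-- Two independent families become one family of pairs. This makes the group of a user and the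
answer of that user a single random variable, independent over the users. -/
theorem prodExp_prodExp {Ω' : Type*} [Fintype Ω'] (μ : ι → Ω → R) (ν : ι → Ω' → R)
    (f : (ι → Ω) → (ι → Ω') → R) :
    prodExp μ (fun ω => prodExp ν (f ω)) =
      prodExp (fun i (x : Ω × Ω') => μ i x.1 * ν i x.2)
        (fun ω => f (fun i => (ω i).1) (fun i => (ω i).2)) := by
  simp only [prodExp, Finset.mul_sum]
  rw [← (Equiv.arrowProdEquivProdArrow ι (fun _ => Ω) (fun _ => Ω')).symm.sum_comp,
    Fintype.sum_prod_type]
  refine Finset.sum_congr rfl fun ω _ => Finset.sum_congr rfl fun ω' _ => ?_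
  simp [Equiv.arrowProdEquivProdArrow, Finset.prod_mul_distrib, mul_assoc]

end ProdExp

section ProdExpOrder

variable {ι Ω : Type*} [Fintype ι] [DecidableEq ι] [Fintype Ω]

theorem prodExp_mono (μ : ι → Ω → ℝ≥0∞) {f g : (ι → Ω) → ℝ≥0∞} (h : ∀ ω, f ω ≤ g ω) :
    prodExp μ f ≤ prodExp μ g :=
  Finset.sum_le_sum fun ω _ => by gcongr; exact h ω

theorem prodExp_nonneg {p : ι → Ω → ℝ} (hp : ∀ i v, 0 ≤ p i v) {f : (ι → Ω) → ℝ}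
    (h : ∀ ω, 0 ≤ f ω) : 0 ≤ prodExp p f :=
  Finset.sum_nonneg fun ω _ => mul_nonneg (Finset.prod_nonneg fun i _ => hp i _) (h ω)

theorem prodExp_ofReal {p : ι → Ω → ℝ} (hp : ∀ i v, 0 ≤ p i v) {f : (ι → Ω) → ℝ}
    (h : ∀ ω, 0 ≤ f ω) :
    prodExp (fun i v => ENNReal.ofReal (p i v)) (fun ω => ENNReal.ofReal (f ω)) =
      ENNReal.ofReal (prodExp p f) := by
  rw [prodExp, prodExp, ENNReal.ofReal_sum_of_nonneg fun ω _ =>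
    mul_nonneg (Finset.prod_nonneg fun i _ => hp i _) (h ω)]
  refine Finset.sum_congr rfl fun ω _ => ?_
  rw [ENNReal.ofReal_mul (Finset.prod_nonneg fun i _ => hp i _),
    ENNReal.ofReal_prod_of_nonneg fun i _ => hp i _]

theorem sum_ofReal_eq_one {Ω : Type*} [Fintype Ω] {p : Ω → ℝ} (hp : ∀ v, 0 ≤ p v)
    (h : ∑ v, p v = 1) : ∑ v, ENNReal.ofReal (p v) = 1 := by
  rw [← ENNReal.ofReal_sum_of_nonneg fun v _ => hp v, h, ENNReal.ofReal_one]

/-- The mean absolute deviation of a sum of independent variables. -/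
theorem prodExp_abs_sum_le {p : ι → Ω → ℝ} (hp : ∀ i v, 0 ≤ p i v) (h1 : ∀ i, ∑ v, p i v = 1)
    (X : ι → Ω → ℝ) (β : ι → ℝ) (hβ : ∀ i, ∑ v, p i v * X i v = β i) (V : ℝ)
    (hV : ∀ i, ∑ v, p i v * X i v ^ 2 ≤ V) :
    prodExp p (fun ω => |∑ i, X i (ω i) - ∑ i, β i|) ≤ Real.sqrt (Fintype.card ι * V) := by
  set Z : ι → Ω → ℝ := fun i v => X i v - β i with hZ
  have hZ0 : ∀ i, ∑ v, p i v * Z i v = 0 := by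
    intro i
    simp only [hZ, mul_sub, Finset.sum_sub_distrib, hβ, ← Finset.sum_mul, h1, one_mul, sub_self]
  have hZ2 : ∀ i, ∑ v, p i v * Z i v ^ 2 ≤ V := by
    intro i
    have : ∑ v, p i v * Z i v ^ 2 = ∑ v, p i v * X i v ^ 2 - β i ^ 2 := by
      have e : ∀ v, p i v * Z i v ^ 2 =
          p i v * X i v ^ 2 - (2 * β i) * (p i v * X i v) + β i ^ 2 * p i v := by
        intro v; simp only [hZ]; ring
      simp only [e, Finset.sum_add_distrib, Finset.sum_sub_distrib, ← Finset.mul_sum, hβ, h1]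
      ring
    rw [this]
    nlinarith [hV i, sq_nonneg (β i)]
  have hsq : prodExp p (fun ω => (∑ i, Z i (ω i)) ^ 2) ≤ Fintype.card ι * V := by
    have e : (fun ω : ι → Ω => (∑ i, Z i (ω i)) ^ 2) =
        fun ω => ∑ i, ∑ j, Z i (ω i) * Z j (ω j) := by
      ext ω; rw [sq, Finset.sum_mul_sum]
    rw [e, prodExp_sum]
    have : ∀ i, prodExp p (fun ω => ∑ j, Z i (ω i) * Z j (ω j)) ≤ V := by
      intro i
      rw [prodExp_sum, Finset.sum_eq_single i]
      · rw [prodExp_marginal p h1 i (fun v => Z i v * Z i v)]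
        simpa only [sq] using hZ2 i
      · intro j _ hj
        -- Off the diagonal, independence and centering make the covariance vanish.
        rw [prodExp_coord p i (h1 i)]
        refine Finset.sum_eq_zero fun v _ => ?_
        simp only [Function.update_self, Function.update_of_ne hj]
        rw [prodExp_mul_left, prodExp_marginal p h1 j, hZ0]; simp
      · simp
    calc _ ≤ ∑ _i : ι, V := Finset.sum_le_sum fun i _ => this i
      _ = _ := by simp
  have hS : (fun ω : ι → Ω => |∑ i, X i (ω i) - ∑ i, β i|) = fun ω => |∑ i, Z i (ω i)| := by
    ext ω; simp [hZ, Finset.sum_sub_distrib]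
  rw [hS]
  set a := prodExp p (fun ω => |∑ i, Z i (ω i)|) with ha
  -- The variance of the absolute value is nonnegative, which gives E|S| ≤ √(E S²).
  have ha0 : 0 ≤ prodExp p (fun ω => (|∑ i, Z i (ω i)| - a) ^ 2) :=
    prodExp_nonneg hp fun ω => sq_nonneg _
  have e : (fun ω : ι → Ω => (|∑ i, Z i (ω i)| - a) ^ 2) =
      fun ω => (∑ i, Z i (ω i)) ^ 2 + ((-2 * a) * |∑ i, Z i (ω i)| + a ^ 2) := by
    ext ω; rw [sub_sq, sq_abs]; ring
  rw [e, prodExp_add, prodExp_add, prodExp_mul_left, prodExp_const p h1, ← ha] at ha0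
  exact Real.le_sqrt_of_sq_le (by nlinarith)

end ProdExpOrder

end RankAgg

namespace RankAgg

/-! ### Expected values along Markov chains -/

section Chain

variable {S : Type} (f : S → PMF S) (φ : S → ℝ≥0∞)

/-- The expectation of `φ` after `N` steps of the Markov chain `f`. -/
noncomputable def chainExp (N : ℕ) (s : S) : ℝ≥0∞ := ∑' s', iter f N s s' * φ s'

theorem PMF.tsum_pure_mul {T : Type} (a : T) (ψ : T → ℝ≥0∞) :
    ∑' x, PMF.pure a x * ψ x = ψ a := by
  rw [tsum_eq_single a]
  · simp
  · intro b hb; simp [PMF.pure_apply, hb]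

theorem PMF.tsum_bind_mul {T U : Type} (p : PMF T) (g : T → PMF U) (ψ : U → ℝ≥0∞) :
    ∑' x, p.bind g x * ψ x = ∑' a, p a * ∑' x, g a x * ψ x := by
  simp only [PMF.bind_apply, ← ENNReal.tsum_mul_right, ← ENNReal.tsum_mul_left]
  rw [ENNReal.tsum_comm]
  simp only [mul_assoc]

theorem PMF.tsum_map_mul {T U : Type} (p : PMF T) (g : T → U) (ψ : U → ℝ≥0∞) :
    ∑' x, p.map g x * ψ x = ∑' a, p a * ψ (g a) := by
  rw [PMF.map, PMF.tsum_bind_mul]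
  simp only [Function.comp, PMF.tsum_pure_mul]

theorem chainExp_zero (s : S) : chainExp f φ 0 s = φ s := PMF.tsum_pure_mul s φ

theorem chainExp_succ (N : ℕ) (s : S) :
    chainExp f φ (N + 1) s = ∑' a, f s a * chainExp f φ N a := by
  simp only [chainExp, iter, PMF.tsum_bind_mul]

variable {f φ}

theorem chainExp_succ_pure {N : ℕ} {s s' : S} (h : f s = PMF.pure s') :
    chainExp f φ (N + 1) s = chainExp f φ N s' := by
  rw [chainExp_succ, h, PMF.tsum_pure_mul]

theorem chainExp_succ_map {T : Type} {N : ℕ} {s : S} {p : PMF T} {g : T → S}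
    (h : f s = p.map g) :
    chainExp f φ (N + 1) s = ∑' a, p a * chainExp f φ N (g a) := by
  rw [chainExp_succ, h, PMF.tsum_map_mul]

/-- Halted states stay put and running states count as ⊤, so a further step can only lower the
expectation. -/
theorem chainExp_succ_le {halted : S → Prop} (h1 : ∀ s, halted s → f s = PMF.pure s)
    (h2 : ∀ s, ¬ halted s → φ s = ⊤) (N : ℕ) (s : S) :
    chainExp f φ (N + 1) s ≤ chainExp f φ N s := by
  induction N generalizing s with
  | zero =>
    by_cases h : halted s
    · rw [chainExp_succ_pure (h1 s h)]
    · rw [chainExp_zero, h2 s h]; exact le_top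
  | succ N ih =>
    rw [chainExp_succ, chainExp_succ f φ N]
    exact ENNReal.tsum_le_tsum fun a => by gcongr; exact ih a

theorem chainExp_anti {halted : S → Prop} (h1 : ∀ s, halted s → f s = PMF.pure s)
    (h2 : ∀ s, ¬ halted s → φ s = ⊤) {N N' : ℕ} (h : N ≤ N') (s : S) :
    chainExp f φ N' s ≤ chainExp f φ N s := by
  induction h with
  | refl => rfl
  | step _ ih => exact (chainExp_succ_le h1 h2 _ s).trans ih

/-- Turns a bound on an expectation into a statement about every run of positive probability. -/
theorem eq_zero_of_chainExp_eq_zero {N : ℕ} {s s' : S} (h : chainExp f φ N s = 0)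
    (hs : s' ∈ (iter f N s).support) : φ s' = 0 := by
  have := ENNReal.tsum_eq_zero.1 h s'
  exact (mul_eq_zero.1 this).resolve_left ((PMF.mem_support_iff _ _).1 hs)

end Chain

/-! ### The user program -/

/-- The user's randomized response to the question whether item `i` is ranked before item `j`,
with privacy parameter `e`. -/
def userProg : Cmd :=
  .seq (.call [.get 0 (.const 0)] [] 1 (.const 0) 1 (.const 0))
    (.seq (.call [.get 0 (.const 1)] [] 1 (.const 1) 1 (.const 1))
      (.ite (.and (.natLt (.get 1 (.const 0)) (.get 1 (.const 1)))
          (.realLt (.ofNat (.const 0)) (.get 0 (.const 0))))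
        (.flip 0 (.const 0) (.div (.add (.ofNat (.const 1)) (.get 0 (.const 0)))
          (.add (.ofNat (.const 2)) (.get 0 (.const 0)))))
        (.flip 0 (.const 0) (.div (.ofNat (.const 1))
          (.add (.ofNat (.const 2)) (.get 0 (.const 0)))))))

open Classical in
/-- The probability that a user with ranking `π` answers `1` to the message `y`. -/
noncomputable def userProb {m : ℕ} (π : Ranking m) (y : Msg) : ℝ :=
  if (rankingOracle π ([y.1.getD 0 0], [])).1 < (rankingOracle π ([y.1.getD 1 0], [])).1 ∧
    0 < y.2.getD 0 0 then (1 + y.2.getD 0 0) / (2 + y.2.getD 0 0) else 1 / (2 + y.2.getD 0 0)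

/-- The reply of a user to the message `y` when the random bit is `r`. -/
noncomputable def userReply (y : Msg) (r : Bool) : Reply := (if r then 1 else 0, y.2.getD 0 0)

section Rules

variable {n m : ℕ} (srv : Cmd) (D : Fin n → Ranking m) (φ : PState n → ℝ≥0∞)

/-- The protocol in which the users run `userProg`. -/
def rrProtocol : Protocol := ⟨srv, userProg⟩

/-- The expectation of `φ` after `N` steps of the protocol. -/
noncomputable def ev (N : ℕ) (s : PState n) : ℝ≥0∞ :=
  chainExp ((rrProtocol srv).step D) φ N s

variable {srv D φ}

theorem step_of_halted (s : PState n) (h : s.Halted) :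
    (rrProtocol srv).step D s = PMF.pure s := by
  obtain ⟨⟨code, μ, c⟩, a, E⟩ := s
  obtain ⟨h1, h2⟩ := h
  simp only at h1 h2
  subst h1 h2
  simp [Protocol.step, RankAgg.step, PMF.pure_map]

/-- The seven steps are two `seq`, two `call`, the `ite`, the `flip`, and the delivery of the reply.
The call by the server that precedes them makes eight in `ev_call_user`. -/
theorem chainExp_user {k : List Cmd} {μ : Mem} {c : ℕ} {E : List (Exchange n)} {N : ℕ}
    {u : Fin n} {y : Msg} {a b : ℕ} {i j : NExp} :
    ev srv D φ (N + 7) ⟨⟨k, μ, c⟩, some ⟨u, y, Config.start userProg y, a, i, b, j⟩, E⟩ =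
      ∑ r : Bool, coin (userProb (D u) y) r *
        ev srv D φ N ⟨⟨k, μ.store (userReply y r) a i b j, c⟩, none,
          E ++ [(u, y, userReply y r)]⟩ := by
  unfold ev
  have s1 : ∀ {M : ℕ} {s s' : PState n}, (rrProtocol srv).step D s = PMF.pure s' →
    chainExp ((rrProtocol srv).step D) φ (M + 1) s =
      chainExp ((rrProtocol srv).step D) φ M s' := fun h => chainExp_succ_pure h
  rw [s1 (s' := ⟨⟨k, μ, c⟩, some ⟨u, y, ⟨_, _, _⟩, a, i, b, j⟩, E⟩)
    (by simp only [Config.start, userProg, Protocol.step, List.isEmpty_cons, RankAgg.step,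
        PMF.pure_map]; rfl)]
  rw [s1 (s' := ⟨⟨k, μ, c⟩, some ⟨u, y, ⟨_, _, _⟩, a, i, b, j⟩, E⟩)
    (by simp only [Protocol.step, List.isEmpty_cons, RankAgg.step,
        PMF.pure_map]; rfl)]
  rw [s1 (s' := ⟨⟨k, μ, c⟩, some ⟨u, y, ⟨_, _, _⟩, a, i, b, j⟩, E⟩)
    (by simp only [Protocol.step, List.isEmpty_cons, RankAgg.step,
        PMF.pure_map]; rfl)]
  rw [s1 (s' := ⟨⟨k, μ, c⟩, some ⟨u, y, ⟨_, _, _⟩, a, i, b, j⟩, E⟩)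
    (by simp only [Protocol.step, List.isEmpty_cons, RankAgg.step,
        PMF.pure_map]; rfl)]
  rw [s1 (s' := ⟨⟨k, μ, c⟩, some ⟨u, y, ⟨_, _, _⟩, a, i, b, j⟩, E⟩)
    (by simp only [Protocol.step, List.isEmpty_cons, RankAgg.step,
        PMF.pure_map]; rfl)]
  -- From here on only three cells of the user's memory matter: the parameter and the two positions.
  generalize hμ : (((Mem.init y).store _ _ _ _ _).store _ _ _ _ _) = μu
  have e0 : μu.real 0 0 = y.2.getD 0 0 := by
    subst hμ; simp [Mem.store, Mem.setReal, Mem.setNat, Mem.init]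
  have n0 : μu.nat 1 0 = (rankingOracle (D u) ([y.1.getD 0 0], [])).1 := by
    subst hμ
    simp [Mem.store, Mem.setReal, Mem.setNat, Mem.init, NExp.eval, message, rankingOracle]
  have n1 : μu.nat 1 1 = (rankingOracle (D u) ([y.1.getD 1 0], [])).1 := by
    subst hμ
    simp [Mem.store, Mem.setReal, Mem.setNat, Mem.init, NExp.eval, message, rankingOracle]
  have fin : ∀ p : RExp, p.eval μu = userProb (D u) y →
      chainExp ((rrProtocol srv).step D) φ (N + 2)
        ⟨⟨k, μ, c⟩, some ⟨u, y, ⟨[.flip 0 (.const 0) p], μu, 2⟩, a, i, b, j⟩, E⟩ =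
      ∑ r : Bool, coin (userProb (D u) y) r *
        chainExp ((rrProtocol srv).step D) φ N ⟨⟨k, μ.store (userReply y r) a i b j, c⟩, none,
          E ++ [(u, y, userReply y r)]⟩ := by
    intro p hp
    rw [chainExp_succ_map (p := coin (userProb (D u) y))
      (g := fun r => ⟨⟨k, μ, c⟩, some ⟨u, y, ⟨[], μu.setNat 0 0 (if r then 1 else 0), 2⟩,
        a, i, b, j⟩, E⟩)
      (by simp only [Protocol.step, List.isEmpty_cons, RankAgg.step, PMF.map_comp, hp]; rfl),
      tsum_fintype]
    refine Finset.sum_congr rfl fun r _ => ?_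
    congr 1
    rw [s1]
    simp [Protocol.step, Mem.setNat, e0, userReply]
  split_ifs with h
  · refine fin _ ?_
    simp only [BExp.eval, NExp.eval, RExp.eval, n0, n1, e0, Nat.cast_zero] at h
    simp only [RExp.eval, NExp.eval, e0, userProb, if_pos h]; norm_num
  · refine fin _ ?_
    simp only [BExp.eval, NExp.eval, RExp.eval, n0, n1, e0, Nat.cast_zero] at h
    simp only [RExp.eval, NExp.eval, e0, userProb, if_neg h]; norm_num

theorem ev_call_user {k : List Cmd} {μ : Mem} {c : ℕ} {E : List (Exchange n)} {N : ℕ}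
    {xs : List NExp} {rs : List RExp} {a b : ℕ} {i j : NExp}
    (u : Fin n) (hu : (message μ xs rs).1.headD 0 = u) :
    ev srv D φ (N + 8) ⟨⟨.call xs rs a i b j :: k, μ, c⟩, none, E⟩ =
      ∑ r : Bool, coin (userProb (D u) ((message μ xs rs).1.tail, (message μ xs rs).2)) r *
        ev srv D φ N ⟨⟨k, μ.store (userReply ((message μ xs rs).1.tail, (message μ xs rs).2) r)
          a i b j, c + 1⟩, none, E ++ [(u, ((message μ xs rs).1.tail, (message μ xs rs).2),
            userReply ((message μ xs rs).1.tail, (message μ xs rs).2) r)]⟩ := by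
  rw [← chainExp_user, ev, chainExp_succ_pure, ev]
  have : (message μ xs rs).1.headD 0 < n := hu ▸ u.2
  simp only [Protocol.step, dif_pos this, rrProtocol]
  have e : (⟨(message μ xs rs).1.headD 0, this⟩ : Fin n) = u := Fin.ext hu
  rw [e]

/-- A server command that is not a call is executed as if there were no users. -/
theorem step_server {k : List Cmd} {μ : Mem} {c : ℕ} {E : List (Exchange n)} {cmd : Cmd}
    (h : ∀ xs rs a i b j, cmd ≠ .call xs rs a i b j) :
    (rrProtocol srv).step D ⟨⟨cmd :: k, μ, c⟩, none, E⟩ =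
      (RankAgg.step (fun _ => (0, 0)) ⟨cmd :: k, μ, c⟩).map fun c => ⟨c, none, E⟩ := by
  cases cmd <;> first | exact absurd rfl (h _ _ _ _ _ _) | rfl

end Rules

/-! ### Upper bounds for the expected value, for the states in which the server is active -/

section Bounds

variable {n m : ℕ} (srv : Cmd) (D : Fin n → Ranking m) (φ : PState n → ℝ≥0∞)

/-- The memory of the server, and the exchanges so far. -/
abbrev SState (n : ℕ) := Mem × List (Exchange n)

/-- The expectation of `φ` after `N` steps when the server starts to execute the commands `k`,
maximized over the irrelevant number of calls made before. -/
noncomputable def W (N : ℕ) (k : List Cmd) (s : SState n) : ℝ≥0∞ :=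
  ⨆ c, ev srv D φ N ⟨⟨k, s.1, c⟩, none, s.2⟩

variable {srv D φ}
variable {N : ℕ} {k : List Cmd} {s : SState n}

/-- Unused time may be discarded, so that branches of different lengths can share one time bound. -/
theorem W_anti (hφ : ∀ s, ¬ s.Halted → φ s = ⊤) {N N' : ℕ} (h : N ≤ N') :
    W srv D φ N' k s ≤ W srv D φ N k s :=
  iSup_mono fun _ => chainExp_anti step_of_halted hφ h _

theorem W_pure {cmd : Cmd} {k' : List Cmd} {μ : Mem}
    (h : ∀ xs rs a i b j, cmd ≠ .call xs rs a i b j)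
    (hs : ∀ c, RankAgg.step (fun _ => (0, 0)) ⟨cmd :: k, s.1, c⟩ = PMF.pure ⟨k', μ, c⟩) :
    W srv D φ (N + 1) (cmd :: k) s ≤ W srv D φ N k' (μ, s.2) := by
  refine iSup_le fun c => le_iSup_of_le c ?_
  rw [ev, chainExp_succ_pure, ev]
  rw [step_server h, hs, PMF.pure_map]

theorem W_skip : W srv D φ (N + 1) (.skip :: k) s ≤ W srv D φ N k s :=
  W_pure (by simp) fun c => rfl

theorem W_setNat {a : ℕ} {i e : NExp} : W srv D φ (N + 1) (.setNat a i e :: k) s ≤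
    W srv D φ N k (s.1.setNat a (i.eval s.1) (e.eval s.1), s.2) :=
  W_pure (by simp) fun c => rfl

theorem W_setReal {a : ℕ} {i : NExp} {e : RExp} : W srv D φ (N + 1) (.setReal a i e :: k) s ≤
    W srv D φ N k (s.1.setReal a (i.eval s.1) (e.eval s.1), s.2) :=
  W_pure (by simp) fun c => rfl

theorem W_seq {c d : Cmd} : W srv D φ (N + 1) (.seq c d :: k) s ≤ W srv D φ N (c :: d :: k) s :=
  W_pure (by simp) fun c => rfl

theorem W_ite_pos {b : BExp} {c d : Cmd} (h : b.eval s.1) :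
    W srv D φ (N + 1) (.ite b c d :: k) s ≤ W srv D φ N (c :: k) s :=
  W_pure (by simp) fun _ => by simp [RankAgg.step, h]

theorem W_ite_neg {b : BExp} {c d : Cmd} (h : ¬ b.eval s.1) :
    W srv D φ (N + 1) (.ite b c d :: k) s ≤ W srv D φ N (d :: k) s :=
  W_pure (by simp) fun _ => by simp [RankAgg.step, h]

theorem W_while_pos {b : BExp} {c : Cmd} (h : b.eval s.1) :
    W srv D φ (N + 1) (.while b c :: k) s ≤ W srv D φ N (c :: .while b c :: k) s :=
  W_pure (by simp) fun _ => by simp [RankAgg.step, h]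

theorem W_while_neg {b : BExp} {c : Cmd} (h : ¬ b.eval s.1) :
    W srv D φ (N + 1) (.while b c :: k) s ≤ W srv D φ N k s :=
  W_pure (by simp) fun _ => by simp [RankAgg.step, h]

theorem W_flip {a : ℕ} {i : NExp} {p : RExp} : W srv D φ (N + 1) (.flip a i p :: k) s ≤
    ∑ r : Bool, coin (p.eval s.1) r *
      W srv D φ N k (s.1.setNat a (i.eval s.1) (if r then 1 else 0), s.2) := by
  refine iSup_le fun c => ?_
  rw [ev, chainExp_succ_map (p := coin (p.eval s.1))
    (g := fun r => ⟨⟨k, s.1.setNat a (i.eval s.1) (if r then 1 else 0), c⟩, none, s.2⟩)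
    (by rw [step_server (by simp), RankAgg.step, PMF.map_comp]; rfl), tsum_fintype]
  refine Finset.sum_le_sum fun r _ => ?_
  gcongr
  exact le_iSup (fun c => ev srv D φ N ⟨⟨k, s.1.setNat a (i.eval s.1) (if r then 1 else 0), c⟩,
    none, s.2⟩) c

theorem W_call {xs : List NExp} {rs : List RExp} {a b : ℕ} {i j : NExp}
    (u : Fin n) {y : Msg} (hx : message s.1 xs rs = ((u : ℕ) :: y.1, y.2)) :
    W srv D φ (N + 8) (.call xs rs a i b j :: k) s ≤
      ∑ r : Bool, coin (userProb (D u) y) r *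
        W srv D φ N k (s.1.store (userReply y r) a i b j, s.2 ++ [(u, y, userReply y r)]) := by
  refine iSup_le fun c => ?_
  rw [ev_call_user u (by simp [hx])]
  simp only [hx, List.tail_cons]
  refine Finset.sum_le_sum fun r _ => ?_
  gcongr
  exact le_iSup (fun c => ev srv D φ N ⟨⟨k, s.1.store (userReply y r) a i b j, c⟩,
    none, s.2 ++ [(u, y, userReply y r)]⟩) (c + 1)

end Bounds

end RankAgg

namespace RankAgg

/-! ### Privacy of randomized response protocols -/

section ChainLimits

variable {S : Type} {f : S → PMF S} {φ : S → ℝ≥0∞}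

theorem iter_of_pure {s : S} (h : f s = PMF.pure s) (N : ℕ) : iter f N s = PMF.pure s := by
  induction N with
  | zero => rfl
  | succ N ih => rw [iter, h, PMF.pure_bind, ih]

theorem iter_add (a b : ℕ) (s : S) : iter f (a + b) s = (iter f a s).bind (iter f b) := by
  induction a generalizing s with
  | zero => simp [iter, PMF.pure_bind]
  | succ a ih =>
    rw [Nat.add_right_comm, iter, iter, PMF.bind_bind]
    congr 1; ext1 x; exact ih x

/-- Allows comparing runs of different lengths, as the privacy proof gives the neighboring data set
more time. -/
theorem iter_eq_of_halted {T N : ℕ} (h : T ≤ N) {s : S}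
    (hs : ∀ s' ∈ (iter f T s).support, f s' = PMF.pure s') : iter f N s = iter f T s := by
  obtain ⟨d, rfl⟩ := Nat.exists_eq_add_of_le h
  rw [iter_add]
  ext x
  rw [PMF.bind_apply]
  conv_rhs => rw [← PMF.bind_pure (iter f T s), PMF.bind_apply]
  refine tsum_congr fun a => ?_
  by_cases ha : a ∈ (iter f T s).support
  · rw [iter_of_pure (hs a ha)]
  · rw [(PMF.apply_eq_zero_iff _ _).2 ha, zero_mul, zero_mul]

/-- The counterpart of `chainExp_succ_le`: when running states count as 0, more time can only raise
the expectation. -/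
theorem le_chainExp_succ {halted : S → Prop} (h1 : ∀ s, halted s → f s = PMF.pure s)
    (h2 : ∀ s, ¬ halted s → φ s = 0) (N : ℕ) (s : S) :
    chainExp f φ N s ≤ chainExp f φ (N + 1) s := by
  induction N generalizing s with
  | zero =>
    by_cases h : halted s
    · rw [chainExp_succ_pure (h1 s h)]
    · rw [chainExp_zero, h2 s h]; exact zero_le
  | succ N ih =>
    rw [chainExp_succ, chainExp_succ f φ (N + 1)]
    exact ENNReal.tsum_le_tsum fun a => by gcongr; exact ih a

theorem chainExp_mono {halted : S → Prop} (h1 : ∀ s, halted s → f s = PMF.pure s)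
    (h2 : ∀ s, ¬ halted s → φ s = 0) {N N' : ℕ} (h : N ≤ N') (s : S) :
    chainExp f φ N s ≤ chainExp f φ N' s := by
  induction h with
  | refl => rfl
  | step _ ih => exact ih.trans (le_chainExp_succ h1 h2 _ s)

end ChainLimits

/-- The factor by which the distribution of the answer to the message `y` may change. -/
noncomputable def factor (y : Msg) : ℝ≥0∞ := ENNReal.ofReal (1 + max (y.2.getD 0 0) 0)

/-- The factor by which the probability of the exchanges `E` may depend on the data of user `k`. -/
noncomputable def loss {n : ℕ} (k : Fin n) (E : List (Exchange n)) : ℝ≥0∞ :=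
  (E.map fun x => if x.1 = k then factor x.2.1 else 1).prod

theorem loss_nil {n : ℕ} (k : Fin n) : loss k [] = 1 := rfl

theorem loss_append {n : ℕ} (k u : Fin n) (E : List (Exchange n)) (y : Msg) (r : Reply) :
    loss k (E ++ [(u, y, r)]) = loss k E * if u = k then factor y else 1 := by
  simp [loss]

theorem coin_apply {p : ℝ} (h0 : 0 ≤ p) (h1 : p ≤ 1) (r : Bool) :
    coin p r = ENNReal.ofReal (if r then p else 1 - p) := by
  simp [coin, h0, h1]

/-- For a positive parameter `e`, each answer has probability between 1/(2+e) and (1+e)/(2+e)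
whatever the ranking, and these bounds have ratio 1+e. For any other number sent by the server the
coin does not depend on the ranking, so nothing is lost. -/
theorem coin_userProb_le {m : ℕ} (π π' : Ranking m) (y : Msg) (r : Bool) :
    coin (userProb π y) r ≤ factor y * coin (userProb π' y) r := by
  rcases le_or_gt (y.2.getD 0 0) 0 with he | he
  · have : factor y = 1 := by simp only [factor, max_eq_right he]; simp
    have hp : ∀ π : Ranking m, userProb π y = 1 / (2 + y.2.getD 0 0) := fun π => by
      rw [userProb, if_neg (fun h => absurd h.2 he.not_gt)]
    rw [this, hp, hp, one_mul]
  · set e := y.2.getD 0 0 with hE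
    have hf : factor y = ENNReal.ofReal (1 + e) := by rw [factor, ← hE, max_eq_left he.le]
    have h2 : (0 : ℝ) < 2 + e := by linarith
    have lo : 1 / (2 + e) ≤ (1 + e) / (2 + e) := by gcongr; linarith
    have su : 1 - (1 + e) / (2 + e) = 1 / (2 + e) := by field_simp; ring
    have su' : 1 - 1 / (2 + e) = (1 + e) / (2 + e) := by field_simp; ring
    have lpos : 0 < 1 / (2 + e) := by positivity
    have hp : ∀ π : Ranking m, userProb π y = (1 + e) / (2 + e) ∨
        userProb π y = 1 / (2 + e) := fun π => by
      rw [userProb, ← hE]; split_ifs <;> simp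
    have bd : ∀ π : Ranking m, ∃ x, 1 / (2 + e) ≤ x ∧ x ≤ (1 + e) / (2 + e) ∧
        coin (userProb π y) r = ENNReal.ofReal x := by
      intro π
      rcases hp π with h | h <;> rw [h, coin_apply (by positivity) (by linarith)] <;>
        refine ⟨_, ?_, ?_, rfl⟩ <;> cases r <;> simp only [su, su', if_true] <;>
        simp <;> simpa using lo
    obtain ⟨x, _, hx, ex⟩ := bd π
    obtain ⟨x', hx', _, ex'⟩ := bd π'
    rw [ex, ex', hf, ← ENNReal.ofReal_mul (by linarith)]
    refine ENNReal.ofReal_le_ofReal (hx.trans ?_)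
    calc (1 + e) / (2 + e) = (1 + e) * (1 / (2 + e)) := by ring
      _ ≤ _ := by gcongr

section DP

variable {n m : ℕ} {srv : Cmd} {D D' : Fin n → Ranking m}

/-- The two executions are compared command by command of the server. They differ only in the coins
of user `k`, and each such coin costs the factor that `loss` records. The factor 8 in the time
arises because one step may be a call, which is followed up to the user's reply; values that vanish
on running states make the extra time harmless. -/
theorem loss_mul_ev_le {k : Fin n} (hD : ∀ l, l ≠ k → D l = D' l) (φ : PState n → ℝ≥0∞)
    (hφ : ∀ s, ¬ s.Halted → φ s = 0) (N : ℕ) (S : Config) (E : List (Exchange n)) :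
    loss k E * ev srv D φ N ⟨S, none, E⟩ ≤
      ev srv D' (fun s => loss k s.exchanges * φ s) (8 * N) ⟨S, none, E⟩ := by
  have hφ' : ∀ s : PState n, ¬ s.Halted → loss k s.exchanges * φ s = 0 :=
    fun s hs => by rw [hφ s hs, mul_zero]
  have up : ∀ (D : Fin n → Ranking m) (ψ : PState n → ℝ≥0∞), (∀ s, ¬ s.Halted → ψ s = 0) →
      ∀ {N N' : ℕ}, N ≤ N' → ∀ s, ev srv D ψ N s ≤ ev srv D ψ N' s :=
    fun D ψ hψ _ _ h s => chainExp_mono step_of_halted hψ h s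
  induction N generalizing S E with
  | zero => simp [ev, chainExp_zero]
  | succ N ih =>
    obtain ⟨code, μ, c⟩ := S
    cases code with
    | nil =>
      have h : ∀ D : Fin n → Ranking m, (rrProtocol srv).step D ⟨⟨[], μ, c⟩, none, E⟩ =
        PMF.pure ⟨⟨[], μ, c⟩, none, E⟩ := fun D => step_of_halted _ ⟨rfl, rfl⟩
      refine le_trans ?_ (up D' _ hφ' (N := 8 * N + 1) (by omega) _)
      rw [ev, chainExp_succ_pure (h D), ev, chainExp_succ_pure (h D')]
      exact ih _ _
    | cons cmd rest =>
      by_cases hc : ∃ xs rs a i b j, cmd = .call xs rs a i b j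
      · obtain ⟨xs, rs, a, i, b, j, rfl⟩ := hc
        by_cases hu : (message μ xs rs).1.headD 0 < n
        · obtain ⟨u, hu'⟩ : ∃ u : Fin n, (message μ xs rs).1.headD 0 = u := ⟨⟨_, hu⟩, rfl⟩
          -- The time is extended so that the call and the user's whole computation fit into it.
          refine le_trans (mul_le_mul_right (up D φ hφ (N' := N + 8) (by omega) _) _) ?_
          rw [Nat.mul_add, ev_call_user u hu', mul_one, ev_call_user u hu', Finset.mul_sum]
          refine Finset.sum_le_sum fun r _ => ?_
          set y : Msg := ((message μ xs rs).1.tail, (message μ xs rs).2)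
          have key : loss k E * coin (userProb (D u) y) r ≤
              coin (userProb (D' u) y) r * loss k (E ++ [(u, y, userReply y r)]) := by
            rw [loss_append]
            by_cases huk : u = k
            · rw [if_pos huk, mul_left_comm, mul_comm (coin _ r)]
              gcongr
              exact coin_userProb_le _ _ _ _
            · rw [if_neg huk, hD u huk, mul_one, mul_comm]
          rw [← mul_assoc]
          refine (mul_le_mul_left key _).trans ?_
          rw [mul_assoc]
          gcongr
          exact ih _ _
        · have h : ∀ D : Fin n → Ranking m,
            (rrProtocol srv).step D ⟨⟨.call xs rs a i b j :: rest, μ, c⟩, none, E⟩ =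
            PMF.pure ⟨⟨rest, μ.store (0, 0) a i b j, c + 1⟩, none, E⟩ :=
            fun D => by simp only [Protocol.step, dif_neg hu]
          refine le_trans ?_ (up D' _ hφ' (N := 8 * N + 1) (by omega) _)
          rw [ev, chainExp_succ_pure (h D), ev, chainExp_succ_pure (h D')]
          exact ih _ _
      · push Not at hc
        refine le_trans ?_ (up D' _ hφ' (N := 8 * N + 1) (by omega) _)
        rw [ev, chainExp_succ_map (step_server hc), ev, chainExp_succ_map (step_server hc),
          ← ENNReal.tsum_mul_left]
        refine ENNReal.tsum_le_tsum fun a => ?_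
        rw [mul_left_comm]
        gcongr
        exact ih _ _

/-- It suffices to bound the accumulated loss on every possible run, for then the factor in
`loss_mul_ev_le` is at most exp ε. -/
theorem isPureDP_transcript {t : ℕ → ℕ} {q : ℕ} {ε : ℝ}
    (h : ∀ D : Fin n → Ranking m, ∀ s ∈ ((rrProtocol srv).run q ε D (t (n + m))).support,
      s.Halted ∧ ∀ k, loss k s.exchanges ≤ ENNReal.ofReal (Real.exp ε)) :
    IsPureDP (fun D : Fin n → Ranking m => (rrProtocol srv).transcript t q ε D) ε := by
  classical
  rintro D D' ⟨k, hk⟩ X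
  set T := t (n + m)
  set s0 : PState n := ⟨Config.start srv ([m, n, q], [ε]), none, []⟩ with hs0
  -- Requiring `Halted` makes the indicator vanish on running states; on the support at time `T` the
  -- requirement is automatic.
  set φ : PState n → ℝ≥0∞ := fun s =>
    if s.Halted ∧ (s.exchanges, readRanking m s.server.mem) ∈ X then 1 else 0
  have prob : ∀ D : Fin n → Ranking m,
      ((rrProtocol srv).transcript t q ε D).toOuterMeasure X = ev srv D φ T s0 := by
    intro D
    rw [Protocol.transcript, PMF.toOuterMeasure_map_apply, PMF.toOuterMeasure_apply]
    refine tsum_congr fun s => ?_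
    by_cases hs : s ∈ ((rrProtocol srv).run q ε D T).support
    · have hH := (h D s hs).1
      rw [Set.indicator_apply]
      simp only [φ, hH, true_and, Set.mem_preimage]
      split_ifs
      · rw [mul_one]; rfl
      · rw [mul_zero]
    · rw [Set.indicator_apply, (PMF.apply_eq_zero_iff _ _).2 hs, ite_self]
      have : iter ((rrProtocol srv).step D) T s0 s = 0 := (PMF.apply_eq_zero_iff _ _).2 hs
      rw [this, zero_mul]
  simp only [prob]
  have h1 := loss_mul_ev_le (srv := srv) hk φ (fun s hs => if_neg fun h => hs h.1) T
    (Config.start srv ([m, n, q], [ε])) []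
  rw [loss_nil, one_mul] at h1
  refine h1.trans ?_
  have e : iter ((rrProtocol srv).step D') (8 * T) s0 = iter ((rrProtocol srv).step D') T s0 :=
    iter_eq_of_halted (by omega) fun s hs => step_of_halted s (h D' s hs).1
  rw [ev, chainExp, ← hs0, e, ev, chainExp, ← ENNReal.tsum_mul_left]
  refine ENNReal.tsum_le_tsum fun s => ?_
  rw [← mul_assoc, ← mul_assoc]
  gcongr ?_ * _
  by_cases hs : s ∈ ((rrProtocol srv).run q ε D' T).support
  · rw [mul_comm]; gcongr; exact (h D' s hs).2 k
  · have : iter ((rrProtocol srv).step D') T s0 s = 0 := (PMF.apply_eq_zero_iff _ _).2 hs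
    rw [this]; simp

end DP

end RankAgg

namespace RankAgg

/-! ### Loops, uniform sampling and polling -/

@[simp] theorem Mem.setNat_nat (μ : Mem) (a i v b j : ℕ) :
    (μ.setNat a i v).nat b j = if b = a ∧ j = i then v else μ.nat b j := rfl

@[simp] theorem Mem.setNat_real (μ : Mem) (a i v : ℕ) : (μ.setNat a i v).real = μ.real := rfl

@[simp] theorem Mem.setReal_real (μ : Mem) (a i : ℕ) (v : ℝ) (b j : ℕ) :
    (μ.setReal a i v).real b j = if b = a ∧ j = i then v else μ.real b j := rfl

@[simp] theorem Mem.setReal_nat (μ : Mem) (a i : ℕ) (v : ℝ) : (μ.setReal a i v).nat = μ.nat := rfl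

/-- The memories agree outside the natural arrays `A` and the real arrays `B`. -/
def Frame (A B : List ℕ) (μ μ' : Mem) : Prop :=
  (∀ a ∉ A, ∀ i, μ'.nat a i = μ.nat a i) ∧ ∀ a ∉ B, ∀ i, μ'.real a i = μ.real a i

theorem Frame.refl (A B : List ℕ) (μ : Mem) : Frame A B μ μ := ⟨fun _ _ _ => rfl, fun _ _ _ => rfl⟩

theorem Frame.trans {A B : List ℕ} {μ₁ μ₂ μ₃ : Mem} (h : Frame A B μ₁ μ₂) (h' : Frame A B μ₂ μ₃) :
    Frame A B μ₁ μ₃ :=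
  ⟨fun a ha i => (h'.1 a ha i).trans (h.1 a ha i), fun a ha i => (h'.2 a ha i).trans (h.2 a ha i)⟩

theorem Frame.mono {A B A' B' : List ℕ} {μ μ' : Mem} (h : Frame A B μ μ') (hA : A ⊆ A')
    (hB : B ⊆ B') : Frame A' B' μ μ' :=
  ⟨fun a ha => h.1 a fun h => ha (hA h), fun a ha => h.2 a fun h => ha (hB h)⟩

theorem Frame.setNat {A B : List ℕ} {μ μ' : Mem} (h : Frame A B μ μ') {a i v : ℕ} (ha : a ∈ A) :
    Frame A B μ (μ'.setNat a i v) := by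
  refine ⟨fun b hb j => ?_, h.2⟩
  rw [Mem.setNat_nat, if_neg fun e : b = a ∧ j = i => hb (e.1 ▸ ha), h.1 b hb j]

theorem Frame.setReal {A B : List ℕ} {μ μ' : Mem} (h : Frame A B μ μ') {a i : ℕ} {v : ℝ}
    (ha : a ∈ B) : Frame A B μ (μ'.setReal a i v) := by
  refine ⟨h.1, fun b hb j => ?_⟩
  rw [Mem.setReal_real, if_neg fun e : b = a ∧ j = i => hb (e.1 ▸ ha), h.2 b hb j]

/-- The variable stored in the first cell of the natural array `a`. -/
abbrev NExp.var (a : ℕ) : NExp := .get a (.const 0)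

/-- Execute `body` for all values of the variable `v` smaller than the variable `bd`. -/
def forLoop (v bd : ℕ) (body : Cmd) : Cmd :=
  .seq (.setNat v (.const 0) (.const 0))
    (.while (.natLt (.var v) (.var bd))
      (.seq body (.setNat v (.const 0) (.add (.var v) (.const 1)))))

section Loops

variable {n m : ℕ} {srv : Cmd} {D : Fin n → Ranking m} {φ : PState n → ℝ≥0∞}

/-- The invariant carries the bound `x` along with the state, so the bound may change with the
random choices of earlier rounds. A round costs three steps besides its body: the test, the `seq`
and the increment. Three more are spent on entering and leaving the loop. -/
theorem W_forLoop {v bd b tb : ℕ} {body : Cmd} (I : ℕ → SState n → ℝ≥0∞ → Prop)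
    (hbd : ∀ t s x, I t s x → s.1.nat bd 0 = b)
    (hbody : ∀ t < b, ∀ s x, I t s x → s.1.nat v 0 = t → ∀ N k,
      (∀ s' x', I (t + 1) (s'.1.setNat v 0 (t + 1), s'.2) x' → s'.1.nat v 0 = t →
        W srv D φ N k s' ≤ x') → W srv D φ (N + tb) (body :: k) s ≤ x)
    {s : SState n} {x : ℝ≥0∞} (h0 : I 0 (s.1.setNat v 0 0, s.2) x) {N : ℕ} {k : List Cmd}
    (hk : ∀ s' x', I b s' x' → s'.1.nat v 0 = b → W srv D φ N k s' ≤ x') :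
    W srv D φ (N + (3 + b * (tb + 3))) (forLoop v bd body :: k) s ≤ x := by
  set wh : Cmd := .while (.natLt (.var v) (.var bd))
      (.seq body (.setNat v (.const 0) (.add (.var v) (.const 1)))) with hwh
  have main : ∀ d t, t + d = b → ∀ s x, I t s x → s.1.nat v 0 = t →
      W srv D φ (N + 1 + d * (tb + 3)) (wh :: k) s ≤ x := by
    intro d
    induction d with
    | zero =>
      intro t ht s x hI hv
      obtain rfl : t = b := by omega
      rw [Nat.zero_mul, Nat.add_zero]
      refine (W_while_neg ?_).trans (hk s x hI hv)
      simp [BExp.eval, NExp.eval, hv, hbd _ _ _ hI]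
    | succ d ih =>
      intro t ht s x hI hv
      have e : N + 1 + (d + 1) * (tb + 3) = (N + 1 + d * (tb + 3) + 1 + tb) + 1 + 1 := by ring
      rw [e]
      refine (W_while_pos ?_).trans (W_seq.trans (hbody t (by omega) s x hI hv _ _ ?_))
      · simp only [BExp.eval, NExp.eval, hv, hbd _ _ _ hI]; omega
      · intro s' x' hI' hv'
        refine W_setNat.trans (ih (t + 1) (by omega) _ x' ?_ ?_)
        · simpa [NExp.eval, hv'] using hI'
        · simp [NExp.eval, hv']
  have e : N + (3 + b * (tb + 3)) = (N + 1 + b * (tb + 3)) + 1 + 1 := by ring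
  rw [e]
  refine W_seq.trans (W_setNat.trans (main b 0 (by omega) _ x h0 ?_))
  simp [NExp.eval]

variable (srv D φ)

/-- From state `s`, the command `c` draws `v` with weight `μ v` and ends in a state satisfying
`Post v` within `t` steps. -/
def Spec (t : ℕ) (c : Cmd) (s : SState n) {Ω : Type} [Fintype Ω] (μ : Ω → ℝ≥0∞)
    (Post : Ω → SState n → Prop) : Prop :=
  ∀ N k (f : Ω → ℝ≥0∞), (∀ v s', Post v s' → W srv D φ N k s' ≤ f v) →
    W srv D φ (N + t) (c :: k) s ≤ ∑ v, μ v * f v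

/-- From state `s`, the command `c` ends in a state satisfying `Post` within `t` steps. -/
def Det (t : ℕ) (c : Cmd) (s : SState n) (Post : SState n → Prop) : Prop :=
  ∀ N k x, (∀ s', Post s' → W srv D φ N k s' ≤ x) → W srv D φ (N + t) (c :: k) s ≤ x

variable {srv D φ}

/-- After `t` rounds the bound is the expectation over the coordinates that are still to be drawn,
the first `t` being frozen. A round draws one coordinate, and `prodExp_coord` says that the bound is
preserved on average. -/
theorem spec_forLoop {v bd b tb : ℕ} {body : Cmd} {Ω : Type} [Fintype Ω]
    (μ : Fin b → Ω → ℝ≥0∞) (hμ : ∀ t, ∑ x, μ t x = 1) (I : ℕ → (Fin b → Ω) → SState n → Prop)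
    (hbd : ∀ t ω s, I t ω s → s.1.nat bd 0 = b)
    (hbody : ∀ (t : Fin b) ω s, I t ω s → s.1.nat v 0 = t → Spec srv D φ tb body s (μ t)
      fun x s' => s'.1.nat v 0 = t ∧
        I (t + 1) (Function.update ω t x) (s'.1.setNat v 0 (t + 1), s'.2))
    {s : SState n} (h0 : ∀ ω, I 0 ω (s.1.setNat v 0 0, s.2)) :
    Spec srv D φ (3 + b * (tb + 3)) (forLoop v bd body) s (fun ω => ∏ t, μ t (ω t))
      fun ω s' => I b ω s' := by
  intro N k f hf
  set mrg : ℕ → (Fin b → Ω) → (Fin b → Ω) → Fin b → Ω :=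
    fun t ω ω' i => if (i : ℕ) < t then ω i else ω' i with hmrg
  -- If there is no outcome at all, then some round has an empty range of values, whose weights
  -- cannot sum to 1.
  rcases isEmpty_or_nonempty (Fin b → Ω) with hE | ⟨⟨ω0⟩⟩
  · obtain ⟨t⟩ : Nonempty (Fin b) := by
      by_contra h
      rw [not_nonempty_iff] at h
      exact hE.false fun i => (h.false i).elim
    have : IsEmpty Ω := ⟨fun x => hE.false fun _ => x⟩
    simpa using hμ t
  refine W_forLoop (fun t s x => ∃ ω, I t ω s ∧ x = prodExp μ fun ω' => f (mrg t ω ω')) ?_ ?_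
    (h0 := ⟨ω0, h0 ω0, ?_⟩) ?_
  · rintro t s x ⟨ω, hI, -⟩; exact hbd _ _ _ hI
  · rintro t ht s x ⟨ω, hI, rfl⟩ hv N k hk
    rw [prodExp_coord μ ⟨t, ht⟩ (hμ _)]
    refine hbody ⟨t, ht⟩ ω s hI hv N k _ fun x s' ⟨hv', hI'⟩ => ?_
    refine hk s' _ ⟨_, hI', ?_⟩ hv'
    congr 1; ext ω'; congr 1; ext i
    simp only [hmrg]
    rcases lt_trichotomy (i : ℕ) t with h | h | h
    · rw [if_pos h, if_pos (by omega), Function.update_of_ne (Fin.ne_of_val_ne h.ne)]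
    · obtain rfl : i = ⟨t, ht⟩ := Fin.ext h
      simp
    · rw [if_neg (by omega), if_neg (by omega), Function.update_of_ne (Fin.ne_of_val_ne h.ne')]
  · simp [hmrg, prodExp]
  · rintro s' x' ⟨ω, hI, rfl⟩ -
    refine (hf ω s' hI).trans (le_of_eq ?_)
    have : ∀ ω', mrg b ω ω' = ω := fun ω' => funext fun i => if_pos i.2
    simp only [this, prodExp_const μ hμ]

theorem det_forLoop {v bd b tb : ℕ} {body : Cmd} (I : ℕ → SState n → Prop)
    (hbd : ∀ t s, I t s → s.1.nat bd 0 = b)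
    (hbody : ∀ t < b, ∀ s, I t s → s.1.nat v 0 = t → Det srv D φ tb body s
      fun s' => s'.1.nat v 0 = t ∧ I (t + 1) (s'.1.setNat v 0 (t + 1), s'.2))
    {s : SState n} (h0 : I 0 (s.1.setNat v 0 0, s.2)) :
    Det srv D φ (3 + b * (tb + 3)) (forLoop v bd body) s (I b) := by
  intro N k x hx
  refine W_forLoop (fun t s y => I t s ∧ y = x) (fun t s x h => hbd t s h.1) ?_ ⟨h0, rfl⟩ ?_
  · rintro t ht s x ⟨hI, rfl⟩ hv N k hk
    exact hbody t ht s hI hv N k _ fun s' ⟨hv', hI'⟩ => hk s' _ ⟨hI', rfl⟩ hv'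
  · rintro s' x' ⟨hI, rfl⟩ -
    exact hx s' hI

theorem coin_true {p : ℝ} (h0 : 0 ≤ p) (h1 : p ≤ 1) : coin p true = ENNReal.ofReal p := by
  rw [coin_apply h0 h1]; simp

theorem coin_false {p : ℝ} (h0 : 0 ≤ p) (h1 : p ≤ 1) : coin p false = ENNReal.ofReal (1 - p) := by
  rw [coin_apply h0 h1]; simp

/-- Sample the variable `4` uniformly from the numbers smaller than the variable `1`. -/
def uniformProg : Cmd :=
  .seq (.setNat 4 (.const 0) (.const 0))
    (forLoop 14 1
      (.seq (.flip 13 (.const 0)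
          (.div (.ofNat (.const 1)) (.ofNat (.add (.var 14) (.const 1)))))
        (.ite (.natLt (.const 0) (.var 13)) (.setNat 4 (.const 0) (.var 14)) .skip)))

/-- Reservoir sampling: round `t` replaces the current value by `t` with probability 1/(t+1). -/
theorem spec_uniform {s : SState n} (hm : 1 ≤ m) (h1 : s.1.nat 1 0 = m) :
    Spec srv D φ (5 + m * 7) uniformProg s (fun _ : Fin m => ENNReal.ofReal (1 / m))
      fun u s' => Frame [4, 13, 14] [] s.1 s'.1 ∧ s'.2 = s.2 ∧ s'.1.nat 4 0 = u := by
  intro N k f hf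
  have hm0 : (0 : ℝ) < m := by exact_mod_cast hm
  have e : N + (5 + m * 7) = (N + (3 + m * (4 + 3))) + 1 + 1 := by ring
  rw [e]
  refine W_seq.trans (W_setNat.trans ?_)
  -- Before round `t` the current value survives to the end with probability t/m, and each later
  -- value is the final one with probability 1/m. At the start the current value has weight 0, so
  -- its choice is immaterial.
  refine W_forLoop (b := m) (tb := 4) (fun t s' x =>
    Frame [4, 13, 14] [] s.1 s'.1 ∧ s'.2 = s.2 ∧ ∃ u : Fin m, s'.1.nat 4 0 = u ∧
      x = ENNReal.ofReal (t / m) * f u +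
        ∑ u' : Fin m, if t ≤ (u' : ℕ) then ENNReal.ofReal (1 / m) * f u' else 0)
    ?_ ?_ (h0 := ⟨?_, ?_, ⟨0, hm⟩, ?_, ?_⟩) ?_
  · rintro t s' x ⟨hF, -⟩
    rw [hF.1 1 (by simp), h1]
  · rintro t ht s' x ⟨hF, hE, u, hu, rfl⟩ hv N k hk
    have et : (1 : ℝ) / ((t : ℝ) + 1) ≤ 1 := by
      rw [div_le_one (by positivity)]; linarith [(Nat.cast_nonneg t : (0 : ℝ) ≤ t)]
    have ht0 : (0 : ℝ) ≤ 1 / ((t : ℝ) + 1) := by positivity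
    refine W_seq.trans (W_flip.trans ?_)
    rw [Fintype.sum_bool]
    simp only [RExp.eval, NExp.eval, hv, Nat.cast_one, Nat.cast_add, coin_true ht0 et,
      coin_false ht0 et]
    have S : (∑ u' : Fin m, if t ≤ (u' : ℕ) then ENNReal.ofReal (1 / m) * f u' else 0) =
        ENNReal.ofReal (1 / m) * f ⟨t, ht⟩ +
        ∑ u' : Fin m, if t + 1 ≤ (u' : ℕ) then ENNReal.ofReal (1 / m) * f u' else 0 := by
      have : ∀ u' : Fin m, (if t ≤ (u' : ℕ) then ENNReal.ofReal (1 / m) * f u' else 0) =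
          (if u' = ⟨t, ht⟩ then ENNReal.ofReal (1 / m) * f u' else 0) +
          if t + 1 ≤ (u' : ℕ) then ENNReal.ofReal (1 / m) * f u' else 0 := by
        intro u'
        rcases lt_trichotomy (u' : ℕ) t with h | h | h
        · simp [Fin.ext_iff, h.ne, not_le.2 h, show ¬ t + 1 ≤ (u' : ℕ) by omega]
        · simp [Fin.ext_iff, h]
        · simp [Fin.ext_iff, h.ne', h.le, show t + 1 ≤ (u' : ℕ) by omega]
      simp only [this, Finset.sum_add_distrib, Finset.sum_ite_eq', Finset.mem_univ, if_true]
    set S' := ∑ u' : Fin m, if t + 1 ≤ (u' : ℕ) then ENNReal.ofReal (1 / m) * f u' else 0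
    have bt : W srv D φ (N + 2)
        (.ite (.natLt (.const 0) (.var 13)) (.setNat 4 (.const 0) (.var 14)) .skip :: k)
        (s'.1.setNat 13 0 (if true = true then 1 else 0), s'.2) ≤
        ENNReal.ofReal ((t + 1 : ℕ) / m) * f ⟨t, ht⟩ + S' := by
      refine (W_ite_pos (by simp [BExp.eval, NExp.eval])).trans (W_setNat.trans (hk _ _ ⟨?_, ?_,
        ⟨t, ht⟩, ?_, rfl⟩ ?_))
      · exact ((hF.setNat (by simp)).setNat (by simp)).setNat (by simp)
      · exact hE
      · simp [NExp.eval, hv]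
      · simp [NExp.eval, hv]
    have bf : W srv D φ (N + 2)
        (.ite (.natLt (.const 0) (.var 13)) (.setNat 4 (.const 0) (.var 14)) .skip :: k)
        (s'.1.setNat 13 0 (if false = true then 1 else 0), s'.2) ≤
        ENNReal.ofReal ((t + 1 : ℕ) / m) * f u + S' := by
      refine (W_ite_neg (by simp [BExp.eval, NExp.eval])).trans (W_skip.trans (hk _ _ ⟨?_, ?_,
        u, ?_, rfl⟩ ?_))
      · exact (hF.setNat (by simp)).setNat (by simp)
      · exact hE
      · simp [hu]
      · simp [hv]
    refine (add_le_add (mul_le_mul_right bt _) (mul_le_mul_right bf _)).trans (le_of_eq ?_)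
    rw [S, mul_add, mul_add, ← mul_assoc, ← mul_assoc, ← ENNReal.ofReal_mul ht0,
      ← ENNReal.ofReal_mul (sub_nonneg.2 et)]
    have c1 : (1 : ℝ) / (t + 1) * ((t + 1 : ℕ) / m) = 1 / m := by
      push_cast; field_simp
    have c2 : (1 - (1 : ℝ) / (t + 1)) * ((t + 1 : ℕ) / m) = t / m := by
      push_cast; field_simp; ring
    have c3 : ENNReal.ofReal (1 / ((t : ℝ) + 1)) * S' + ENNReal.ofReal (1 - 1 / ((t : ℝ) + 1)) * S'
        = S' := by
      rw [← add_mul, ← ENNReal.ofReal_add ht0 (sub_nonneg.2 et)]; simp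
    rw [c1, c2]
    calc _ = ENNReal.ofReal (t / m) * f u + (ENNReal.ofReal (1 / m) * f ⟨t, ht⟩ +
          (ENNReal.ofReal (1 / ((t : ℝ) + 1)) * S' +
            ENNReal.ofReal (1 - 1 / ((t : ℝ) + 1)) * S')) := by ring
      _ = _ := by rw [c3]
  · exact ((Frame.refl _ _ _).setNat (by simp)).setNat (by simp)
  · rfl
  · simp [NExp.eval]
  · simp
  · rintro s' x' ⟨hF, hE, u, hu, rfl⟩ -
    refine (hf u s' ⟨hF, hE, hu⟩).trans (le_of_eq ?_)
    rw [div_self hm0.ne']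
    simp [fun x : Fin m => not_le.2 x.2]

/-- The weight of the reply `r` of a user whose bit is `b`, with privacy parameter `e`. -/
noncomputable def rrWeight (e : ℝ) (b r : Bool) : ℝ :=
  if r = b then (1 + e) / (2 + e) else 1 / (2 + e)

theorem rrWeight_nonneg {e : ℝ} (he : 0 ≤ e) (b r : Bool) : 0 ≤ rrWeight e b r := by
  unfold rrWeight; split_ifs <;> positivity

theorem sum_rrWeight {e : ℝ} (he : 0 ≤ e) (b : Bool) : ∑ r, rrWeight e b r = 1 := by
  have : (2 + e) ≠ 0 := by positivity
  cases b <;> simp [rrWeight] <;> field_simp <;> ring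

/-- Whether the ranking `π` puts item `i` before item `j`. -/
def before {m : ℕ} (π : Ranking m) (i j : Fin m) : Bool := decide (π i < π j)

theorem coin_userProb {π : Ranking m} {i j : Fin m} {e : ℝ} (he : 0 < e) (r : Bool) :
    coin (userProb π ([i, j], [e])) r = ENNReal.ofReal (rrWeight e (before π i j) r) := by
  have h2 : (0 : ℝ) < 2 + e := by linarith
  have lo : 1 / (2 + e) ≤ 1 := by rw [div_le_one h2]; linarith
  have hi : (1 + e) / (2 + e) ≤ 1 := by rw [div_le_one h2]; linarith
  have su : 1 - (1 + e) / (2 + e) = 1 / (2 + e) := by field_simp; ring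
  have su' : 1 - 1 / (2 + e) = (1 + e) / (2 + e) := by field_simp; ring
  by_cases h : π i < π j
  · have : userProb π ([i, j], [e]) = (1 + e) / (2 + e) := by
      simp [userProb, rankingOracle, he, h]
    rw [this, coin_apply (by positivity) hi, su]
    cases r <;> simp [rrWeight, before, h]
  · have : userProb π ([i, j], [e]) = 1 / (2 + e) := by
      simp [userProb, rankingOracle, he, h]
    rw [this, coin_apply (by positivity) lo, su']
    cases r <;> simp [rrWeight, before, h]

/-- Ask all users whose group (array `3`) is the variable `4` whether they put item `9` before
item `10`; add the answers to the variable `6`, and the number of users asked to `7`. -/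
def pollProg : Cmd :=
  forLoop 5 2
    (.ite (.and (.not (.natLt (.get 3 (.var 5)) (.var 4)))
        (.not (.natLt (.var 4) (.get 3 (.var 5)))))
      (.seq (.call [.var 5, .var 9, .var 10] [.get 1 (.const 0)] 8 (.const 0) 3 (.const 0))
        (.seq (.setNat 6 (.const 0) (.add (.var 6) (.var 8)))
          (.setNat 7 (.const 0) (.add (.var 7) (.const 1)))))
      .skip)

/-- The outcome space contains an answer of every user, although only one group is asked. The
answers of the others are never looked at; including them keeps the distribution independent of the
group. -/
theorem spec_poll (hφ : ∀ s, ¬ s.Halted → φ s = ⊤) {s : SState n} {e : ℝ} {i j : Fin m}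
    (he : 0 < e) (h2 : s.1.nat 2 0 = n)
    (hi : s.1.nat 9 0 = i) (hj : s.1.nat 10 0 = j) (hr : s.1.real 1 0 = e) :
    Spec srv D φ (3 + n * 16) pollProg s
      (fun r : Fin n → Bool => ∏ k, ENNReal.ofReal (rrWeight e (before (D k) i j) (r k)))
      fun r s' => Frame [5, 6, 7, 8] [3] s.1 s'.1 ∧
        s'.1.nat 6 0 = s.1.nat 6 0 +
          ∑ k : Fin n, (if s.1.nat 3 k = s.1.nat 4 0 then (r k).toNat else 0) ∧
        s'.1.nat 7 0 = s.1.nat 7 0 +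
          ∑ k : Fin n, (if s.1.nat 3 k = s.1.nat 4 0 then 1 else 0) ∧
        ∀ k : Fin n, loss k s'.2 = loss k s.2 *
          if s.1.nat 3 k = s.1.nat 4 0 then ENNReal.ofReal (1 + e) else 1 := by
  have hw : ∀ b, ∑ r, ENNReal.ofReal (rrWeight e b r) = 1 := fun b =>
    sum_ofReal_eq_one (rrWeight_nonneg he.le b) (sum_rrWeight he.le b)
  have key := spec_forLoop (srv := srv) (D := D) (φ := φ) (v := 5) (bd := 2) (tb := 13) (s := s)
    (body := (.ite (.and (.not (.natLt (.get 3 (.var 5)) (.var 4)))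
        (.not (.natLt (.var 4) (.get 3 (.var 5)))))
      (.seq (.call [.var 5, .var 9, .var 10] [.get 1 (.const 0)] 8 (.const 0) 3 (.const 0))
        (.seq (.setNat 6 (.const 0) (.add (.var 6) (.var 8)))
          (.setNat 7 (.const 0) (.add (.var 7) (.const 1)))))
      .skip)) (fun (k : Fin n) r => ENNReal.ofReal (rrWeight e (before (D k) i j) r))
    (fun k => hw _) (fun t r s' => Frame [5, 6, 7, 8] [3] s.1 s'.1 ∧
        s'.1.nat 6 0 = s.1.nat 6 0 + ∑ k : Fin n,
          (if (k : ℕ) < t ∧ s.1.nat 3 k = s.1.nat 4 0 then (r k).toNat else 0) ∧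
        s'.1.nat 7 0 = s.1.nat 7 0 + ∑ k : Fin n,
          (if (k : ℕ) < t ∧ s.1.nat 3 k = s.1.nat 4 0 then 1 else 0) ∧
        ∀ k : Fin n, loss k s'.2 = loss k s.2 *
          if (k : ℕ) < t ∧ s.1.nat 3 k = s.1.nat 4 0 then ENNReal.ofReal (1 + e) else 1) ?_ ?_ ?_
  · intro N k f hf
    exact key N k f fun r s' h => hf r s' (by simpa using h)
  · rintro t r s' ⟨hF, -⟩
    rw [hF.1 2 (by simp), h2]
  · rintro t r s' ⟨hF, h6, h7, hl⟩ hv N k f hf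
    have e3 := hF.1 3 (by simp)
    have e4 := hF.1 4 (by simp)
    have upd : ∀ (x : Bool) (F : Bool → ℕ),
        (∑ k : Fin n, if (k : ℕ) < t + 1 ∧ s.1.nat 3 k = s.1.nat 4 0
          then F (Function.update r t x k) else 0) =
        (∑ k : Fin n, if (k : ℕ) < t ∧ s.1.nat 3 k = s.1.nat 4 0 then F (r k) else 0) +
          if s.1.nat 3 t = s.1.nat 4 0 then F x else 0 := by
      intro x F
      rw [← Finset.sum_erase_add _ _ (Finset.mem_univ t),
        ← Finset.sum_erase_add (a := t) _ _ (Finset.mem_univ t)]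
      simp only [Function.update_self, lt_irrefl, false_and, if_false, add_zero,
        Nat.lt_succ_self, true_and]
      congr 1
      refine Finset.sum_congr rfl fun k hk => ?_
      have hk := Finset.ne_of_mem_erase hk
      have : (k : ℕ) < t + 1 ↔ (k : ℕ) < t := by
        have := Fin.val_ne_of_ne hk; omega
      simp only [this, Function.update_of_ne hk]
    have updl : ∀ k : Fin n, (if (k : ℕ) < t + 1 ∧ s.1.nat 3 k = s.1.nat 4 0
        then ENNReal.ofReal (1 + e) else 1) =
        (if (k : ℕ) < t ∧ s.1.nat 3 k = s.1.nat 4 0 then ENNReal.ofReal (1 + e) else 1) *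
          if t = k ∧ s.1.nat 3 k = s.1.nat 4 0 then ENNReal.ofReal (1 + e) else 1 := by
      intro k
      rcases lt_trichotomy (k : ℕ) t with h | h | h
      · simp [h, show (k : ℕ) < t + 1 by omega, Fin.ext_iff, h.ne']
      · simp [h, Fin.ext_iff]
      · simp [show ¬ (k : ℕ) < t + 1 by omega, Fin.ext_iff, h.ne, show ¬ (k : ℕ) < t by omega]
    by_cases hg : s.1.nat 3 t = s.1.nat 4 0
    · refine (W_ite_pos ?_).trans (W_seq.trans ((W_call (N := N + 3) t (y := ([i, j], [e])) ?_).trans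
        (Finset.sum_le_sum fun x _ => ?_)))
      · simp [BExp.eval, NExp.eval, hv, e3, e4, hg]
      · simp [message, NExp.eval, RExp.eval, hv, hF.1 9, hF.1 10, hF.2 1, hi, hj, hr]
      · rw [coin_userProb he]
        gcongr
        refine W_seq.trans (W_setNat.trans (W_setNat.trans (hf x _ ⟨?_, ?_, ?_, ?_, ?_⟩)))
        · simp [Mem.store, NExp.eval, hv]
        · refine Frame.setNat (Frame.setNat (Frame.setNat (Frame.setReal (Frame.setNat hF ?_) ?_)
            ?_) ?_) ?_ <;> simp
        · have := upd x Bool.toNat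
          rw [if_pos hg] at this
          rw [this]
          cases x <;> simp [Mem.store, NExp.eval, userReply, h6, add_assoc]
        · have := upd x (fun _ => 1)
          rw [if_pos hg] at this
          rw [this]
          simp [Mem.store, NExp.eval, h7, add_assoc]
        · intro k
          rw [loss_append, hl, updl, mul_assoc]
          congr 2
          by_cases hk : t = k
          · subst hk; simp [hg, factor, he.le]
          · simp [hk]
    · refine (W_anti hφ (N := N + 2) (N' := N + 13) (by omega)).trans ?_
      refine (W_ite_neg ?_).trans (W_skip.trans ?_)
      · simp only [BExp.eval, NExp.eval, hv, e3, e4]; omega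
      -- A user outside the group flips no coin; an imaginary answer is inserted, whose weights sum
      -- to 1.
      · calc _ = ∑ x, ENNReal.ofReal (rrWeight e (before (D t) i j) x) * W srv D φ N k s' := by
              rw [← Finset.sum_mul, hw, one_mul]
          _ ≤ _ := by
              refine Finset.sum_le_sum fun x _ => ?_
              gcongr
              refine hf x s' ⟨hv, hF.setNat (by simp), ?_, ?_, ?_⟩
              · have := upd x Bool.toNat
                rw [if_neg hg] at this
                rw [this]
                simpa using h6
              · have := upd x (fun _ => 1)
                rw [if_neg hg] at this
                rw [this]
                simpa using h7
              · intro k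
                rw [updl, hl k]
                by_cases hk : t = k
                · subst hk; simp [hg]
                · simp [hk]
  · intro r
    refine ⟨(Frame.refl _ _ _).setNat (by simp), ?_, ?_, ?_⟩ <;> simp

end Loops

end RankAgg

namespace RankAgg

/-! ### Simulation of a query algorithm -/

/-- The offset 25 separates the memory of the simulated algorithm from the arrays 0 to 24 of the
server. -/
def NExp.shift : NExp → NExp
  | const c => const c
  | get a i => get (a + 25) i.shift
  | add e f => add e.shift f.shift
  | sub e f => sub e.shift f.shift

def RExp.shift : RExp → RExp
  | ofNat e => ofNat e.shift
  | get a i => get (a + 25) i.shift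
  | add e f => add e.shift f.shift
  | sub e f => sub e.shift f.shift
  | mul e f => mul e.shift f.shift
  | div e f => div e.shift f.shift

def BExp.shift : BExp → BExp
  | natLt e f => natLt e.shift f.shift
  | realLt e f => realLt e.shift f.shift
  | not b => not b.shift
  | and b c => and b.shift c.shift

/-- The memory `μ` contains the memory `ν` in the arrays with numbers at least `25`. -/
def Shifted (ν μ : Mem) : Prop :=
  (∀ a i, μ.nat (a + 25) i = ν.nat a i) ∧ ∀ a i, μ.real (a + 25) i = ν.real a i

section Shift

variable {ν μ : Mem}

theorem Shifted.evalN (h : Shifted ν μ) (e : NExp) : e.shift.eval μ = e.eval ν := by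
  induction e with
  | const c => rfl
  | get a i ih => simp [NExp.shift, NExp.eval, ih, h.1]
  | add e f ihe ihf => simp [NExp.shift, NExp.eval, ihe, ihf]
  | sub e f ihe ihf => simp [NExp.shift, NExp.eval, ihe, ihf]

theorem Shifted.evalR (h : Shifted ν μ) (e : RExp) : e.shift.eval μ = e.eval ν := by
  induction e with
  | ofNat e => simp [RExp.shift, RExp.eval, h.evalN]
  | get a i => simp [RExp.shift, RExp.eval, h.evalN, h.2]
  | add e f ihe ihf => simp [RExp.shift, RExp.eval, ihe, ihf]
  | sub e f ihe ihf => simp [RExp.shift, RExp.eval, ihe, ihf]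
  | mul e f ihe ihf => simp [RExp.shift, RExp.eval, ihe, ihf]
  | div e f ihe ihf => simp [RExp.shift, RExp.eval, ihe, ihf]

theorem Shifted.evalB (h : Shifted ν μ) (e : BExp) : e.shift.eval μ ↔ e.eval ν := by
  induction e with
  | natLt e f => simp [BExp.shift, BExp.eval, h.evalN]
  | realLt e f => simp [BExp.shift, BExp.eval, h.evalR]
  | not b ih => simp [BExp.shift, BExp.eval, ih]
  | and b c ihb ihc => simp [BExp.shift, BExp.eval, ihb, ihc]

theorem Shifted.setNat (h : Shifted ν μ) (a i v : ℕ) :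
    Shifted (ν.setNat a i v) (μ.setNat (a + 25) i v) :=
  ⟨fun b j => by simp [h.1], fun b j => by simp [h.2]⟩

theorem Shifted.setReal (h : Shifted ν μ) (a i : ℕ) (v : ℝ) :
    Shifted (ν.setReal a i v) (μ.setReal (a + 25) i v) :=
  ⟨fun b j => by simp [h.1], fun b j => by simp [h.2]⟩

theorem Shifted.frame (h : Shifted ν μ) {A B : List ℕ} {μ' : Mem} (hF : Frame A B μ μ')
    (hA : ∀ a ∈ A, a < 25) (hB : ∀ a ∈ B, a < 25) : Shifted ν μ' :=
  ⟨fun a i => by rw [hF.1 _ (fun h => by have := hA _ h; omega), h.1],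
    fun a i => by rw [hF.2 _ (fun h => by have := hB _ h; omega), h.2]⟩

end Shift

/-- The index of the pair stored in the variables `9` and `10`; array `17` holds row offsets. -/
def pairIdx : NExp := .add (.get 17 (.var 9)) (.var 10)

/-- The debiased and rescaled average of the answers of a group. -/
def estExp : RExp :=
  -- The scaling is by m/n, the inverse of the expected group size, and not by the actual size: the
  -- estimate stays a sum of independent terms and is unbiased before clamping.
  .mul (.div (.sub (.mul (.ofNat (.var 6)) (.add (.ofNat (.const 2)) (.get 1 (.const 0))))
    (.ofNat (.var 7))) (.get 1 (.const 0))) (.div (.ofNat (.var 1)) (.ofNat (.var 2)))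

/-- Poll the group `4` and store the estimate, clamped to `[0, 1]`, in the table. -/
def freshPoll : Cmd :=
  .seq (.setNat 19 (.var 4) (.add (.get 19 (.var 4)) (.const 1)))
    (.seq pollProg
      (.seq (.setReal 2 pairIdx estExp)
        (.ite (.realLt (.get 2 pairIdx) (.ofNat (.const 0)))
          (.setReal 2 pairIdx (.ofNat (.const 0)))
          (.ite (.realLt (.ofNat (.const 1)) (.get 2 pairIdx))
            (.setReal 2 pairIdx (.ofNat (.const 1))) .skip))))

/-- Give up: raise the flag `20`. -/
def freshFail : Cmd :=
  .seq (.setNat 20 (.const 0) (.const 1)) (.setReal 2 pairIdx (.ofNat (.const 0)))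

/-- Whether the load (array `19`) of the group `4` is still small. -/
def capExp : BExp :=
  -- The test (load + 1)·m ≤ 4q is made in the reals because naturals cannot be multiplied.
  .not (.realLt (.mul (.ofNat (.const 4)) (.ofNat (.var 24)))
    (.mul (.ofNat (.add (.get 19 (.var 4)) (.const 1))) (.ofNat (.var 1))))

/-- Compute a table entry. -/
def freshProg : Cmd :=
  .seq uniformProg
    (.seq (.setNat 6 (.const 0) (.const 0))
      (.seq (.setNat 7 (.const 0) (.const 0))
        (.seq (.ite capExp freshPoll freshFail) (.setNat 18 pairIdx (.const 1)))))

/-- Make sure that the table entry for the items `9` and `10` exists. -/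
def ensureProg : Cmd :=
  .ite (.natLt (.get 18 pairIdx) (.const 1)) freshProg .skip

/-- Answer the query for the items `9` and `10`, if the answer is not zero. -/
def queryBody : Cmd :=
  .ite (.and (.natLt (.var 9) (.var 1)) (.natLt (.var 10) (.var 1)))
    (.ite (.natLt (.var 9) (.var 10))
      (.seq ensureProg (.setReal 4 (.const 0) (.get 2 pairIdx)))
      (.ite (.natLt (.var 10) (.var 9))
        (.seq (.setNat 21 (.const 0) (.var 9))
          (.seq (.setNat 9 (.const 0) (.var 10))
            (.seq (.setNat 10 (.const 0) (.var 21))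
              (.seq ensureProg
                (.setReal 4 (.const 0) (.sub (.ofNat (.const 1)) (.get 2 pairIdx)))))))
        .skip))
    .skip

/-- Answer the query for the items `9` and `10`. -/
def queryProg : Cmd := .seq (.setReal 4 (.const 0) (.ofNat (.const 0))) queryBody

/-- The server code that simulates the command of a query algorithm. -/
def Cmd.simulate : Cmd → Cmd
  | .skip => .skip
  | .setNat a i e => .setNat (a + 25) i.shift e.shift
  | .setReal a i e => .setReal (a + 25) i.shift e.shift
  | .flip a i p => .flip (a + 25) i.shift p.shift
  | .call xs _ a i b j =>
      .seq (.setNat 22 (.const 0) i.shift) (.seq (.setNat 23 (.const 0) j.shift)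
        (.seq (.setNat 9 (.const 0) (xs.getD 0 (.const 0)).shift)
          (.seq (.setNat 10 (.const 0) (xs.getD 1 (.const 0)).shift)
            (.seq queryProg
              (.seq (.setNat (a + 25) (.var 22) (.const 0))
                (.setReal (b + 25) (.var 23) (.get 4 (.const 0))))))))
  | .seq s t => .seq s.simulate t.simulate
  | .ite c s t => .ite c.shift s.simulate t.simulate
  | .while c s => .while c.shift s.simulate

/-- A partial table of answers for pairs of items. -/
abbrev Table (m : ℕ) := Fin m → Fin m → Option ℝ

/-- Add an entry to a table. -/
def Table.set {m : ℕ} (T : Table m) (i j : Fin m) (v : ℝ) : Table m :=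
  fun a b => if a = i ∧ b = j then some v else T a b

/-- Clamp to the unit interval. -/
noncomputable def clampUnit (x : ℝ) : ℝ := if x < 0 then 0 else if 1 < x then 1 else x

theorem clampUnit_nonneg (x : ℝ) : 0 ≤ clampUnit x := by
  unfold clampUnit; split_ifs <;> linarith

theorem clampUnit_le_one (x : ℝ) : clampUnit x ≤ 1 := by
  unfold clampUnit; split_ifs <;> linarith

/-- The estimate computed from `N` answers with sum `S`. -/
noncomputable def groupEst (e : ℝ) (m n S N : ℕ) : ℝ := ((S * (2 + e) - N) / e) * (m / n)

section Simulation

variable {n m : ℕ} {srv : Cmd} {D : Fin n → Ranking m} {φ : PState n → ℝ≥0∞}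

/-- The table entry determined by the random choices `x`: a group and the answers of all users. -/
noncomputable def entry (g : Fin n → Fin m) (e : ℝ) (x : Fin m × (Fin n → Bool)) : ℝ :=
  clampUnit (groupEst e m n (∑ k : Fin n, if g k = x.1 then (x.2 k).toNat else 0)
    (∑ k : Fin n, if g k = x.1 then 1 else 0))

/-- The weight of the answers `r` of all users to the question about the items `i` and `j`. -/
noncomputable def answerWeight (D : Fin n → Ranking m) (e : ℝ) (i j : Fin m) (r : Fin n → Bool) :
    ℝ≥0∞ := ∏ k, ENNReal.ofReal (rrWeight e (before (D k) i j) (r k))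

/-- The parameters of the simulation: the groups of the users, the number `q`, the privacy
parameter of an answer, the fallback positions, and the privacy loss before the simulation. -/
structure SimParams (n m : ℕ) where
  g : Fin n → Fin m
  q : ℕ
  e : ℝ
  pos : ℕ → ℕ
  base : ℝ≥0∞

/-- The invariant of the simulation. -/
structure SimInv (p : SimParams n m) (T : Table m) (load : Fin m → ℕ) (fail : Bool)
    (s : SState n) : Prop where
  m1 : s.1.nat 1 0 = m
  n2 : s.1.nat 2 0 = n
  group : ∀ k : Fin n, s.1.nat 3 k = p.g k
  pos : ∀ i < m, s.1.nat 16 i = p.pos i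
  row : ∀ i < m, s.1.nat 17 i = i * m
  known : ∀ i j : Fin m, i < j → s.1.nat 18 (i * m + j) = if (T i j).isSome then 1 else 0
  loads : ∀ u : Fin m, s.1.nat 19 u = load u
  flag : s.1.nat 20 0 = if fail then 1 else 0
  q24 : s.1.nat 24 0 = p.q
  e1 : s.1.real 1 0 = p.e
  entries : ∀ i j : Fin m, ∀ v, i < j → T i j = some v → s.1.real 2 (i * m + j) = v
  privacy : ∀ k, loss k s.2 ≤ p.base * ENNReal.ofReal (1 + p.e) ^ load (p.g k)
  cap : ∀ u, load u * m ≤ 4 * p.q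
  unit : ∀ i j v, T i j = some v → 0 ≤ v ∧ v ≤ 1

variable {p : SimParams n m} {T : Table m} {load : Fin m → ℕ} {fail : Bool} {s : SState n}

theorem SimInv.frame (h : SimInv p T load fail s) {A B : List ℕ} {s' : SState n}
    (hF : Frame A B s.1 s'.1) (hA : ∀ a ∈ [1, 2, 3, 16, 17, 18, 19, 20, 24], a ∉ A)
    (hB : ∀ a ∈ [1, 2], a ∉ B) (hE : s'.2 = s.2) : SimInv p T load fail s' where
  m1 := by rw [hF.1 _ (hA _ (by simp)), h.m1]
  n2 := by rw [hF.1 _ (hA _ (by simp)), h.n2]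
  group k := by rw [hF.1 _ (hA _ (by simp)), h.group]
  pos i hi := by rw [hF.1 _ (hA _ (by simp)), h.pos i hi]
  row i hi := by rw [hF.1 _ (hA _ (by simp)), h.row i hi]
  known i j hij := by rw [hF.1 _ (hA _ (by simp)), h.known i j hij]
  loads u := by rw [hF.1 _ (hA _ (by simp)), h.loads u]
  flag := by rw [hF.1 _ (hA _ (by simp)), h.flag]
  q24 := by rw [hF.1 _ (hA _ (by simp)), h.q24]
  e1 := by rw [hF.2 _ (hB _ (by simp)), h.e1]
  entries i j v hij hv := by rw [hF.2 _ (hB _ (by simp)), h.entries i j v hij hv]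
  privacy k := by rw [hE]; exact h.privacy k
  cap := h.cap
  unit := h.unit

theorem pairIdx_inj {i j i' j' : Fin m} :
    (i' : ℕ) * m + j' = i * m + j ↔ i' = i ∧ j' = j := by
  refine ⟨fun h => ?_, fun h => by rw [h.1, h.2]⟩
  have hm : 0 < m := i.pos
  have h1 := congrArg (· / m) h
  have h2 := congrArg (· % m) h
  simp only [Nat.mul_add_mod', Nat.mod_eq_of_lt j.2, Nat.mod_eq_of_lt j'.2] at h2
  have d : ∀ a b : Fin m, ((a : ℕ) * m + b) / m = a := fun a b => by
    rw [mul_comm, Nat.mul_add_div hm, Nat.div_eq_of_lt b.2, add_zero]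
  simp only [d] at h1
  exact ⟨Fin.ext h1, Fin.ext h2⟩

theorem SimInv.set (h : SimInv p T load fail s) {i j : Fin m} {v : ℝ} (hv : 0 ≤ v ∧ v ≤ 1)
    {load' : Fin m → ℕ} {fail' : Bool} {s' : SState n}
    (hF : Frame [4, 5, 6, 7, 8, 13, 14, 18, 19, 20] [2, 3] s.1 s'.1)
    (h18 : ∀ x, s'.1.nat 18 x = if x = i * m + j then 1 else s.1.nat 18 x)
    (h2 : ∀ x, s'.1.real 2 x = if x = i * m + j then v else s.1.real 2 x)
    (h19 : ∀ u : Fin m, s'.1.nat 19 u = load' u)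
    (h20 : s'.1.nat 20 0 = if fail' then 1 else 0)
    (hl : ∀ k, loss k s'.2 ≤ p.base * ENNReal.ofReal (1 + p.e) ^ load' (p.g k))
    (hc : ∀ u, load' u * m ≤ 4 * p.q) : SimInv p (T.set i j v) load' fail' s' where
  m1 := by rw [hF.1 _ (by simp), h.m1]
  n2 := by rw [hF.1 _ (by simp), h.n2]
  group k := by rw [hF.1 _ (by simp), h.group]
  pos i hi := by rw [hF.1 _ (by simp), h.pos i hi]
  row i hi := by rw [hF.1 _ (by simp), h.row i hi]
  known a b hab := by
    rw [h18]
    by_cases e : a = i ∧ b = j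
    · simp [Table.set, e]
    · rw [if_neg fun e' => e (pairIdx_inj.1 e'), h.known a b hab]; simp [Table.set, e]
  loads u := h19 u
  flag := h20
  q24 := by rw [hF.1 _ (by simp), h.q24]
  e1 := by rw [hF.2 _ (by simp), h.e1]
  entries a b w hab hw := by
    rw [h2]
    by_cases e : a = i ∧ b = j
    · rw [if_pos (pairIdx_inj.2 e)]; simpa [Table.set, e] using hw
    · rw [if_neg fun e' => e (pairIdx_inj.1 e')]
      exact h.entries a b w hab (by simpa [Table.set, e] using hw)
  privacy := hl
  cap := hc
  unit a b w hw := by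
    by_cases e : a = i ∧ b = j
    · have : v = w := by simpa [Table.set, e] using hw
      exact this ▸ hv
    · exact h.unit a b w (by simpa [Table.set, e] using hw)

theorem spec_freshPoll (hφ : ∀ s, ¬ s.Halted → φ s = ⊤) (h : SimInv p T load fail s) (he : 0 < p.e)
    {i j u : Fin m} {s1 : SState n} (hF : Frame [4, 6, 7, 13, 14] [] s.1 s1.1) (hE : s1.2 = s.2)
    (hi : s.1.nat 9 0 = i) (hj : s.1.nat 10 0 = j) (hu : s1.1.nat 4 0 = u)
    (h6 : s1.1.nat 6 0 = 0) (h7 : s1.1.nat 7 0 = 0) (hc : (load u + 1) * m ≤ 4 * p.q)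
    {N : ℕ} {k : List Cmd} (F : ℝ → ℝ≥0∞)
    (hk : ∀ v s', SimInv p (T.set i j v) (Function.update load u (load u + 1)) fail s' →
      Frame [4, 5, 6, 7, 8, 13, 14, 18, 19, 20] [2, 3] s.1 s'.1 → W srv D φ N k s' ≤ F v) :
    W srv D φ (N + (12 + n * 16)) (freshPoll :: .setNat 18 pairIdx (.const 1) :: k) s1 ≤
      ∑ r, answerWeight D p.e i j r * F (entry p.g p.e (u, r)) := by
  have e : N + (12 + n * 16) = (((N + 1 + 2 + 1 + 1 + 1 + (3 + n * 16)) + 1) + 1) + 1 := by ring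
  rw [e]
  refine W_seq.trans (W_setNat.trans (W_seq.trans ?_))
  simp only [NExp.eval, hu]
  have i9 : s1.1.nat 9 0 = i := by rw [hF.1 9 (by simp), hi]
  have i10 : s1.1.nat 10 0 = j := by rw [hF.1 10 (by simp), hj]
  have r1 : s1.1.real 1 0 = p.e := by rw [hF.2 1 (by simp), h.e1]
  have n19 : ∀ w : Fin m, s1.1.nat 19 w = load w := fun w => by rw [hF.1 19 (by simp), h.loads]
  refine spec_poll hφ (i := i) (j := j) he ?_ ?_ ?_ ?_ _ _ _ ?_
  · simp [hF.1 2, h.n2]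
  · simp [i9]
  · simp [i10]
  · simp [r1]
  rintro r s2 ⟨hF2, h6', h7', hl⟩
  have hg : ∀ k : Fin n, s1.1.nat 3 k = p.g k := fun k => by rw [hF.1 3 (by simp), h.group]
  simp only [Mem.setNat_nat, Nat.reduceEqDiff, false_and,
    if_false, h6, h7, hu, hg, zero_add, Fin.val_inj] at h6' h7' hl
  have idx : ∀ μ : Mem, (∀ x, μ.nat 17 x = s2.1.nat 17 x) → (∀ x, μ.nat 9 x = s2.1.nat 9 x) →
      (∀ x, μ.nat 10 x = s2.1.nat 10 x) → pairIdx.eval μ = i * m + j := by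
    intro μ a b c
    simp [pairIdx, NExp.eval, a, b, c, hF2.1 17, hF2.1 9, hF2.1 10, i9, i10, hF.1 17,
      h.row i i.2]
  have est : estExp.eval s2.1 = groupEst p.e m n
      (∑ k : Fin n, if p.g k = u then (r k).toNat else 0)
      (∑ k : Fin n, if p.g k = u then 1 else 0) := by
    simp only [estExp, RExp.eval, NExp.eval, h6', h7', groupEst, hF2.2 1 (by simp),
      hF2.1 1 (by simp), hF2.1 2 (by simp)]
    simp [r1, hF.1 1, hF.1 2, h.m1, h.n2]
  set x := estExp.eval s2.1 with hx
  -- All three outcomes of the clamping leave the same memory up to the value written, so they share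
  -- this conclusion.
  have fin : ∀ (v : ℝ) (μ : Mem), v = clampUnit x → μ.nat = s2.1.nat →
      (∀ b y, μ.real b y = if b = 2 ∧ y = i * m + j then v else s2.1.real b y) →
      W srv D φ (N + 1) (.setNat 18 pairIdx (.const 1) :: k) (μ, s2.2) ≤
        F (entry p.g p.e (u, r)) := by
    intro v μ hv hn hr
    have hve : v = entry p.g p.e (u, r) := by rw [hv, est, entry]
    rw [← hve]
    refine W_setNat.trans (hk v _ ?_ ?_)
    all_goals
      have fr : Frame [4, 5, 6, 7, 8, 13, 14, 18, 19, 20] [2, 3] s.1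
          (μ.setNat 18 (pairIdx.eval μ) 1) := by
        refine Frame.setNat ⟨fun a ha y => ?_, fun a ha y => ?_⟩ (by simp)
        · simp only [List.mem_cons, not_or] at ha
          rw [hn, hF2.1 a (by simp; omega), Mem.setNat_nat, if_neg (by omega),
            hF.1 a (by simp; omega)]
        · simp only [List.mem_cons, not_or] at ha
          rw [hr, if_neg (by omega), hF2.2 a (by simp; omega), Mem.setNat_real, hF.2 a (by simp)]
    · have ix := idx μ (by simp [hn]) (by simp [hn]) (by simp [hn])
      refine h.set (hv ▸ ⟨clampUnit_nonneg x, clampUnit_le_one x⟩) fr ?_ ?_ ?_ ?_ ?_ ?_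
      · intro y
        simp [ix, hn, hF2.1 18, hF.1 18, NExp.eval]
      · intro y
        simp only [Mem.setNat_real, hr, true_and, hF2.2 2 (by simp), hF.2 2 (by simp)]
      · intro w
        simp only [Mem.setNat_nat, hn, hF2.1 19 (by simp)]
        by_cases hw : w = u
        · subst hw; simp [n19]
        · simp [Fin.val_inj, hw, n19]
      · simp [hn, hF2.1 20, hF.1 20, h.flag]
      · intro l
        rw [hl l, hE]
        by_cases hw : p.g l = u
        · simp only [hw, if_true, Function.update_self, pow_succ]
          rw [← mul_assoc]
          gcongr
          exact hw ▸ h.privacy l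
        · simpa [hw, Function.update_of_ne hw] using h.privacy l
      · intro w
        by_cases hw : w = u
        · subst hw; simpa using hc
        · simpa [Function.update_of_ne hw] using h.cap w
    · exact fr
  refine W_seq.trans (W_setReal.trans ?_)
  have ix0 := idx s2.1 (fun _ => rfl) (fun _ => rfl) (fun _ => rfl)
  have ix1 := idx (s2.1.setReal 2 (i * m + j) x) (fun _ => rfl) (fun _ => rfl) (fun _ => rfl)
  rw [ix0, ← hx]
  by_cases c1 : x < 0
  · refine (W_anti hφ (N := N + 1 + 1 + 1) (by omega)).trans
      ((W_ite_pos ?_).trans (W_setReal.trans (fin 0 _ ?_ ?_ ?_)))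
    · simp [BExp.eval, RExp.eval, NExp.eval, ix1, c1]
    · simp [clampUnit, c1]
    · rfl
    · intro b y
      simp only [ix1, Mem.setReal_real, RExp.eval, NExp.eval]
      split_ifs <;> simp
  · refine (W_ite_neg ?_).trans ?_
    · simpa [BExp.eval, RExp.eval, NExp.eval, ix1] using c1
    by_cases c2 : 1 < x
    · refine (W_ite_pos ?_).trans (W_setReal.trans (fin 1 _ ?_ ?_ ?_))
      · simp [BExp.eval, RExp.eval, NExp.eval, ix1, c2]
      · simp [clampUnit, c1, c2]
      · rfl
      · intro b y
        simp only [ix1, Mem.setReal_real, RExp.eval, NExp.eval]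
        split_ifs <;> simp
    · refine (W_ite_neg ?_).trans (W_skip.trans (fin x _ ?_ ?_ ?_))
      · simpa [BExp.eval, RExp.eval, NExp.eval, ix1] using c2
      · simp [clampUnit, c1, c2]
      · rfl
      · intro b y
        simp only [Mem.setReal_real]

end Simulation

end RankAgg

namespace RankAgg

/-! ### Fresh table entries and answers to queries. -/

section Simulation

variable {n m : ℕ} {srv : Cmd} {D : Fin n → Ranking m} {φ : PState n → ℝ≥0∞}
variable {p : SimParams n m} {T : Table m} {load : Fin m → ℕ} {fail : Bool} {s : SState n}

/-- The expected bound after the computation of a new table entry for the items `i` and `j`, if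
`F v` bounds the expected value when the entry is `v`. -/
noncomputable def freshBound (D : Fin n → Ranking m) (p : SimParams n m) (load : Fin m → ℕ)
    (fail : Bool) (i j : Fin m) (F : ℝ → (Fin m → ℕ) → Bool → ℝ≥0∞) : ℝ≥0∞ :=
  ∑ u : Fin m, ENNReal.ofReal (1 / m) *
    if (load u + 1) * m ≤ 4 * p.q then
      ∑ r, answerWeight D p.e i j r *
        F (entry p.g p.e (u, r)) (Function.update load u (load u + 1)) fail
    else F 0 load true

theorem spec_fresh (hφ : ∀ s, ¬ s.Halted → φ s = ⊤) (h : SimInv p T load fail s)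
    (he : 0 < p.q → 0 < p.e) {i j : Fin m}
    (hi : s.1.nat 9 0 = i) (hj : s.1.nat 10 0 = j)
    {N : ℕ} {k : List Cmd} (F : ℝ → (Fin m → ℕ) → Bool → ℝ≥0∞)
    (hk : ∀ v load' fail' s', SimInv p (T.set i j v) load' fail' s' →
      Frame [4, 5, 6, 7, 8, 13, 14, 18, 19, 20] [2, 3] s.1 s'.1 →
        W srv D φ N k s' ≤ F v load' fail') :
    W srv D φ (N + (24 + m * 7 + n * 16)) (freshProg :: k) s ≤
      freshBound D p load fail i j F := by
  have hm : 1 ≤ m := i.pos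
  have e : N + (24 + m * 7 + n * 16) =
      ((N + (12 + n * 16)) + 1 + 1 + 1 + 1 + 1 + 1 + (5 + m * 7)) + 1 := by ring
  rw [e]
  refine W_seq.trans (spec_uniform hm h.m1 _ _ _ ?_)
  rintro u s1 ⟨hF, hE, hu⟩
  refine W_seq.trans (W_setNat.trans (W_seq.trans (W_setNat.trans (W_seq.trans ?_))))
  simp only [NExp.eval]
  set s2 : SState n := ((s1.1.setNat 6 0 0).setNat 7 0 0, s1.2) with hs2
  have hF2 : Frame [4, 6, 7, 13, 14] [] s.1 s2.1 :=
    ((hF.mono (by simp) (by simp)).setNat (by simp)).setNat (by simp)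
  have u2 : s2.1.nat 4 0 = u := by simp [hs2, hu]
  have cap : capExp.eval s2.1 ↔ (load u + 1) * m ≤ 4 * p.q := by
    simp only [capExp, BExp.eval, RExp.eval, NExp.eval, u2, hF2.1 19 (by simp), h.loads,
      hF2.1 24 (by simp), h.q24, hF2.1 1 (by simp), h.m1, not_lt]
    exact_mod_cast Iff.rfl
  split_ifs with hc
  -- A poll is allowed only if q > 0, and then the privacy parameter is positive. For q = 0 every
  -- attempt at a fresh entry fails.
  · have hq : 0 < p.q := by
      by_contra h0
      have : (load u + 1) * m = 0 := by omega
      simp at this; omega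
    refine (W_ite_pos (cap.2 hc)).trans (spec_freshPoll hφ h (he hq) hF2 hE hi hj u2 ?_ ?_ hc
      (fun v => F v _ _) fun v s' h1 h2 => hk v _ _ s' h1 h2)
    · simp [hs2]
    · simp [hs2]
  · refine (W_ite_neg (mt cap.1 hc)).trans ((W_anti hφ (N := N + 1 + 1 + 1 + 1) (by omega)).trans
      (W_seq.trans (W_setNat.trans (W_setReal.trans (W_setNat.trans (hk 0 load true _ ?_ ?_))))))
    all_goals
      have fr : ∀ a c : ℕ, ∀ b : ℝ, Frame [4, 5, 6, 7, 8, 13, 14, 18, 19, 20] [2, 3] s.1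
          (((s2.1.setNat 20 0 1).setReal 2 a b).setNat 18 c 1) := fun a c b =>
        (((hF2.mono (by simp) (by simp)).setNat (by simp)).setReal (by simp)).setNat (by simp)
    · have ix : ∀ μ : Mem, (∀ x, μ.nat 17 x = s2.1.nat 17 x) → (∀ x, μ.nat 9 x = s2.1.nat 9 x) →
          (∀ x, μ.nat 10 x = s2.1.nat 10 x) → pairIdx.eval μ = i * m + j := by
        intro μ a b c
        simp only [pairIdx, NExp.eval, a, b, c, hF2.1 17 (by simp), hF2.1 9 (by simp),
          hF2.1 10 (by simp), hi, hj]
        rw [h.row i i.2]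
      have i1 := ix (s2.1.setNat 20 0 1) (fun _ => rfl) (fun _ => rfl) (fun _ => rfl)
      have i2 := fun v : ℝ => ix ((s2.1.setNat 20 0 1).setReal 2 (i * m + j) v)
        (fun _ => rfl) (fun _ => rfl) (fun _ => rfl)
      simp only [NExp.eval, RExp.eval, i1, i2, Nat.cast_zero]
      refine h.set ⟨le_rfl, zero_le_one⟩ (fr _ _ _) ?_ ?_ ?_ ?_ ?_ h.cap
      · intro x; simp [hF2.1 18]
      · intro x; simp [hF2.2 2]
      · intro x; simp [hF2.1 19, h.loads]
      · simp
      · intro l; simp only [hs2, hE]; exact h.privacy l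
    · exact fr _ _ _

/-- The answer to the query `a, b` according to the weights `w`. -/
noncomputable def queryAnswer (w : Fin m → Fin m → ℝ) (a b : ℕ) : ℝ :=
  if h : a < m ∧ b < m then w ⟨a, h.1⟩ ⟨b, h.2⟩ else 0

/-- The weight matrix that is given by the table `T`, completed by the random choices `ω`. -/
noncomputable def tableWeight (p : SimParams n m) (T : Table m)
    (ω : Fin m × Fin m → Fin m × (Fin n → Bool)) (i j : Fin m) : ℝ :=
  if i < j then (T i j).getD (entry p.g p.e (ω (i, j)))
  else if j < i then 1 - (T j i).getD (entry p.g p.e (ω (j, i))) else 0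

/-- The weights `w` agree with the entries of the table `T`. -/
def Table.Consistent (T : Table m) (w : Fin m → Fin m → ℝ) : Prop :=
  ∀ i j v, i < j → T i j = some v → w i j = v

theorem spec_ensure (hφ : ∀ s, ¬ s.Halted → φ s = ⊤) (h : SimInv p T load fail s)
    (he : 0 < p.q → 0 < p.e) {i j : Fin m} (hij : i < j)
    (hi : s.1.nat 9 0 = i) (hj : s.1.nat 10 0 = j)
    (ex : RExp) (rep : ℝ → ℝ) (hex : ∀ μ, ex.eval μ = rep (μ.real 2 (pairIdx.eval μ)))
    {N : ℕ} {k : List Cmd} (F : ℝ → Table m → (Fin m → ℕ) → Bool → ℝ≥0∞)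
    (hk : ∀ r T' load' fail' s', SimInv p T' load' fail' s' →
      Frame [4, 5, 6, 7, 8, 9, 10, 13, 14, 18, 19, 20, 21] [2, 3, 4] s.1 s'.1 →
        s'.1.real 4 0 = r → W srv D φ N k s' ≤ F r T' load' fail') :
    (∃ v, T i j = some v ∧ W srv D φ (N + (27 + m * 7 + n * 16))
      (.seq ensureProg (.setReal 4 (.const 0) ex) :: k) s ≤ F (rep v) T load fail) ∨
    (T i j = none ∧ W srv D φ (N + (27 + m * 7 + n * 16))
      (.seq ensureProg (.setReal 4 (.const 0) ex) :: k) s ≤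
        freshBound D p load fail i j fun v => F (rep v) (T.set i j v)) := by
  have hread : ∀ {T' : Table m} {load' fail'} {v : ℝ} {s' : SState n},
      SimInv p T' load' fail' s' → T' i j = some v →
      Frame [4, 5, 6, 7, 8, 13, 14, 18, 19, 20] [2, 3] s.1 s'.1 →
      W srv D φ (N + 1) (.setReal 4 (.const 0) ex :: k) s' ≤ F (rep v) T' load' fail' := by
    intro T' load' fail' v s' h' hv hF
    refine W_setReal.trans (hk _ T' load' fail' _ ?_ ?_ ?_)
    · exact h'.frame (((Frame.refl [4] [4] _)).setReal (by simp)) (by simp) (by simp) rfl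
    · exact (hF.mono (by simp) (by simp)).setReal (by simp)
    · have : pairIdx.eval s'.1 = i * m + j := by
        simp only [pairIdx, NExp.eval, hF.1 9 (by simp), hF.1 10 (by simp), hi, hj]
        rw [h'.row i i.2]
      simp [hex, NExp.eval, this, h'.entries i j v hij hv]
  have hix : pairIdx.eval s.1 = i * m + j := by
    simp only [pairIdx, NExp.eval, hi, hj]; rw [h.row i i.2]
  have e : N + (27 + m * 7 + n * 16) = (N + 1 + (24 + m * 7 + n * 16)) + 1 + 1 := by ring
  rw [e]
  cases hT : T i j with
  | some v =>
    refine Or.inl ⟨v, rfl, W_seq.trans ((W_ite_neg ?_).trans ((W_anti hφ (N := N + 1 + 1)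
      (by omega)).trans (W_skip.trans (hread h hT (Frame.refl _ _ _)))))⟩
    simp [BExp.eval, NExp.eval, hix, h.known i j hij, hT]
  | none =>
    refine Or.inr ⟨rfl, W_seq.trans ((W_ite_pos ?_).trans (spec_fresh hφ h he hi hj
      (fun v => F (rep v) (T.set i j v)) fun v load' fail' s' h1 h2 => ?_))⟩
    · simp [BExp.eval, NExp.eval, hix, h.known i j hij, hT]
    · exact hread h1 (by simp [Table.set]) h2

/-- Only pairs `i < j` are stored; the probability constraint determines the rest. So an answer is
either forced by the table, the diagonal or the range of the indices, or it is a function `rep` of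
one missing entry: the identity, or `1 - v` for a pair in reverse order. -/
theorem spec_query (hφ : ∀ s, ¬ s.Halted → φ s = ⊤) (h : SimInv p T load fail s)
    (he : 0 < p.q → 0 < p.e) {a b : ℕ} (ha : s.1.nat 9 0 = a) (hb : s.1.nat 10 0 = b)
    {N : ℕ} {k : List Cmd} (F : ℝ → Table m → (Fin m → ℕ) → Bool → ℝ≥0∞)
    (hk : ∀ r T' load' fail' s', SimInv p T' load' fail' s' →
      Frame [4, 5, 6, 7, 8, 9, 10, 13, 14, 18, 19, 20, 21] [2, 3, 4] s.1 s'.1 →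
        s'.1.real 4 0 = r → W srv D φ N k s' ≤ F r T' load' fail') :
    (∃ r, (∀ w, IsProbWeight w → T.Consistent w → queryAnswer w a b = r) ∧
      W srv D φ (N + (38 + m * 7 + n * 16)) (queryProg :: k) s ≤ F r T load fail) ∨
    (∃ i j : Fin m, i < j ∧ T i j = none ∧ ∃ rep : ℝ → ℝ,
      (∀ w, IsProbWeight w → queryAnswer w a b = rep (w i j)) ∧
      W srv D φ (N + (38 + m * 7 + n * 16)) (queryProg :: k) s ≤
        freshBound D p load fail i j fun v => F (rep v) (T.set i j v)) := by
  set s0 : SState n := (s.1.setReal 4 0 0, s.2) with hs0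
  have f0 : Frame [] [4] s.1 s0.1 := (Frame.refl _ _ _).setReal (by simp)
  have h0 : SimInv p T load fail s0 := h.frame f0 (by simp) (by simp) rfl
  have a0 : s0.1.nat 9 0 = a := ha
  have b0 : s0.1.nat 10 0 = b := hb
  have start : ∀ {x}, W srv D φ (N + (36 + m * 7 + n * 16)) (queryBody :: k) s0 ≤ x →
      W srv D φ (N + (38 + m * 7 + n * 16)) (queryProg :: k) s ≤ x := by
    intro x hx
    have e : N + (38 + m * 7 + n * 16) = N + (36 + m * 7 + n * 16) + 1 + 1 := by ring
    rw [e]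
    refine W_seq.trans (W_setReal.trans ?_)
    simpa [NExp.eval, RExp.eval] using hx
  have r0 : s0.1.real 4 0 = 0 := by simp [hs0]
  have done : W srv D φ N k s0 ≤ F 0 T load fail :=
    hk 0 T load fail s0 h0 (f0.mono (by simp) (by simp)) r0
  by_cases hab : a < m ∧ b < m
  · have c1 : BExp.eval s0.1 (.and (.natLt (.var 9) (.var 1)) (.natLt (.var 10) (.var 1))) := by
      simp only [BExp.eval, NExp.eval, a0, b0, h0.m1]; exact hab
    obtain ⟨i, rfl⟩ : ∃ i : Fin m, a = i := ⟨⟨a, hab.1⟩, rfl⟩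
    obtain ⟨j, rfl⟩ : ∃ j : Fin m, b = j := ⟨⟨b, hab.2⟩, rfl⟩
    have qa : ∀ w : Fin m → Fin m → ℝ, queryAnswer w i j = w i j := fun w => by simp [queryAnswer]
    rcases lt_trichotomy i j with hij | hij | hij
    · have st : ∀ {x}, W srv D φ (N + (27 + m * 7 + n * 16)) 
        (.seq ensureProg (.setReal 4 (.const 0) (.get 2 pairIdx)) :: k) s0 ≤ x →
        W srv D φ (N + (38 + m * 7 + n * 16)) (queryProg :: k) s ≤ x := fun {x} hx =>
        start (((W_anti hφ (N := N + (27 + m * 7 + n * 16) + 1 + 1) (by omega)).trans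
          ((W_ite_pos c1).trans (W_ite_pos (by
            simp only [BExp.eval, NExp.eval, a0, b0]; exact hij)))).trans hx)
      rcases spec_ensure (srv := srv) (D := D) hφ h0 he hij a0 b0 (.get 2 pairIdx) id
        (fun μ => rfl) (k := k) F (fun r T' load' fail' s' h1 h2 h3 => hk r T' load' fail' s' h1
          ((f0.mono (by simp) (by simp)).trans h2) h3) with ⟨v, hv, hW⟩ | ⟨hv, hW⟩
      · exact Or.inl ⟨v, fun w _ hw => (qa w).trans (hw i j v hij hv), st hW⟩
      · exact Or.inr ⟨i, j, hij, hv, id, fun w _ => qa w, st hW⟩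
    · subst hij
      refine Or.inl ⟨0, fun w hw _ => (qa w).trans (hw.diag i), start (((W_anti hφ
        (N := N + 1 + 1 + 1 + 1) (by omega)).trans ((W_ite_pos c1).trans ((W_ite_neg ?_).trans
          ((W_ite_neg ?_).trans W_skip)))).trans done)⟩ <;>
      simp [BExp.eval, NExp.eval, a0, b0]
    · set s1 : SState n := (((s0.1.setNat 21 0 i).setNat 9 0 j).setNat 10 0 i, s0.2) with hs1
      have f1 : Frame [9, 10, 21] [] s0.1 s1.1 :=
        (((Frame.refl _ _ _).setNat (by simp)).setNat (by simp)).setNat (by simp)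
      have h1 : SimInv p T load fail s1 := h0.frame f1 (by simp) (by simp) rfl
      have st : ∀ {x}, W srv D φ (N + (27 + m * 7 + n * 16)) 
        (.seq ensureProg (.setReal 4 (.const 0) (.sub (.ofNat (.const 1)) (.get 2 pairIdx))) :: k)
        s1 ≤ x → W srv D φ (N + (38 + m * 7 + n * 16)) (queryProg :: k) s ≤ x := fun {x} hx =>
        start (x := x) (by
          refine (W_anti hφ (N := N + (27 + m * 7 + n * 16) + 1 + 1 + 1 + 1 + 1 + 1 + 1 + 1 + 1)
            (by omega)).trans ((W_ite_pos c1).trans ((W_ite_neg ?_).trans ((W_ite_pos ?_).trans ?_)))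
          · simp only [BExp.eval, NExp.eval, a0, b0, not_lt]; exact hij.le
          · simp only [BExp.eval, NExp.eval, a0, b0]; exact hij
          · refine W_seq.trans (W_setNat.trans (W_seq.trans (W_setNat.trans (W_seq.trans
              (W_setNat.trans ?_)))))
            simpa [NExp.eval, a0, b0] using hx)
      rcases spec_ensure (srv := srv) (D := D) hφ h1 he hij (by simp [hs1]) (by simp [hs1])
        (.sub (.ofNat (.const 1)) (.get 2 pairIdx)) (fun v => 1 - v)
        (fun μ => by simp [RExp.eval, NExp.eval]) (k := k) F (fun r T' load' fail' s' h1 h2 h3 =>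
          hk r T' load' fail' s' h1 ((f0.mono (by simp) (by simp)).trans
            ((f1.mono (by simp) (by simp)).trans h2)) h3) with ⟨v, hv, hW⟩ | ⟨hv, hW⟩
      · exact Or.inl ⟨1 - v, fun w hw hT => by
          rw [qa, ← hT j i v hij hv, ← hw.add_eq_one i j hij.ne']; ring, st hW⟩
      · exact Or.inr ⟨j, i, hij, hv, fun v => 1 - v,
          fun w hw => by
          rw [qa, ← hw.add_eq_one i j hij.ne']; ring, st hW⟩
  · refine Or.inl ⟨0, fun w _ _ => by simp only [queryAnswer, dif_neg hab], start (((W_anti hφ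
      (N := N + 1 + 1) (by omega)).trans ((W_ite_neg ?_).trans W_skip)).trans done)⟩
    simp only [BExp.eval, NExp.eval, a0, b0, h0.m1]; exact hab

end Simulation

end RankAgg

namespace RankAgg

/-! ### Deferred choices of the weights, and the potential for the group loads. -/

section Simulation

variable {n m : ℕ} {srv : Cmd} {D : Fin n → Ranking m} {φ : PState n → ℝ≥0∞}
variable {p : SimParams n m} {T : Table m} {load : Fin m → ℕ} {fail : Bool} {s : SState n}

theorem isProbWeight_tableWeight (hT : ∀ i j v, T i j = some v → 0 ≤ v ∧ v ≤ 1)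
    (ω : Fin m × Fin m → Fin m × (Fin n → Bool)) : IsProbWeight (tableWeight p T ω) := by
  have key : ∀ i j x, 0 ≤ (T i j).getD (entry p.g p.e x) ∧ (T i j).getD (entry p.g p.e x) ≤ 1 := by
    intro i j x
    cases h : T i j with
    | none => exact ⟨clampUnit_nonneg _, clampUnit_le_one _⟩
    | some v => exact hT i j v h
  refine ⟨fun i j => ?_, fun i j hij => ?_, fun i => by simp [tableWeight]⟩
  · unfold tableWeight
    split_ifs
    · exact (key _ _ _).1
    · linarith [(key j i (ω (j, i))).2]
    · exact le_rfl
  · unfold tableWeight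
    rcases lt_or_gt_of_ne hij with h | h <;> simp [h, h.not_gt]

theorem consistent_tableWeight (ω : Fin m × Fin m → Fin m × (Fin n → Bool)) :
    T.Consistent (tableWeight p T ω) := fun i j v hij hv => by simp [tableWeight, hij, hv]

/-- Choosing the randomness of a missing pair and writing the resulting entry into the table have
the same effect on the matrix. -/
theorem tableWeight_update {i j : Fin m} (hij : i < j) (hT : T i j = none)
    (ω : Fin m × Fin m → Fin m × (Fin n → Bool)) (x : Fin m × (Fin n → Bool)) :
    tableWeight p T (Function.update ω (i, j) x) =
      tableWeight p (T.set i j (entry p.g p.e x)) ω := by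
  have key : ∀ a b : Fin m,
      (T a b).getD (entry p.g p.e (Function.update ω (i, j) x (a, b))) =
      (T.set i j (entry p.g p.e x) a b).getD (entry p.g p.e (ω (a, b))) := by
    intro a b
    by_cases h : a = i ∧ b = j
    · obtain ⟨rfl, rfl⟩ := h; simp [Table.set, hT]
    · simp only [Table.set, if_neg h]
      rw [Function.update_of_ne]
      simpa [Prod.ext_iff] using h
  ext a b
  simp only [tableWeight, key]

/-- The weights of the random choices for a pair of items. -/
noncomputable def choiceWeight (D : Fin n → Ranking m) (e : ℝ) (ij : Fin m × Fin m)
    (x : Fin m × (Fin n → Bool)) : ℝ≥0∞ :=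
  ENNReal.ofReal (1 / m) * answerWeight D e ij.1 ij.2 x.2

theorem sum_answerWeight {e : ℝ} (he : 0 ≤ e) (i j : Fin m) :
    ∑ r, answerWeight D e i j r = 1 := by
  simp only [answerWeight]
  exact prodExp_weights (fun (k : Fin n) r => ENNReal.ofReal (rrWeight e (before (D k) i j) r))
    fun k => sum_ofReal_eq_one (rrWeight_nonneg he _) (sum_rrWeight he _)

theorem sum_inv_card (hm : 1 ≤ m) : ∑ _u : Fin m, ENNReal.ofReal (1 / m) = 1 := by
  have : (m : ℝ) ≠ 0 := by positivity
  refine sum_ofReal_eq_one (fun _ => by positivity) ?_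
  simp [this]

theorem sum_choiceWeight (hm : 1 ≤ m) {e : ℝ} (he : 0 ≤ e) (ij : Fin m × Fin m) :
    ∑ x, choiceWeight D e ij x = 1 := by
  rw [Fintype.sum_prod_type]
  simp only [choiceWeight, ← Finset.mul_sum, sum_answerWeight he, mul_one, sum_inv_card hm]

/-- The expectation of `h` when the algorithm runs for `M` steps with the weights given by the
table `T` and random choices. -/
noncomputable def tableExp (D : Fin n → Ranking m) (p : SimParams n m) (h : Config → ℝ≥0∞)
    (M : ℕ) (x : Config) (T : Table m) : ℝ≥0∞ :=
  prodExp (choiceWeight D p.e) fun ω => chainExp (step (weightOracle (tableWeight p T ω))) h M x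

/-- The algorithm halts within `M` steps for all weights that are consistent with `T`. -/
def HaltsIn (M : ℕ) (x : Config) (T : Table m) : Prop :=
  ∀ w, IsProbWeight w → T.Consistent w →
    ∀ c ∈ (iter (step (weightOracle w)) M x).support, c.code = []

theorem HaltsIn.succ {M : ℕ} {x x' : Config} {T' : Table m} (h : HaltsIn (M + 1) x T)
    (hx : ∀ w, IsProbWeight w → T'.Consistent w →
      T.Consistent w ∧ step (weightOracle w) x x' ≠ 0) : HaltsIn M x' T' := by
  intro w hw hT c hc
  obtain ⟨h1, h2⟩ := hx w hw hT
  refine h w hw h1 c ?_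
  rw [iter, PMF.mem_support_bind_iff]
  exact ⟨x', (PMF.mem_support_iff _ _).2 h2, hc⟩

theorem calls_le_of_mem_support {env : Msg → Reply} {x y : Config}
    (h : y ∈ (step env x).support) : x.calls ≤ y.calls := by
  obtain ⟨code, μ, c⟩ := x
  match code with
  | [] => simp [RankAgg.step] at h; simp [h]
  | .skip :: k => simp [RankAgg.step] at h; simp [h]
  | .setNat .. :: k => simp [RankAgg.step] at h; simp [h]
  | .setReal .. :: k => simp [RankAgg.step] at h; simp [h]
  | .flip .. :: k =>
    simp only [RankAgg.step, PMF.support_map] at h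
    obtain ⟨b, -, rfl⟩ := h
    exact le_rfl
  | .call .. :: k => simp [RankAgg.step] at h; simp [h]
  | .seq .. :: k => simp [RankAgg.step] at h; simp [h]
  | .ite .. :: k => simp [RankAgg.step] at h; simp [h]
  | .while .. :: k => simp [RankAgg.step] at h; simp [h]

/-- The number of calls never decreases, so a run that has exceeded `q` queries stays in the region
where `h` is at least `y`. -/
theorem le_chainExp_of_lt_calls {env : Msg → Reply} {h : Config → ℝ≥0∞} {q : ℕ} {y : ℝ≥0∞}
    (hy : ∀ x : Config, q < x.calls → y ≤ h x) (M : ℕ) {x : Config} (hx : q < x.calls) :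
    y ≤ chainExp (step env) h M x := by
  induction M generalizing x with
  | zero => rw [chainExp_zero]; exact hy x hx
  | succ M ih =>
    rw [chainExp_succ]
    calc y = ∑' a, step env x a * y := by rw [ENNReal.tsum_mul_right, PMF.tsum_coe, one_mul]
      _ ≤ _ := by
        refine ENNReal.tsum_le_tsum fun a => ?_
        by_cases ha : a ∈ (step env x).support
        · gcongr
          exact ih (hx.trans_le (calls_le_of_mem_support ha))
        · rw [(PMF.apply_eq_zero_iff _ _).2 ha, zero_mul]; exact zero_le

/-- A potential that bounds the probability that some group is overloaded after `q` queries, given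
the loads after `c` queries. -/
noncomputable def potential (q : ℕ) (load : Fin m → ℕ) (c : ℕ) : ℝ≥0∞ :=
  if c ≤ q then ENNReal.ofReal ((∑ u, Real.exp (load u)) * (Real.exp 1 * Real.exp (-(4 * q / m)) *
    (1 + 2 / m) ^ (q - c))) else 0

theorem potential_anti (q : ℕ) (load : Fin m → ℕ) (c : ℕ) :
    potential q load (c + 1) ≤ potential q load c := by
  unfold potential
  split_ifs with h1 h2
  · refine ENNReal.ofReal_le_ofReal ?_
    have : (1 : ℝ) ≤ 1 + 2 / m := by
      have : (0 : ℝ) ≤ 2 / m := by positivity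
      linarith
    gcongr
    omega
  · omega
  · exact zero_le
  · exact le_rfl

/-- A query raises the load of a uniformly random group, so the sum of the exponentials of the loads
grows on average by at most the factor 1 + 2/m, which the decrease of the exponent `q - c` absorbs.
Where the cap forbids a poll within the first `q` queries, the potential has already reached 1.
Beyond `q` queries nothing is charged here. -/
theorem potential_step (hm : 1 ≤ m) (q : ℕ) (load : Fin m → ℕ) (c : ℕ) :
    ∑ u : Fin m, ENNReal.ofReal (1 / m) * (if (load u + 1) * m ≤ 4 * q then
      potential q (Function.update load u (load u + 1)) (c + 1)
        else if c + 1 ≤ q then 1 else 0) ≤ potential q load c := by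
  have hm0 : (0 : ℝ) < m := by exact_mod_cast hm
  by_cases hc : c + 1 ≤ q
  · simp only [potential, hc, if_true, show c ≤ q by omega]
    set Z : ℝ := Real.exp 1 * Real.exp (-(4 * q / m)) * (1 + 2 / m) ^ (q - (c + 1)) with hZ
    set Φ : ℝ := ∑ u, Real.exp (load u) with hΦ
    have hZ0 : 0 ≤ Z := by positivity
    have hΦ0 : 0 ≤ Φ := Finset.sum_nonneg fun _ _ => (Real.exp_pos _).le
    have hpow : Real.exp 1 * Real.exp (-(4 * q / m)) * (1 + 2 / m) ^ (q - c) =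
        (1 + 2 / m) * Z := by
      rw [hZ, show q - c = q - (c + 1) + 1 by omega, pow_succ]; ring
    -- One more unit of load adds (e - 1)·exp(load) ≤ 2·exp(load).
    have e3 : Real.exp 1 ≤ 3 := by linarith [Real.exp_one_lt_d9]
    have upd : ∀ u, ∑ w, Real.exp ((Function.update load u (load u + 1) w : ℕ) : ℝ) ≤
        Φ + 2 * Real.exp (load u) := by
      intro u
      rw [hΦ, ← Finset.sum_erase_add _ _ (Finset.mem_univ u),
        ← Finset.sum_erase_add (a := u) Finset.univ (fun u => Real.exp (load u))
          (Finset.mem_univ u)]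
      have : ∑ w ∈ Finset.univ.erase u, Real.exp ((Function.update load u (load u + 1) w : ℕ) : ℝ)
          = ∑ w ∈ Finset.univ.erase u, Real.exp (load w) :=
        Finset.sum_congr rfl fun w hw => by
          rw [Function.update_of_ne (Finset.ne_of_mem_erase hw)]
      rw [this, Function.update_self]
      push_cast
      rw [Real.exp_add]
      nlinarith [Real.exp_pos (load u)]
    have bound : ∀ u : Fin m, (if (load u + 1) * m ≤ 4 * q then
        ENNReal.ofReal ((∑ w, Real.exp ((Function.update load u (load u + 1) w : ℕ) : ℝ)) * Z)
        else 1) ≤ ENNReal.ofReal ((Φ + 2 * Real.exp (load u)) * Z) := by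
      intro u
      split_ifs with h
      · exact ENNReal.ofReal_le_ofReal (mul_le_mul_of_nonneg_right (upd u) hZ0)
      · rw [← ENNReal.ofReal_one]
        refine ENNReal.ofReal_le_ofReal ?_
        have h' : (4 * q / m : ℝ) ≤ load u + 1 := by
          rw [div_le_iff₀ hm0]
          have : 4 * q ≤ (load u + 1) * m := by omega
          exact_mod_cast this
        -- The summand of the overloaded group alone is at least 1.
        have h1 : 1 ≤ Real.exp (load u) * (Real.exp 1 * Real.exp (-(4 * q / m))) := by
          rw [← Real.exp_add, ← Real.exp_add]
          exact Real.one_le_exp (by linarith)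
        have h2 : Real.exp 1 * Real.exp (-(4 * q / m)) ≤ Z := by
          rw [hZ]
          refine le_mul_of_one_le_right (by positivity) (one_le_pow₀ ?_)
          have : (0 : ℝ) ≤ 2 / m := by positivity
          linarith
        calc (1 : ℝ) ≤ Real.exp (load u) * Z := h1.trans (by gcongr)
          _ ≤ _ := by
            gcongr
            nlinarith [Real.exp_pos (load u)]
    refine (Finset.sum_le_sum fun u _ => mul_le_mul_right (bound u) _).trans (le_of_eq ?_)
    simp only [← ENNReal.ofReal_mul (show (0 : ℝ) ≤ 1 / m by positivity)]
    rw [← ENNReal.ofReal_sum_of_nonneg fun u _ => by positivity, hpow]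
    congr 1
    rw [← Finset.mul_sum, ← Finset.sum_mul, Finset.sum_add_distrib, ← Finset.mul_sum, ← hΦ]
    simp
    field_simp
  · have : ∀ u : Fin m, (if (load u + 1) * m ≤ 4 * q then
      potential q (Function.update load u (load u + 1)) (c + 1)
        else if c + 1 ≤ q then 1 else 0) = 0 := by
      intro u; split_ifs <;> simp [potential, hc]
    simp only [this, mul_zero, Finset.sum_const_zero, zero_le]

end Simulation

end RankAgg

namespace RankAgg

/-! ### The expected value of a simulated run. -/

section Simulation

variable {n m : ℕ} {srv : Cmd} {D : Fin n → Ranking m} {φ : PState n → ℝ≥0∞}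
variable {p : SimParams n m} {T : Table m} {load : Fin m → ℕ} {fail : Bool} {s : SState n}

/-- The value of a final configuration of the query algorithm: the cost of its output, and the
cost `cF` of a failure if there were too many queries. -/
noncomputable def finalValue (cost : Mem → ℝ≥0∞) (cF : ℝ≥0∞) (q : ℕ) (c : Config) : ℝ≥0∞ :=
  cost c.mem + cF * if q < c.calls then 1 else 0

/-- The bound for the expected value when `M` steps of the query algorithm are to be simulated. -/
noncomputable def simBound (D : Fin n → Ranking m) (p : SimParams n m) (cost : Mem → ℝ≥0∞)
    (cF : ℝ≥0∞) (M : ℕ) (x : Config) (T : Table m) (load : Fin m → ℕ) (fail : Bool) : ℝ≥0∞ :=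
  if fail then cF else
    tableExp D p (finalValue cost cF p.q) M x T + cF * potential p.q load x.calls

theorem tableExp_succ_pure {h : Config → ℝ≥0∞} {M : ℕ} {x x' : Config}
    (hT : ∀ i j v, T i j = some v → 0 ≤ v ∧ v ≤ 1)
    (hx : ∀ w : Fin m → Fin m → ℝ, IsProbWeight w → T.Consistent w →
      step (weightOracle w) x = PMF.pure x') :
    tableExp D p h (M + 1) x T = tableExp D p h M x' T := by
  simp only [tableExp]
  congr 1
  ext ω
  rw [chainExp_succ_pure (hx _ (isProbWeight_tableWeight hT ω) (consistent_tableWeight ω))]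

theorem simBound_pure {cost : Mem → ℝ≥0∞} {cF : ℝ≥0∞} {M : ℕ} {x x' : Config}
    (hT : ∀ i j v, T i j = some v → 0 ≤ v ∧ v ≤ 1)
    (hx : ∀ w : Fin m → Fin m → ℝ, IsProbWeight w → T.Consistent w →
      step (weightOracle w) x = PMF.pure x')
    (hc : x'.calls = x.calls ∨ x'.calls = x.calls + 1) :
    simBound D p cost cF M x' T load fail ≤ simBound D p cost cF (M + 1) x T load fail := by
  unfold simBound
  split_ifs
  · exact le_rfl
  · rw [tableExp_succ_pure hT hx]
    gcongr
    rcases hc with hc | hc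
    · rw [hc]
    · rw [hc]; exact potential_anti _ _ _

theorem HaltsIn.pure {M : ℕ} {x x' : Config} (h : HaltsIn (M + 1) x T)
    (hx : ∀ w : Fin m → Fin m → ℝ, IsProbWeight w → T.Consistent w →
      step (weightOracle w) x = PMF.pure x') : HaltsIn M x' T :=
  h.succ fun w hw hT => ⟨hT, by rw [hx w hw hT]; simp⟩

theorem Table.Consistent.of_set {i j : Fin m} {v : ℝ} {w : Fin m → Fin m → ℝ}
    (h : (T.set i j v).Consistent w) (hT : T i j = none) (hij : i < j) :
    T.Consistent w ∧ w i j = v := by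
  refine ⟨fun a b x hab hx => h a b x hab ?_, h i j v hij (by simp [Table.set])⟩
  rw [Table.set, if_neg, hx]
  rintro ⟨rfl, rfl⟩
  simp [hT] at hx

/-- One simulated query with a fresh entry does not raise the bound on average. The group and the
answers drawn now take the place of the coordinate `(i, j)` of the choices made in advance, and a
refusal to poll is paid for by the potential or by the charge for too many queries. -/
theorem freshBound_simBound_le (hm : 1 ≤ m) (he : 0 ≤ p.e) {cost : Mem → ℝ≥0∞} {cF : ℝ≥0∞}
    {M : ℕ} {x : Config} {x' : ℝ → Config} (hT : ∀ i j v, T i j = some v → 0 ≤ v ∧ v ≤ 1)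
    {i j : Fin m} (hij : i < j) (hTij : T i j = none)
    (hx : ∀ w : Fin m → Fin m → ℝ, IsProbWeight w →
      step (weightOracle w) x = PMF.pure (x' (w i j)))
    (hc : ∀ v, (x' v).calls = x.calls + 1) :
    (freshBound D p load fail i j fun v => simBound D p cost cF M (x' v) (T.set i j v)) ≤
      simBound D p cost cF (M + 1) x T load fail := by
  have hu := sum_inv_card hm
  have ha : ∑ r, answerWeight D p.e i j r = 1 := sum_answerWeight he i j
  cases fail with
  | true =>
    simp only [freshBound, simBound, if_true, ← Finset.sum_mul, ha, one_mul, ite_self, hu]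
    exact le_rfl
  | false =>
    simp only [freshBound, simBound, if_true, Bool.false_eq_true, if_false, hc]
    set h := finalValue cost cF p.q
    have hE : tableExp D p h (M + 1) x T = ∑ u : Fin m, ENNReal.ofReal (1 / m) *
        ∑ r, answerWeight D p.e i j r * tableExp D p h M (x' (entry p.g p.e (u, r)))
          (T.set i j (entry p.g p.e (u, r))) := by
      rw [tableExp, prodExp_coord _ (i, j) (sum_choiceWeight hm he _), Fintype.sum_prod_type]
      simp only [choiceWeight, Finset.mul_sum, mul_assoc]
      refine Finset.sum_congr rfl fun u _ => Finset.sum_congr rfl fun r _ => ?_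
      congr 2
      simp only [tableExp, tableWeight_update hij hTij]
      congr 1
      ext ω
      have hT' : ∀ a b v, T.set i j (entry p.g p.e (u, r)) a b = some v → 0 ≤ v ∧ v ≤ 1 := by
        intro a b v hv
        by_cases e : a = i ∧ b = j
        · have : entry p.g p.e (u, r) = v := by simpa [Table.set, e] using hv
          exact this ▸ ⟨clampUnit_nonneg _, clampUnit_le_one _⟩
        · exact hT a b v (by simpa [Table.set, e] using hv)
      rw [chainExp_succ_pure (hx _ (isProbWeight_tableWeight hT' ω))]
      rw [consistent_tableWeight ω i j (entry p.g p.e (u, r)) hij (by simp [Table.set])]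
    rw [hE]
    refine le_trans ?_ (add_le_add_right (mul_le_mul_right (potential_step hm p.q load x.calls) cF) _)
    rw [Finset.mul_sum, ← Finset.sum_add_distrib]
    refine Finset.sum_le_sum fun u _ => ?_
    rw [mul_left_comm cF, ← mul_add]
    gcongr
    split_ifs with h1 h2
    · simp only [mul_add, Finset.sum_add_distrib, ← Finset.sum_mul, ha, one_mul]
      exact le_rfl
    -- Overload within the first `q` queries: the cost of the failure is covered by the potential.
    · rw [mul_one]; exact le_add_self
    -- Overload after more than `q` queries: `finalValue` charges `cF` on every continuation of the
    -- run.
    · rw [mul_zero, add_zero]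
      calc cF = ∑ r, answerWeight D p.e i j r * cF := by rw [← Finset.sum_mul, ha, one_mul]
        _ ≤ _ := by
          gcongr with r
          rw [tableExp]
          rw [← prodExp_const (choiceWeight D p.e) (sum_choiceWeight hm he) cF]
          refine prodExp_mono _ fun ω => le_chainExp_of_lt_calls (q := p.q) (fun y hy => ?_) _ ?_
          · simp [h, finalValue, hy]
          · rw [hc]; omega

theorem getD_map_eval (μ : Mem) (xs : List NExp) (i : ℕ) :
    (xs.map (NExp.eval μ)).getD i 0 = (xs.getD i (.const 0)).eval μ := by
  simp only [List.getD_eq_getElem?_getD, List.getElem?_map]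
  cases xs[i]? <;> rfl

theorem step_call (w : Fin m → Fin m → ℝ) (xs : List NExp) (rs : List RExp) (a : ℕ) (i : NExp)
    (b : ℕ) (j : NExp) (k : List Cmd) (μ : Mem) (c : ℕ) :
    step (weightOracle w) ⟨.call xs rs a i b j :: k, μ, c⟩ =
      PMF.pure ⟨k, μ.store (0, queryAnswer w ((xs.getD 0 (.const 0)).eval μ)
        ((xs.getD 1 (.const 0)).eval μ)) a i b j, c + 1⟩ := by
  simp only [← getD_map_eval]
  rfl

/-- Induction on the remaining steps of the algorithm, each of which takes the server at most 50 +
7m + 16n steps. The table represents what the algorithm has learned; the bound averages over the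
completions of the table and is preserved by each command. -/
theorem spec_simulate (hφ : ∀ s, ¬ s.Halted → φ s = ⊤) (hm : 1 ≤ m) (he : 0 < p.q → 0 < p.e)
    (he0 : 0 ≤ p.e) (cost : Mem → ℝ≥0∞) (cF : ℝ≥0∞) {N : ℕ} {k : List Cmd}
    (hk : ∀ ν T load fail s, SimInv p T load fail s → Shifted ν s.1 →
      W srv D φ N k s ≤ if fail then cF else cost ν) (M : ℕ) (x : Config)
    (h : SimInv p T load fail s) (hs : Shifted x.mem s.1) (hH : HaltsIn M x T) :
    W srv D φ (N + M * (50 + m * 7 + n * 16)) (x.code.map Cmd.simulate ++ k) s ≤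
      simBound D p cost cF M x T load fail := by
  induction M generalizing x T load fail s with
  | zero =>
    -- `HaltsIn` speaks about consistent matrices, so one is needed: any completion of the table
    -- will do.
    have ω : Fin m × Fin m → Fin m × (Fin n → Bool) := fun _ => (⟨0, hm⟩, fun _ => false)
    have hx : x.code = [] := hH _ (isProbWeight_tableWeight (p := p) h.unit ω)
      (consistent_tableWeight ω) x (by simp [iter])
    rw [hx]
    refine le_trans (by simpa using hk x.mem T load fail s h hs) ?_
    unfold simBound
    split_ifs
    · exact le_rfl
    · refine le_trans ?_ le_self_add
      simp only [tableExp, chainExp_zero, prodExp_const (choiceWeight D p.e)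
        (sum_choiceWeight hm he0), finalValue]
      exact le_self_add
  | succ M ih =>
    set t := 50 + m * 7 + n * 16 with ht
    have e : N + (M + 1) * t = (N + M * t) + t := by ring
    have pad : ∀ {k' : List Cmd}, W srv D φ (N + (M + 1) * t) k' s ≤
        W srv D φ (N + M * t + 1) k' s := W_anti hφ (by rw [e]; omega)
    obtain ⟨code, ν, c⟩ := x
    have pure_step : ∀ {x' : Config} {s' : SState n}, x'.calls = c →
        (∀ w : Fin m → Fin m → ℝ, step (weightOracle w) ⟨code, ν, c⟩ = PMF.pure x') →
        SimInv p T load fail s' → Shifted x'.mem s'.1 →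
        (W srv D φ (N + (M + 1) * t) (code.map Cmd.simulate ++ k) s ≤
          W srv D φ (N + M * t) (x'.code.map Cmd.simulate ++ k) s') →
        W srv D φ (N + (M + 1) * t) (code.map Cmd.simulate ++ k) s ≤
          simBound D p cost cF (M + 1) ⟨code, ν, c⟩ T load fail :=
      fun hc hx h' hs' hW => hW.trans ((ih _ h' hs' (hH.pure fun w _ _ => hx w)).trans
        (simBound_pure h.unit (fun w _ _ => hx w) (Or.inl hc)))
    have inv_nat : ∀ a i v, SimInv p T load fail (s.1.setNat (a + 25) i v, s.2) := fun a i v =>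
      h.frame (((Frame.refl [a + 25] [] _)).setNat (by simp)) (by simp) (by simp) rfl
    have inv_real : ∀ a i v, SimInv p T load fail (s.1.setReal (a + 25) i v, s.2) := fun a i v =>
      h.frame (((Frame.refl [] [a + 25] _)).setReal (by simp)) (by simp) (by simp) rfl
    have hs' : Shifted ν s.1 := hs
    match code with
    | [] =>
      exact pure_step (x' := ⟨[], ν, c⟩) rfl (fun w => rfl) h hs (W_anti hφ (by rw [e]; omega))
    | .skip :: k' =>
      exact pure_step (x' := ⟨k', ν, c⟩) rfl (fun w => rfl) h hs (pad.trans W_skip)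
    | .setNat a i v :: k' =>
      refine pure_step (x' := ⟨k', ν.setNat a (i.eval ν) (v.eval ν), c⟩) rfl (fun w => rfl)
        (inv_nat a _ _) (hs'.setNat a _ _) (pad.trans (W_setNat.trans ?_))
      rw [hs'.evalN, hs'.evalN]; exact le_rfl
    | .setReal a i v :: k' =>
      refine pure_step (x' := ⟨k', ν.setReal a (i.eval ν) (v.eval ν), c⟩) rfl (fun w => rfl)
        (inv_real a _ _) (hs'.setReal a _ _) (pad.trans (W_setReal.trans ?_))
      rw [hs'.evalN, hs'.evalR]; exact le_rfl
    | .seq a b :: k' =>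
      exact pure_step (x' := ⟨a :: b :: k', ν, c⟩) rfl (fun w => rfl) h hs (pad.trans W_seq)
    | .ite b a a' :: k' =>
      by_cases hb : b.eval ν
      · exact pure_step (x' := ⟨a :: k', ν, c⟩) rfl (fun w => by simp [RankAgg.step, hb]) h hs
          (pad.trans (W_ite_pos ((hs'.evalB b).2 hb)))
      · exact pure_step (x' := ⟨a' :: k', ν, c⟩) rfl (fun w => by simp [RankAgg.step, hb]) h hs
          (pad.trans (W_ite_neg (mt (hs'.evalB b).1 hb)))
    | .while b a :: k' =>
      by_cases hb : b.eval ν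
      · exact pure_step (x' := ⟨a :: .while b a :: k', ν, c⟩) rfl
          (fun w => by simp [RankAgg.step, hb]) h hs
          (pad.trans (W_while_pos ((hs'.evalB b).2 hb)))
      · exact pure_step (x' := ⟨k', ν, c⟩) rfl (fun w => by simp [RankAgg.step, hb]) h hs
          (pad.trans (W_while_neg (mt (hs'.evalB b).1 hb)))
    | .flip a i r :: k' =>
      set x' : Bool → Config := fun b => ⟨k', ν.setNat a (i.eval ν) (if b then 1 else 0), c⟩
        with hx'
      have hx : ∀ w : Fin m → Fin m → ℝ, step (weightOracle w) ⟨.flip a i r :: k', ν, c⟩ =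
        (coin (r.eval ν)).map x' := fun w => rfl
      have hsum : ∑ b, coin (r.eval ν) b = 1 := by
        rw [← tsum_fintype (L := .unconditional _)]; exact PMF.tsum_coe _
      refine (pad.trans W_flip).trans ?_
      calc _ ≤ ∑ b, coin (r.eval ν) b * simBound D p cost cF M (x' b) T load fail := by
            rw [hs'.evalR]
            refine Finset.sum_le_sum fun b _ => ?_
            -- Halting is inherited only along outcomes of positive probability; the others have
            -- weight 0 in the sum.
            by_cases hb : coin (r.eval ν) b = 0
            · rw [hb, zero_mul, zero_mul]
            · gcongr
              refine ih (x' b) (inv_nat a _ _) ?_ (hH.succ fun w _ hT => ⟨hT, ?_⟩)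
              · rw [hs'.evalN]; exact hs'.setNat a _ _
              · rw [hx, ← PMF.mem_support_iff, PMF.support_map]
                exact ⟨b, (PMF.mem_support_iff _ _).2 hb, rfl⟩
        _ ≤ _ := by
            unfold simBound
            cases fail with
            | true => simp only [if_true, ← Finset.sum_mul, hsum, one_mul]; exact le_rfl
            | false =>
              simp only [Bool.false_eq_true, if_false, mul_add, Finset.sum_add_distrib]
              refine add_le_add (le_of_eq ?_) (by simp only [hx', ← Finset.sum_mul, hsum, one_mul]; rfl)
              simp only [tableExp, ← prodExp_mul_left, ← prodExp_sum]
              congr 1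
              ext ω
              rw [chainExp_succ_map (hx _), tsum_fintype]
    | .call xs rs a i b j :: k' =>
      set qa := (xs.getD 0 (.const 0)).eval ν with hqa
      set qb := (xs.getD 1 (.const 0)).eval ν with hqb
      set x' : ℝ → Config := fun r => ⟨k', ν.store (0, r) a i b j, c + 1⟩ with hx'
      have hx : ∀ w : Fin m → Fin m → ℝ, step (weightOracle w)
        ⟨.call xs rs a i b j :: k', ν, c⟩ = PMF.pure (x' (queryAnswer w qa qb)) :=
          fun w => step_call w xs rs a i b j k' ν c
      set s1 : SState n := ((((s.1.setNat 22 0 (i.eval ν)).setNat 23 0 (j.eval ν)).setNat 9 0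
        qa).setNat 10 0 qb, s.2) with hs1
      have f1 : Frame [9, 10, 22, 23] [] s.1 s1.1 := ((((Frame.refl _ _ _).setNat
        (by simp)).setNat (by simp)).setNat (by simp)).setNat (by simp)
      have h1 : SimInv p T load fail s1 := h.frame f1 (by simp) (by simp) rfl
      have sh1 : Shifted ν s1.1 := hs'.frame f1 (by simp) (by simp)
      classical
      -- The continuation must be bounded for arbitrary replies and tables, while the induction
      -- hypothesis needs `HaltsIn`. The value ⊤ makes the remaining cases trivial, and they are
      -- excluded below for the replies that can occur.
      set F : ℝ → Table m → (Fin m → ℕ) → Bool → ℝ≥0∞ := fun r T' load' fail' =>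
        if HaltsIn M (x' r) T' then simBound D p cost cF M (x' r) T' load' fail' else ⊤ with hF
      set rest : List Cmd := .seq (.setNat (a + 25) (.var 22) (.const 0))
                (.setReal (b + 25) (.var 23) (.get 4 (.const 0))) ::
                  (k'.map Cmd.simulate ++ k) with hrest
      have start : W srv D φ (N + (M + 1) * t) ((Cmd.call xs rs a i b j :: k').map Cmd.simulate ++ k)
          s ≤ W srv D φ (N + M * t + 3 + (38 + m * 7 + n * 16)) (queryProg :: rest) s1 := by
        have e' : N + (M + 1) * t = (N + M * t + 3 + (38 + m * 7 + n * 16)) +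
          1 + 1 + 1 + 1 + 1 + 1 + 1 + 1 + 1 := by rw [e, ht]; ring
        rw [e']
        have E1 := hs'.evalN
        have E2 : ∀ v, Shifted ν (s.1.setNat 22 0 v) := fun v => hs'.frame (A := [22]) (B := [])
          ((Frame.refl _ _ _).setNat (by simp)) (by simp) (by simp)
        have E3 : ∀ v v', Shifted ν ((s.1.setNat 22 0 v).setNat 23 0 v') := fun v v' =>
          (E2 v).frame (A := [23]) (B := []) ((Frame.refl _ _ _).setNat (by simp)) (by simp)
            (by simp)
        have E4 : ∀ v v' v'', Shifted ν (((s.1.setNat 22 0 v).setNat 23 0 v').setNat 9 0 v'') :=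
          fun v v' v'' => (E3 v v').frame (A := [9]) (B := [])
            ((Frame.refl _ _ _).setNat (by simp)) (by simp) (by simp)
        refine W_seq.trans (W_setNat.trans ?_)
        simp only [NExp.eval, E1]
        refine W_seq.trans (W_setNat.trans ?_)
        simp only [NExp.eval, (E2 _).evalN]
        refine W_seq.trans (W_setNat.trans ?_)
        simp only [NExp.eval, (E3 _ _).evalN]
        refine W_seq.trans (W_setNat.trans ?_)
        simp only [NExp.eval, (E4 _ _ _).evalN]
        exact W_seq
      have cont : ∀ r T' load' fail' s', SimInv p T' load' fail' s' →
          Frame [4, 5, 6, 7, 8, 9, 10, 13, 14, 18, 19, 20, 21] [2, 3, 4] s1.1 s'.1 →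
          s'.1.real 4 0 = r → W srv D φ (N + M * t + 3) rest s' ≤ F r T' load' fail' := by
        intro r T' load' fail' s' h' hf hr
        simp only [hF]
        split_ifs with hh
        · refine W_seq.trans (W_setNat.trans (W_setReal.trans ?_))
          have v22 : s'.1.nat 22 0 = i.eval ν := by rw [hf.1 22 (by simp)]; simp [hs1]
          have v23 : s'.1.nat 23 0 = j.eval ν := by rw [hf.1 23 (by simp)]; simp [hs1]
          have sh' : Shifted ν s'.1 := sh1.frame hf (by simp) (by simp)
          have e23 : ∀ v v', (s'.1.setNat (a + 25) v v').nat 23 0 = s'.1.nat 23 0 := by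
            intro v v'; rw [Mem.setNat_nat, if_neg (by omega)]
          simp only [NExp.eval, RExp.eval, e23, v22, v23, Mem.setNat_real, hr]
          refine ih (x' r) ?_ ((sh'.setNat a _ _).setReal b _ _) hh
          exact h'.frame (A := [a + 25]) (B := [b + 25]) (((Frame.refl _ _ _).setNat
            (by simp)).setReal (by simp)) (by simp) (by simp) rfl
        · exact le_top
      refine start.trans ?_
      rcases spec_query hφ h1 he (a := qa) (b := qb) (by simp [hs1]) (by simp [hs1]) F cont with
        ⟨r, hr, hW⟩ | ⟨i', j', hij, hTij, rep, hr, hW⟩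
      · have hx1 : ∀ w : Fin m → Fin m → ℝ, IsProbWeight w → T.Consistent w →
            step (weightOracle w) ⟨.call xs rs a i b j :: k', ν, c⟩ = PMF.pure (x' r) :=
          fun w hw hT => by rw [hx, hr w hw hT]
        refine hW.trans ?_
        simp only [hF, if_pos (hH.pure hx1)]
        exact simBound_pure h.unit hx1 (Or.inr rfl)
      · have hx1 : ∀ w : Fin m → Fin m → ℝ, IsProbWeight w → step (weightOracle w)
            ⟨.call xs rs a i b j :: k', ν, c⟩ = PMF.pure (x' (rep (w i' j'))) :=
          fun w hw => by rw [hx, hr w hw]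
        have hh : ∀ v, HaltsIn M (x' (rep v)) (T.set i' j' v) := fun v =>
          hH.succ fun w hw hT => by
            obtain ⟨hT', hv⟩ := hT.of_set hTij hij
            refine ⟨hT', ?_⟩
            rw [hx1 w hw, hv]; simp
        refine hW.trans ?_
        simp only [hF, if_pos (hh _)]
        exact freshBound_simBound_le (x' := fun v => x' (rep v)) hm he0 h.unit hij hTij hx1
          fun v => rfl

end Simulation

end RankAgg

namespace RankAgg

/-! ### The server program -/

/-- Count, over all users and items, the answers that put an item before the item `11`. -/
def countBody : Cmd :=
  .seq (.setNat 6 (.const 0) (.const 0))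
    (.seq (forLoop 12 1
        (.seq (.setNat 9 (.const 0) (.var 12)) (.seq (.setNat 10 (.const 0) (.var 11)) pollProg)))
      (.setNat 15 (.var 11) (.var 6)))

/-- Compute the position of item `11` when the items are sorted by their counts. -/
def rankBody : Cmd :=
  .seq (.setNat 6 (.const 0) (.const 0))
    (.seq (forLoop 12 1
        (.ite (.and (.not (.natLt (.get 15 (.var 12)) (.get 15 (.var 11))))
            (.not (.and (.not (.natLt (.get 15 (.var 11)) (.get 15 (.var 12))))
              (.natLt (.var 12) (.var 11)))))
          .skip (.setNat 6 (.const 0) (.add (.var 6) (.const 1)))))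
      (.setNat 16 (.var 11) (.var 6)))

/-- Tabulate the multiples of the number of items. -/
def rowProg : Cmd :=
  .seq (.setNat 6 (.const 0) (.const 0))
    (forLoop 11 1 (.seq (.setNat 17 (.var 11) (.var 6)) (.setNat 6 (.const 0) (.add (.var 6) (.var 1)))))

/-- Assign a random group to every user. -/
def groupProg : Cmd := forLoop 11 2 (.seq uniformProg (.setNat 3 (.var 11) (.var 4)))

/-- Copy the first cells of the array `a` to the output. -/
def copyProg (a : ℕ) : Cmd := forLoop 11 1 (.setNat 0 (.var 11) (.get a (.var 11)))

/-! ### Subprograms of the server: counts, ranks, row offsets, groups and output. -/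

section Fallback

variable {n m : ℕ} {srv : Cmd} {D : Fin n → Ranking m} {φ : PState n → ℝ≥0∞}

theorem sum_update_lt {b : ℕ} {Ω : Type} (t : Fin b) (x : Fin b → Ω) (v : Ω) (F : Ω → ℕ) :
    (∑ k : Fin b, if (k : ℕ) < t + 1 then F (Function.update x t v k) else 0) =
      (∑ k : Fin b, if (k : ℕ) < t then F (x k) else 0) + F v := by
  rw [← Finset.sum_erase_add _ _ (Finset.mem_univ t),
    ← Finset.sum_erase_add (a := t) _ _ (Finset.mem_univ t)]
  simp only [Function.update_self, lt_irrefl, if_false, add_zero, Nat.lt_succ_self, if_true]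
  congr 1
  refine Finset.sum_congr rfl fun k hk => ?_
  have hk := Finset.ne_of_mem_erase hk
  have : (k : ℕ) < t + 1 ↔ (k : ℕ) < t := by
    have := Fin.val_ne_of_ne hk; omega
  simp only [this, Function.update_of_ne hk]

/-- The number of positive answers. -/
def answerCount (x : Fin m → Fin n → Bool) : ℕ := ∑ j, ∑ k, (x j k).toNat

/-- By `h3` all users are in the group being polled, so everybody is asked. Each user answers one
question per item `j`, namely whether `j` comes before `i`; the count therefore estimates the
position of `i`. -/
theorem spec_countBody (hφ : ∀ s, ¬ s.Halted → φ s = ⊤) {s : SState n} {e : ℝ} (he : 0 < e)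
    {i : Fin m} (h1 : s.1.nat 1 0 = m) (h2 : s.1.nat 2 0 = n) (hr : s.1.real 1 0 = e)
    (h3 : ∀ k : Fin n, s.1.nat 3 k = s.1.nat 4 0) (hi : s.1.nat 11 0 = i) :
    Spec srv D φ (7 + m * (10 + n * 16)) countBody s
      (fun x : Fin m → Fin n → Bool => ∏ j, answerWeight D e j i (x j))
      fun x s' => Frame [5, 6, 7, 8, 9, 10, 12, 15] [3] s.1 s'.1 ∧
        (∀ l, s'.1.nat 15 l = if l = i then answerCount x else s.1.nat 15 l) ∧
        ∀ k : Fin n, loss k s'.2 = loss k s.2 * ENNReal.ofReal (1 + e) ^ m := by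
  intro N k f hf
  have ee : N + (7 + m * (10 + n * 16)) = ((N + 1) + (3 + m * ((7 + n * 16) + 3))) + 1 + 1 + 1 := by
    ring
  rw [ee]
  refine W_seq.trans (W_setNat.trans (W_seq.trans ?_))
  simp only [NExp.eval]
  refine spec_forLoop (srv := srv) (D := D) (φ := φ) (fun j => answerWeight D e j i)
    (fun j => sum_answerWeight he.le j i)
    (fun t x s' => Frame [5, 6, 7, 8, 9, 10, 12] [3] s.1 s'.1 ∧
      s'.1.nat 6 0 = (∑ j : Fin m, if (j : ℕ) < t then ∑ k, (x j k).toNat else 0) ∧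
      ∀ k : Fin n, loss k s'.2 = loss k s.2 * ENNReal.ofReal (1 + e) ^ t) ?_ ?_ ?_ _ _ f ?_
  · rintro t x s' ⟨hF, -⟩
    rw [hF.1 1 (by simp), h1]
  · rintro t x s' ⟨hF, h6, hl⟩ hv N k f hf
    have e1 : N + (7 + n * 16) = (N + (3 + n * 16)) + 1 + 1 + 1 + 1 := by ring
    rw [e1]
    refine W_seq.trans (W_setNat.trans (W_seq.trans (W_setNat.trans ?_)))
    have h11 : s'.1.nat 11 0 = i := by rw [hF.1 11 (by simp), hi]
    refine spec_poll hφ he (i := t) (j := i) ?_ ?_ ?_ ?_ _ _ f ?_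
    · simp [NExp.eval, hF.1 2, h2]
    · simp [NExp.eval, hv]
    · simp [NExp.eval, h11]
    · simp [hF.2 1, hr]
    rintro r s2 ⟨hF2, h6', -, hl'⟩
    have h34 : ∀ k : Fin n, s'.1.nat 3 k = s'.1.nat 4 0 := fun k => by
      rw [hF.1 3 (by simp), hF.1 4 (by simp), h3]
    refine hf r s2 ⟨?_, ?_, ?_, ?_⟩
    · rw [hF2.1 12 (by simp)]; simp [hv]
    · refine Frame.setNat (hF.trans (Frame.trans ?_ (hF2.mono (by simp) (by simp)))) (by simp)
      exact ((Frame.refl _ _ _).setNat (by simp)).setNat (by simp)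
    · have := sum_update_lt t x r fun y => ∑ k, (y k).toNat
      rw [this]
      simp only [Mem.setNat_nat, Nat.reduceEqDiff, false_and, if_false, h34, if_true] at h6'
      simp [h6', h6]
    · intro k
      simp only [Mem.setNat_nat, Nat.reduceEqDiff, false_and, if_false, h34, if_true] at hl'
      rw [hl' k, hl k, pow_succ, mul_assoc]
  · intro x
    refine ⟨((Frame.refl _ _ _).setNat (by simp)).setNat (by simp), by simp, by simp⟩
  · rintro x s' ⟨hF, h6, hl⟩
    have h11 : s'.1.nat 11 0 = i := by rw [hF.1 11 (by simp), hi]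
    refine W_setNat.trans (hf x _ ⟨(hF.mono (by simp) (by simp)).setNat (by simp), ?_, hl⟩)
    intro l
    simp only [NExp.eval, Mem.setNat_nat, true_and, h11, h6, Fin.is_lt, if_true, answerCount,
      hF.1 15 (by simp)]

theorem spec_counts (hφ : ∀ s, ¬ s.Halted → φ s = ⊤) {s : SState n} {e : ℝ} (he : 0 < e)
    (h1 : s.1.nat 1 0 = m) (h2 : s.1.nat 2 0 = n) (hr : s.1.real 1 0 = e)
    (h3 : ∀ k : Fin n, s.1.nat 3 k = s.1.nat 4 0) :
    Spec srv D φ (3 + m * (7 + m * (10 + n * 16) + 3)) (forLoop 11 1 countBody) s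
      (fun x : Fin m → Fin m → Fin n → Bool => ∏ i, ∏ j, answerWeight D e j i (x i j))
      fun x s' => Frame [5, 6, 7, 8, 9, 10, 11, 12, 15] [3] s.1 s'.1 ∧
        (∀ i : Fin m, s'.1.nat 15 i = answerCount (x i)) ∧
        ∀ k : Fin n, loss k s'.2 = loss k s.2 * ENNReal.ofReal (1 + e) ^ (m * m) := by
  have key := spec_forLoop (srv := srv) (D := D) (φ := φ) (v := 11) (bd := 1) (b := m)
    (body := countBody) (s := s)
    (fun (i : Fin m) (x : Fin m → Fin n → Bool) => ∏ j, answerWeight D e j i (x j))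
    (fun i => prodExp_weights (fun (j : Fin m) r => answerWeight D e j i r)
      fun j => sum_answerWeight he.le j i)
    (fun t x s' => Frame [5, 6, 7, 8, 9, 10, 11, 12, 15] [3] s.1 s'.1 ∧
      (∀ i : Fin m, (i : ℕ) < t → s'.1.nat 15 i = answerCount (x i)) ∧
      ∀ k : Fin n, loss k s'.2 = loss k s.2 * ENNReal.ofReal (1 + e) ^ (t * m)) ?_
    (fun t x s' ⟨hF, hC, hl⟩ hv N k f hf => spec_countBody (i := t) hφ he ?_ ?_ ?_ ?_ hv N k f ?_) ?_
  · intro N k f hf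
    exact key N k f fun x s' ⟨hF, hC, hl⟩ => hf x s' ⟨hF, fun i => hC i i.2, hl⟩
  · rintro t x s' ⟨hF, -⟩
    rw [hF.1 1 (by simp), h1]
  · rw [hF.1 1 (by simp), h1]
  · rw [hF.1 2 (by simp), h2]
  · rw [hF.2 1 (by simp), hr]
  · intro k; rw [hF.1 3 (by simp), hF.1 4 (by simp), h3]
  · rintro x' s2 ⟨hF2, hC2, hl2⟩
    refine hf x' s2 ⟨?_, ?_, ?_, ?_⟩
    · rw [hF2.1 11 (by simp), hv]
    · exact (hF.trans (hF2.mono (by simp) (by simp))).setNat (by simp)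
    · intro i hi
      simp only [Mem.setNat_nat, Nat.reduceEqDiff, false_and, if_false, hC2]
      by_cases h : i = t
      · subst h; simp
      · have : (i : ℕ) ≠ t := Fin.val_ne_of_ne h
        rw [if_neg this, Function.update_of_ne h, hC i (by omega)]
    · intro k
      rw [hl2 k, hl k, mul_assoc, ← pow_add, Nat.succ_mul]
  · intro x
    exact ⟨(Frame.refl _ _ _).setNat (by simp), by simp, by simp⟩

/-- The position of item `i` when the items are sorted by `C`. -/
def lexRank (C : Fin m → ℕ) (i : Fin m) : ℕ :=
  ∑ j, if C j < C i ∨ (¬ C i < C j ∧ j < i) then 1 else 0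

theorem det_ranks {s : SState n} {C : Fin m → ℕ}
    (h1 : s.1.nat 1 0 = m) (hC : ∀ i : Fin m, s.1.nat 15 i = C i) :
    Det srv D φ (3 + m * (7 + m * 5 + 3)) (forLoop 11 1 rankBody) s
      fun s' => Frame [6, 11, 12, 16] [] s.1 s'.1 ∧ s'.2 = s.2 ∧
        ∀ i : Fin m, s'.1.nat 16 i = lexRank C i := by
  have key := det_forLoop (srv := srv) (D := D) (φ := φ) (v := 11) (bd := 1) (b := m)
    (body := rankBody) (s := s) (tb := 7 + m * 5)
    (fun t s' => Frame [6, 11, 12, 16] [] s.1 s'.1 ∧ s'.2 = s.2 ∧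
        ∀ i : Fin m, (i : ℕ) < t → s'.1.nat 16 i = lexRank C i) ?_ ?_ ?_
  · intro N k f hf
    exact key N k f fun s' ⟨hF, hE, hR⟩ => hf s' ⟨hF, hE, fun i => hR i i.2⟩
  · rintro t s' ⟨hF, -⟩
    rw [hF.1 1 (by simp), h1]
  · rintro t ht s' ⟨hF, hE, hR⟩ hv N k x hx
    have ee : N + (7 + m * 5) = ((N + 1) + (3 + m * (2 + 3))) + 1 + 1 + 1 := by ring
    rw [ee]
    refine W_seq.trans (W_setNat.trans (W_seq.trans ?_))
    simp only [NExp.eval]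
    refine det_forLoop (srv := srv) (D := D) (φ := φ)
      (fun t' s2 => Frame [6, 12] [] s'.1 s2.1 ∧ s2.2 = s'.2 ∧ s2.1.nat 6 0 = ∑ j : Fin m,
        if (j : ℕ) < t' then (if C j < C ⟨t, ht⟩ ∨ (¬ C ⟨t, ht⟩ < C j ∧ j < ⟨t, ht⟩) then 1 else 0)
          else 0) ?_ ?_ ?_ _ _ x ?_
    · rintro t' s2 ⟨hF2, -⟩
      rw [hF2.1 1 (by simp), hF.1 1 (by simp), h1]
    · rintro t' ht' s2 ⟨hF2, hE2, h6⟩ hv2 N k x hx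
      have c1 : s2.1.nat 15 t' = C ⟨t', ht'⟩ := by
        rw [hF2.1 15 (by simp), hF.1 15 (by simp), ← hC]
      have c2 : s2.1.nat 15 t = C ⟨t, ht⟩ := by
        rw [hF2.1 15 (by simp), hF.1 15 (by simp), ← hC]
      have c3 : s2.1.nat 11 0 = t := by rw [hF2.1 11 (by simp), hv]
      have upd : (∑ j : Fin m, if (j : ℕ) < t' + 1 then
          (if C j < C ⟨t, ht⟩ ∨ (¬ C ⟨t, ht⟩ < C j ∧ j < ⟨t, ht⟩) then 1 else 0) else 0) =
          (∑ j : Fin m, if (j : ℕ) < t' then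
          (if C j < C ⟨t, ht⟩ ∨ (¬ C ⟨t, ht⟩ < C j ∧ j < ⟨t, ht⟩) then 1 else 0) else 0) +
          if C ⟨t', ht'⟩ < C ⟨t, ht⟩ ∨ (¬ C ⟨t, ht⟩ < C ⟨t', ht'⟩ ∧ t' < t) then 1 else 0 := by
        have := sum_update_lt ⟨t', ht'⟩ (fun j : Fin m => j) ⟨t', ht'⟩ (fun j =>
          if C j < C ⟨t, ht⟩ ∨ (¬ C ⟨t, ht⟩ < C j ∧ j < ⟨t, ht⟩) then 1 else 0)
        rwa [Function.update_eq_self] at this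
      by_cases hc : C ⟨t', ht'⟩ < C ⟨t, ht⟩ ∨ (¬ C ⟨t, ht⟩ < C ⟨t', ht'⟩ ∧ t' < t)
      · refine (W_ite_neg ?_).trans (W_setNat.trans (hx _ ⟨?_, ?_, ?_, ?_⟩))
        · simp only [BExp.eval, NExp.eval, c1, c2, c3, hv2]; tauto
        · simp [NExp.eval, hv2]
        · exact (hF2.setNat (by simp)).setNat (by simp)
        · exact hE2
        · rw [upd, if_pos hc]; simp [NExp.eval, h6]
      · refine (W_ite_pos ?_).trans (W_skip.trans (hx _ ⟨?_, ?_, ?_, ?_⟩))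
        · simp only [BExp.eval, NExp.eval, c1, c2, c3, hv2]; tauto
        · exact hv2
        · exact hF2.setNat (by simp)
        · exact hE2
        · rw [upd, if_neg hc]; simp [h6]
    · exact ⟨((Frame.refl _ _ _).setNat (by simp)).setNat (by simp), rfl, by simp⟩
    · rintro s2 ⟨hF2, hE2, h6⟩
      have c3 : s2.1.nat 11 0 = t := by rw [hF2.1 11 (by simp), hv]
      refine W_setNat.trans (hx _ ⟨?_, ?_, ?_, ?_⟩)
      · simp [NExp.eval, c3]
      · exact ((hF.trans (hF2.mono (by simp) (by simp))).setNat (by simp)).setNat (by simp)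
      · exact hE2.trans hE
      · intro i hi
        simp only [NExp.eval, Mem.setNat_nat, c3, h6, Fin.is_lt, if_true, Nat.reduceEqDiff,
          false_and, if_false, true_and]
        split_ifs with h
        · obtain rfl : i = ⟨t, ht⟩ := Fin.ext h
          rfl
        · rw [hF2.1 16 (by simp), hR i (by omega)]
  · exact ⟨(Frame.refl _ _ _).setNat (by simp), rfl, by simp⟩

/-- The offsets arise by repeated addition because naturals cannot be multiplied. -/
theorem det_rows {s : SState n} (h1 : s.1.nat 1 0 = m) :
    Det srv D φ (5 + m * 6) rowProg s
      fun s' => Frame [6, 11, 17] [] s.1 s'.1 ∧ s'.2 = s.2 ∧ ∀ i < m, s'.1.nat 17 i = i * m := by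
  intro N k x hx
  have ee : N + (5 + m * 6) = (N + (3 + m * (3 + 3))) + 1 + 1 := by ring
  rw [ee]
  refine W_seq.trans (W_setNat.trans ?_)
  refine det_forLoop (srv := srv) (D := D) (φ := φ)
    (fun t s' => Frame [6, 11, 17] [] s.1 s'.1 ∧ s'.2 = s.2 ∧ s'.1.nat 6 0 = t * m ∧
      ∀ i < t, s'.1.nat 17 i = i * m) ?_ ?_ ?_ _ _ x ?_
  · rintro t s' ⟨hF, -⟩
    rw [hF.1 1 (by simp), h1]
  · rintro t ht s' ⟨hF, hE, h6, hR⟩ hv N k x hx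
    refine W_seq.trans (W_setNat.trans (W_setNat.trans (hx _ ⟨?_, ?_, ?_, ?_, ?_⟩)))
    · simp [NExp.eval, hv]
    · exact ((hF.setNat (by simp)).setNat (by simp)).setNat (by simp)
    · exact hE
    · simp [NExp.eval, h6, hF.1 1, h1, Nat.succ_mul]
    · intro i hi
      simp only [NExp.eval, Mem.setNat_nat, hv, h6, Nat.reduceEqDiff, false_and, if_false, true_and]
      split_ifs with h
      · rw [h]
      · exact hR i (by omega)
  · exact ⟨((Frame.refl _ _ _).setNat (by simp)).setNat (by simp), rfl, by simp [NExp.eval], by simp⟩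
  · rintro s' ⟨hF, hE, -, hR⟩
    exact hx s' ⟨hF, hE, hR⟩

theorem spec_groups (hm : 1 ≤ m) {s : SState n} (h1 : s.1.nat 1 0 = m) (h2 : s.1.nat 2 0 = n) :
    Spec srv D φ (3 + n * (10 + m * 7)) groupProg s
      (fun g : Fin n → Fin m => ∏ k, (fun _ _ => ENNReal.ofReal (1 / m)) k (g k))
      fun g s' => Frame [3, 4, 11, 13, 14] [] s.1 s'.1 ∧ s'.2 = s.2 ∧
        ∀ k : Fin n, s'.1.nat 3 k = g k := by
  have key := spec_forLoop (srv := srv) (D := D) (φ := φ) (v := 11) (bd := 2) (b := n)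
    (body := .seq uniformProg (.setNat 3 (.var 11) (.var 4))) (s := s) (tb := 7 + m * 7)
    (fun (_ : Fin n) (_ : Fin m) => ENNReal.ofReal (1 / m)) (fun _ => sum_inv_card hm)
    (fun t g s' => Frame [3, 4, 11, 13, 14] [] s.1 s'.1 ∧ s'.2 = s.2 ∧
      ∀ k : Fin n, (k : ℕ) < t → s'.1.nat 3 k = g k) ?_ ?_ ?_
  · intro N k f hf
    have ee : 3 + n * (10 + m * 7) = 3 + n * (7 + m * 7 + 3) := by ring
    rw [ee]
    exact key N k f fun x s' ⟨hF, hE, hG⟩ => hf x s' ⟨hF, hE, fun i => hG i i.2⟩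
  · rintro t g s' ⟨hF, -⟩
    rw [hF.1 2 (by simp), h2]
  · rintro t g s' ⟨hF, hE, hG⟩ hv N k f hf
    have ee : N + (7 + m * 7) = ((N + 1) + (5 + m * 7)) + 1 := by ring
    rw [ee]
    refine W_seq.trans (spec_uniform hm ?_ _ _ f ?_)
    · rw [hF.1 1 (by simp), h1]
    rintro u s2 ⟨hF2, hE2, hu⟩
    have h11 : s2.1.nat 11 0 = t := by rw [hF2.1 11 (by simp), hv]
    refine W_setNat.trans (hf u _ ⟨?_, ?_, ?_, ?_⟩)
    · simp [NExp.eval, h11]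
    · exact ((hF.trans (hF2.mono (by simp) (by simp))).setNat (by simp)).setNat (by simp)
    · exact hE2.trans hE
    · intro k hk
      simp only [NExp.eval, Mem.setNat_nat, h11, hu, Nat.reduceEqDiff, false_and, if_false, true_and]
      by_cases h : k = t
      · subst h; simp
      · have : (k : ℕ) ≠ t := Fin.val_ne_of_ne h
        rw [if_neg this, Function.update_of_ne h, hF2.1 3 (by simp), hG k (by omega)]
  · intro g
    exact ⟨(Frame.refl _ _ _).setNat (by simp), rfl, by simp⟩

theorem det_copy {a : ℕ} (ha : a ≠ 0) (ha' : a ≠ 11) {s : SState n} (h1 : s.1.nat 1 0 = m) :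
    Det srv D φ (3 + m * 4) (copyProg a) s
      fun s' => s'.2 = s.2 ∧ ∀ i < m, s'.1.nat 0 i = s.1.nat a i := by
  intro N k x hx
  refine det_forLoop (srv := srv) (D := D) (φ := φ)
    (fun t s' => Frame [0, 11] [] s.1 s'.1 ∧ s'.2 = s.2 ∧
      ∀ i < t, s'.1.nat 0 i = s.1.nat a i) ?_ ?_ ?_ _ _ x ?_
  · rintro t s' ⟨hF, -⟩
    rw [hF.1 1 (by simp), h1]
  · rintro t ht s' ⟨hF, hE, hR⟩ hv N k x hx
    refine W_setNat.trans (hx _ ⟨?_, ?_, ?_, ?_⟩)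
    · simp [NExp.eval, hv]
    · exact (hF.setNat (by simp)).setNat (by simp)
    · exact hE
    · intro i hi
      simp only [NExp.eval, Mem.setNat_nat, hv, false_and, if_false, true_and,
        OfNat.zero_ne_ofNat]
      split_ifs with h
      · rw [h, hF.1 a (by simp [ha, ha'])]
      · exact hR i (by omega)
  · exact ⟨(Frame.refl _ _ _).setNat (by simp), rfl, by simp⟩
  · rintro s' ⟨hF, hE, hR⟩
    exact hx s' ⟨hE, hR⟩

end Fallback

end RankAgg

namespace RankAgg

/-! ### Sorting by counts, and reading off the output. -/

section Ranks

variable {m : ℕ}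

/-- The order in which `lexRank` sorts the items. -/
def LexLt (C : Fin m → ℕ) (j i : Fin m) : Prop := C j < C i ∨ (¬ C i < C j ∧ j < i)

/-- By transitivity everything that precedes `j` precedes `i`, and `j` itself is counted only for
`i`. -/
theorem lexRank_lt_lexRank {C : Fin m → ℕ} {i j : Fin m} (h : LexLt C j i) :
    lexRank C j < lexRank C i := by
  refine Finset.sum_lt_sum (fun k _ => ?_) ⟨j, Finset.mem_univ _, ?_⟩
  · split_ifs with h1 h2
    · exact le_rfl
    · exact absurd (by unfold LexLt at h; omega) h2
    · exact Nat.zero_le _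
    · exact le_rfl
  · rw [if_pos (show C j < C i ∨ (¬ C i < C j ∧ j < i) from h), if_neg (by simp)]
    exact Nat.zero_lt_one

theorem lexRank_lt (C : Fin m → ℕ) (i : Fin m) : lexRank C i < m := by
  calc lexRank C i < ∑ _j : Fin m, 1 := by
        refine Finset.sum_lt_sum (fun k _ => ?_) ⟨i, Finset.mem_univ _, ?_⟩
        · split_ifs <;> simp
        · rw [if_neg (by simp)]; exact Nat.zero_lt_one
    _ = m := by simp

/-- The ranking of the items that is sorted by `C`. -/
noncomputable def lexPerm (C : Fin m → ℕ) : Ranking m :=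
  Equiv.ofBijective (fun i => ⟨lexRank C i, lexRank_lt C i⟩) <| by
    refine Finite.injective_iff_bijective.1 fun i j hij => ?_
    have hij : lexRank C i = lexRank C j := congrArg Fin.val hij
    by_contra hne
    rcases lt_trichotomy (C i) (C j) with h | h | h
    · exact absurd (lexRank_lt_lexRank (C := C) (Or.inl h)) (by omega)
    · rcases lt_or_gt_of_ne hne with h' | h'
      · exact absurd (lexRank_lt_lexRank (C := C) (i := j) (j := i) (Or.inr ⟨by omega, h'⟩))
          (by omega)
      · exact absurd (lexRank_lt_lexRank (C := C) (i := i) (j := j) (Or.inr ⟨by omega, h'⟩))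
          (by omega)
    · exact absurd (lexRank_lt_lexRank (C := C) (Or.inl h)) (by omega)

theorem lexPerm_val (C : Fin m → ℕ) (i : Fin m) : (lexPerm C i : ℕ) = lexRank C i := rfl

theorem readRanking_congr {μ μ' : Mem} (h : ∀ i < m, μ.nat 0 i = μ'.nat 0 i) :
    readRanking m μ = readRanking m μ' := by
  have e : ∀ i : Fin m, μ.nat 0 i = μ'.nat 0 i := fun i => h i i.2
  unfold readRanking
  simp only [e]

theorem readRanking_eq_some {μ : Mem} {σ : Ranking m} (h : ∀ i : Fin m, μ.nat 0 i = σ i) :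
    readRanking m μ = some σ := by
  have hex : ∃ σ : Ranking m, ∀ i : Fin m, μ.nat 0 i = (σ i : ℕ) := ⟨σ, h⟩
  rw [readRanking, dif_pos hex]
  congr 1
  ext i
  rw [← hex.choose_spec i, h i]

end Ranks

/-- The server's program, for a query algorithm `A`. First all users are asked about all pairs of
items, with a small privacy parameter; this yields a ranking to fall back on. Then the algorithm
is simulated, and every query that it makes for the first time is put to a random group. -/
def serverProg (A : Cmd) : Cmd :=
  .seq (.setNat 1 (.const 0) (.get 0 (.const 0)))
    (.seq (.setNat 2 (.const 0) (.get 0 (.const 1)))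
      (.seq (.setNat 24 (.const 0) (.get 0 (.const 2)))
        (.seq (.setReal 1 (.const 0) (.div (.get 0 (.const 0))
            (.mul (.mul (.ofNat (.const 2)) (.ofNat (.var 1))) (.ofNat (.var 1)))))
          (.seq (forLoop 11 1 countBody)
            (.seq (forLoop 11 1 rankBody)
              (.seq rowProg
                (.seq groupProg
                  (.seq (.setReal 1 (.const 0) (.div (.mul (.get 0 (.const 0)) (.ofNat (.var 1)))
                      (.mul (.ofNat (.const 8)) (.ofNat (.var 24)))))
                    (.seq (.setNat 25 (.const 0) (.var 1))
                      (.seq A.simulate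
                        (.ite (.natLt (.const 0) (.var 20)) (copyProg 16) (copyProg 25))))))))))))

/-- The running time of the server's program when `M` steps of the algorithm are simulated. -/
def serverTime {R : Type*} [CommSemiring R] (m n M : R) : R :=
  (3 + m * (7 + m * (10 + n * 16) + 3)) + (3 + m * (7 + m * 5 + 3)) + (5 + m * 6) +
    (3 + n * (10 + m * 7)) + M * (50 + m * 7 + n * 16) + (3 + m * 4) + 18

/-! ### The whole server program: halting, privacy budget and expected value. -/

section Total

variable {n m : ℕ} {D : Fin n → Ranking m}

open Classical in
/-- The value `c` of the output of a protocol run that halts and is `ε`-private. -/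
noncomputable def runValue (m : ℕ) (ε : ℝ) (c : Option (Ranking m) → ℝ≥0∞) (s : PState n) : ℝ≥0∞ :=
  if s.Halted ∧ ∀ k, loss k s.exchanges ≤ ENNReal.ofReal (Real.exp ε) then
    c (readRanking m s.server.mem) else ⊤

/-- The privacy parameter of the questions for the fallback ranking. -/
noncomputable def fallbackEps (m : ℕ) (ε : ℝ) : ℝ := ε / (2 * m * m)

/-- The privacy parameter of the questions that answer the queries. -/
noncomputable def queryEps (m q : ℕ) (ε : ℝ) : ℝ := ε * m / (8 * q)

/-- The simulation parameters when the groups are `g` and the fallback answers are `x`. -/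
noncomputable def simParams (q : ℕ) (ε : ℝ) (g : Fin n → Fin m) (x : Fin m → Fin m → Fin n → Bool) :
    SimParams n m where
  g := g
  q := q
  e := queryEps m q ε
  pos i := if h : i < m then lexRank (fun i => answerCount (x i)) ⟨i, h⟩ else 0
  base := ENNReal.ofReal (1 + fallbackEps m ε) ^ (m * m)

theorem one_add_pow_le_exp {x : ℝ} (hx : 0 ≤ x) (k : ℕ) : (1 + x) ^ k ≤ Real.exp (k * x) := by
  rw [Real.exp_nat_mul]
  exact pow_le_pow_left₀ (by linarith) (by linarith [Real.add_one_le_exp x]) k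

/-- Each phase spends ε/2: the fallback asks m² questions at ε/(2m²), and the simulation at most
4q/m questions at εm/(8q). -/
theorem privacy_le {q load : ℕ} {ε : ℝ} (hm : 1 ≤ m) (hε : 0 < ε) (h : load * m ≤ 4 * q) :
    ENNReal.ofReal (1 + fallbackEps m ε) ^ (m * m) *
      ENNReal.ofReal (1 + queryEps m q ε) ^ load ≤ ENNReal.ofReal (Real.exp ε) := by
  have hm0 : (0 : ℝ) < m := by exact_mod_cast hm
  have h2 : 0 ≤ fallbackEps m ε := by unfold fallbackEps; positivity
  have h1 : 0 ≤ queryEps m q ε := by unfold queryEps; positivity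
  rw [← ENNReal.ofReal_pow (by linarith), ← ENNReal.ofReal_pow (by linarith),
    ← ENNReal.ofReal_mul (by positivity)]
  refine ENNReal.ofReal_le_ofReal ?_
  calc _ ≤ Real.exp ((m * m : ℕ) * fallbackEps m ε) * Real.exp (load * queryEps m q ε) := by
        gcongr
        · exact one_add_pow_le_exp h2 _
        · exact one_add_pow_le_exp h1 _
    _ ≤ _ := by
        rw [← Real.exp_add]
        refine Real.exp_le_exp.2 ?_
        have e2 : ((m * m : ℕ) : ℝ) * fallbackEps m ε = ε / 2 := by
          unfold fallbackEps; push_cast; field_simp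
        have e1 : (load : ℝ) * queryEps m q ε ≤ ε / 2 := by
          unfold queryEps
          -- For q = 0 the division by zero makes `queryEps` equal to 0.
          rcases Nat.eq_zero_or_pos q with rfl | hq
          · simp; positivity
          · have hq0 : (0 : ℝ) < q := by exact_mod_cast hq
            have h' : (load : ℝ) * m ≤ 4 * q := by exact_mod_cast h
            rw [mul_div_assoc', div_le_div_iff₀ (by positivity) (by norm_num)]
            nlinarith [mul_le_mul_of_nonneg_left h' hε.le]
        linarith

theorem W_nil_le {srv : Cmd} {φ : PState n → ℝ≥0∞} {s : SState n} {x : ℝ≥0∞}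
    (h : ∀ c, φ ⟨⟨[], s.1, c⟩, none, s.2⟩ ≤ x) : W srv D φ 0 [] s ≤ x :=
  iSup_le fun c => by rw [ev, chainExp_zero]; exact h c

theorem W_output {srv : Cmd} {q : ℕ} {ε : ℝ} {c : Option (Ranking m) → ℝ≥0∞} {g : Fin n → Fin m}
    {x : Fin m → Fin m → Fin n → Bool} {T : Table m} {load : Fin m → ℕ} {fail : Bool}
    {s : SState n} {ν : Mem} (hm : 1 ≤ m) (hε : 0 < ε)
    (h : SimInv (simParams q ε g x) T load fail s) (hs : Shifted ν s.1) :
    W srv D (runValue m ε c) (3 + m * 4 + 1)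
      [.ite (.natLt (.const 0) (.var 20)) (copyProg 16) (copyProg 25)] s ≤
      if fail then c (some (lexPerm fun i => answerCount (x i))) else c (readRanking m ν) := by
  have fin : ∀ s' : SState n, s'.2 = s.2 → W srv D (runValue m ε c) 0 [] s' ≤
      c (readRanking m s'.1) := by
    intro s' hE
    refine W_nil_le fun c' => ?_
    rw [runValue, if_pos]
    refine ⟨⟨rfl, rfl⟩, fun k => ?_⟩
    rw [hE]
    exact (h.privacy k).trans (privacy_le hm hε (h.cap _))
  cases fail with
  | true =>
    refine (W_ite_pos (by simp [BExp.eval, NExp.eval, h.flag])).trans ?_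
    rw [← Nat.zero_add (3 + m * 4)]
    refine det_copy (by simp) (by simp) h.m1 _ _ _ fun s' ⟨hE, hc⟩ => (fin s' hE).trans ?_
    rw [readRanking_eq_some (σ := lexPerm fun i => answerCount (x i)), if_pos rfl]
    intro i
    rw [hc i i.2, h.pos i i.2]
    simp [simParams, lexPerm_val]
  | false =>
    refine (W_ite_neg (by simp [BExp.eval, NExp.eval, h.flag])).trans ?_
    rw [← Nat.zero_add (3 + m * 4)]
    refine det_copy (by simp) (by simp) h.m1 _ _ _ fun s' ⟨hE, hc⟩ => (fin s' hE).trans ?_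
    rw [readRanking_congr (μ' := ν), if_neg (by simp)]
    intro i hi
    rw [hc i hi, hs.1 0 i]

/-- The bound for the expected value of the output of the protocol. -/
noncomputable def totalBound (A : Cmd) (D : Fin n → Ranking m) (q : ℕ) (ε : ℝ) (M : ℕ)
    (c : Option (Ranking m) → ℝ≥0∞) : ℝ≥0∞ :=
  ∑ x : Fin m → Fin m → Fin n → Bool, (∏ i, ∏ j, answerWeight D (fallbackEps m ε) j i (x i j)) *
    ∑ g : Fin n → Fin m, (∏ _k : Fin n, ENNReal.ofReal (1 / m)) *
      simBound D (simParams q ε g x) (fun ν => c (readRanking m ν))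
        (c (some (lexPerm fun i => answerCount (x i)))) M (Config.start A ([m], []))
        (fun _ _ => none) (fun _ => 0) false

/-- The fallback answers and the groups are drawn before the simulation starts, so `spec_simulate`
applies with both fixed and with the cost of the fallback ranking as the constant `cF`. -/
theorem W_serverProg_le {srv A : Cmd} {q : ℕ} {ε : ℝ} {M : ℕ} (hm : 1 ≤ m) (hε : 0 < ε)
    (hA : ∀ w : Fin m → Fin m → ℝ, IsProbWeight w → ∀ c ∈ (runQuery A w M).support, c.code = [])
    (c : Option (Ranking m) → ℝ≥0∞) :
    W srv D (runValue m ε c) (serverTime m n M) [serverProg A] (Mem.init ([m, n, q], [ε]), []) ≤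
      totalBound A D q ε M c := by
  have hm0 : (0 : ℝ) < m := by exact_mod_cast hm
  have hφ : ∀ s : PState n, ¬ s.Halted → runValue m ε c s = ⊤ :=
    fun s hs => if_neg fun h => hs h.1
  have e2 : 0 < fallbackEps m ε := by unfold fallbackEps; positivity
  -- The time budget is regrouped in the order in which the commands consume it, the last command
  -- innermost.
  have et : serverTime m n M = ((((((3 + m * 4 + 1) + M * (50 + m * 7 + n * 16)) + 1 + 1 + 1 + 1 + 1
    + (3 + n * (10 + m * 7))) + 1 + (5 + m * 6)) + 1 + (3 + m * (7 + m * 5 + 3))) + 1 +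
    (3 + m * (7 + m * (10 + n * 16) + 3))) + 1 + 1 + 1 + 1 + 1 + 1 + 1 + 1 + 1 := by
    simp only [serverTime]; ring
  rw [et]
  refine W_seq.trans (W_setNat.trans (W_seq.trans (W_setNat.trans (W_seq.trans (W_setNat.trans
    (W_seq.trans (W_setReal.trans (W_seq.trans ?_))))))))
  dsimp only
  generalize hμ : Mem.setReal _ _ _ _ = μ
  have a1 : μ.nat 1 0 = m := by subst hμ; simp [NExp.eval, Mem.init]
  have a2 : μ.nat 2 0 = n := by subst hμ; simp [NExp.eval, Mem.init]
  have a24 : μ.nat 24 0 = q := by subst hμ; simp [NExp.eval, Mem.init]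
  have r1 : μ.real 1 0 = fallbackEps m ε := by
    subst hμ; simp [NExp.eval, RExp.eval, Mem.init, fallbackEps]
  have r0 : μ.real 0 0 = ε := by subst hμ; simp [NExp.eval, RExp.eval, Mem.init]
  -- Untouched cells are zero. Hence all users start in group 0, which is the one polled for the
  -- fallback, and the table, the loads and the flag start empty.
  have an : ∀ a i, a ∉ [0, 1, 2, 24] → μ.nat a i = 0 := by
    intro a i ha
    simp only [List.mem_cons, not_or] at ha
    subst hμ; simp [NExp.eval, Mem.init, ha]
  have ar : ∀ a i, a ∉ [0, 1] → μ.real a i = 0 := by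
    intro a i ha
    simp only [List.mem_cons, not_or] at ha
    subst hμ; simp [NExp.eval, Mem.init, ha]
  clear hμ
  refine (spec_counts hφ e2 a1 a2 r1 (fun k => by rw [an _ _ (by simp), an _ _ (by simp)])
    _ _ (fun x => ∑ g : Fin n → Fin m, (∏ _k : Fin n, ENNReal.ofReal (1 / m)) *
      simBound D (simParams q ε g x) (fun ν => c (readRanking m ν))
        (c (some (lexPerm fun i => answerCount (x i)))) M (Config.start A ([m], []))
        (fun _ _ => none) (fun _ => 0) false) ?_).trans le_rfl
  rintro x s1 ⟨F1, hC, hl⟩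
  refine W_seq.trans (det_ranks (F1.1 1 (by simp) 0 |>.trans a1) hC _ _ _ ?_)
  rintro s2 ⟨F2, E2, hR⟩
  refine W_seq.trans (det_rows (by rw [F2.1 1 (by simp), F1.1 1 (by simp), a1]) _ _ _ ?_)
  rintro s3 ⟨F3, E3, hrow⟩
  refine W_seq.trans (spec_groups hm
    (by rw [F3.1 1 (by simp), F2.1 1 (by simp), F1.1 1 (by simp), a1])
    (by rw [F3.1 2 (by simp), F2.1 2 (by simp), F1.1 2 (by simp), a2]) _ _ _ ?_)
  rintro g s4 ⟨F4, E4, hG⟩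
  refine W_seq.trans (W_setReal.trans (W_seq.trans (W_setNat.trans (W_seq.trans ?_))))
  dsimp only
  have F : Frame [3, 4, 5, 6, 7, 8, 9, 10, 11, 12, 13, 14, 15, 16, 17] [3] μ s4.1 :=
    (F1.mono (by simp) (by simp)).trans ((F2.mono (by simp) (by simp)).trans
      ((F3.mono (by simp) (by simp)).trans (F4.mono (by simp) (by simp))))
  have E : s4.2 = s1.2 := by rw [E4, E3, E2]
  generalize hμ' : Mem.setNat _ _ _ _ = μ'
  have n' : ∀ a i, μ'.nat a i = if a = 25 ∧ i = 0 then m else s4.1.nat a i := by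
    intro a i; subst hμ'; simp [NExp.eval, F.1 1, a1]
  have r' : ∀ a i, μ'.real a i = if a = 1 ∧ i = 0 then queryEps m q ε else s4.1.real a i := by
    intro a i; subst hμ'
    simp [NExp.eval, RExp.eval, F.1 1, F.1 24, F.2 0, a1, a24, r0, queryEps]
  clear hμ'
  have key := spec_simulate (srv := srv) (D := D) (p := simParams q ε g x) (s := (μ', s4.2))
    (T := fun _ _ => none) (load := fun _ => 0) (fail := false) hφ hm ?_ ?_
    (fun ν => c (readRanking m ν)) (c (some (lexPerm fun i => answerCount (x i))))
    (N := 3 + m * 4 + 1) (k := [.ite (.natLt (.const 0) (.var 20)) (copyProg 16) (copyProg 25)])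
    (fun ν T load fail s h hs => W_output hm hε h hs) M (Config.start A ([m], [])) ?_ ?_
    (fun w hw _ => hA w hw)
  · exact key
  · intro hq
    have : (0 : ℝ) < q := by exact_mod_cast hq
    simp only [simParams, queryEps]; positivity
  · simp only [simParams, queryEps]; positivity
  · refine ⟨?_, ?_, ?_, ?_, ?_, ?_, ?_, ?_, ?_, ?_, ?_, ?_, ?_, ?_⟩
    · simp [n', F.1 1, a1]
    · simp [n', F.1 2, a2]
    · intro k; simp [n', hG, simParams]
    · intro i hi
      simp [n', F4.1 16, F3.1 16, hR ⟨i, hi⟩, hi, simParams]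
    · intro i hi; simp [n', F4.1 17, hrow i hi]
    · intro i j _; simp [n', F.1 18, an]
    · intro u; simp [n', F.1 19, an]
    · simp [n', F.1 20, an]
    · simp [n', F.1 24, a24, simParams]
    · simp [r', simParams]
    · intro i j v _ h; simp at h
    · intro k
      simp only [E, hl, loss_nil, simParams, one_mul, pow_zero, mul_one, le_refl]
    · simp
    · intro i j v h; simp at h
  · refine ⟨fun a i => ?_, fun a i => ?_⟩
    · have : s4.1.nat (a + 25) i = 0 := by
        rw [F.1 _ (by simp only [List.mem_cons, List.not_mem_nil, or_false]; omega),
          an _ _ (by simp only [List.mem_cons, List.not_mem_nil, or_false]; omega)]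
      rw [n', this]
      rcases i with _ | i <;> simp [Config.start, Mem.init]
    · have : s4.1.real (a + 25) i = 0 := by
        rw [F.2 _ (by simp only [List.mem_cons, List.not_mem_nil, or_false]; omega),
          ar _ _ (by simp only [List.mem_cons, List.not_mem_nil, or_false]; omega)]
      rw [r', this, if_neg (by omega)]
      simp [Config.start, Mem.init]

theorem ev_serverProg_le {A : Cmd} {q : ℕ} {ε : ℝ} {M N : ℕ} (hm : 1 ≤ m) (hε : 0 < ε)
    (hA : ∀ w : Fin m → Fin m → ℝ, IsProbWeight w → ∀ c ∈ (runQuery A w M).support, c.code = [])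
    (hN : serverTime m n M ≤ N) (c : Option (Ranking m) → ℝ≥0∞) :
    ev (serverProg A) D (runValue m ε c) N
      ⟨Config.start (serverProg A) ([m, n, q], [ε]), none, []⟩ ≤ totalBound A D q ε M c :=
  (le_iSup (fun c' => ev (serverProg A) D (runValue m ε c) N
    ⟨⟨[serverProg A], Mem.init ([m, n, q], [ε]), c'⟩, none, []⟩) 0).trans
    ((W_anti (fun _ hs => if_neg fun h => hs h.1) hN).trans (W_serverProg_le hm hε hA c))

theorem totalBound_zero (A : Cmd) (q : ℕ) (ε : ℝ) (M : ℕ) :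
    totalBound A D q ε M (fun _ => 0) = 0 := by
  have : ∀ p : SimParams n m, finalValue (fun _ : Mem => (0 : ℝ≥0∞)) 0 p.q = fun _ => 0 := by
    intro p; ext c; simp [finalValue]
  simp [totalBound, simBound, tableExp, this, chainExp, prodExp]

/-- With cost zero the value of a run is 0 or ⊤, the latter for bad runs. Since the expectation is
bounded by 0, no bad run has positive probability. -/
theorem halted_and_private {A : Cmd} {q : ℕ} {ε : ℝ} {M N : ℕ} (hm : 1 ≤ m) (hε : 0 < ε)
    (hA : ∀ w : Fin m → Fin m → ℝ, IsProbWeight w → ∀ c ∈ (runQuery A w M).support, c.code = [])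
    (hN : serverTime m n M ≤ N) {s : PState n}
    (hs : s ∈ ((rrProtocol (serverProg A)).run q ε D N).support) :
    s.Halted ∧ ∀ k, loss k s.exchanges ≤ ENNReal.ofReal (Real.exp ε) := by
  have h0 := (ev_serverProg_le (q := q) (D := D) hm hε hA hN (fun _ => 0)).trans
    (totalBound_zero A q ε M).le
  have h1 := eq_zero_of_chainExp_eq_zero (le_antisymm h0 zero_le) hs
  by_contra hne
  rw [runValue, if_neg hne] at h1
  exact ENNReal.top_ne_zero h1

theorem tsum_output_le {A : Cmd} {q : ℕ} {ε : ℝ} {M : ℕ} {t : ℕ → ℕ} (hm : 1 ≤ m) (hε : 0 < ε)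
    (hA : ∀ w : Fin m → Fin m → ℝ, IsProbWeight w → ∀ c ∈ (runQuery A w M).support, c.code = [])
    (hN : serverTime m n M ≤ t (n + m)) (c : Option (Ranking m) → ℝ≥0∞) :
    ∑' o, (rrProtocol (serverProg A)).output t q ε D o * c o ≤ totalBound A D q ε M c := by
  rw [Protocol.output, PMF.tsum_map_mul]
  refine le_trans ?_ (ev_serverProg_le (q := q) (D := D) hm hε hA hN c)
  refine ENNReal.tsum_le_tsum fun s => ?_
  by_cases hs : s ∈ ((rrProtocol (serverProg A)).run q ε D (t (n + m))).support
  · rw [runValue, if_pos (halted_and_private hm hε hA hN hs)]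
    exact le_rfl
  · rw [(PMF.apply_eq_zero_iff _ _).2 hs, zero_mul]; exact zero_le

end Total

/-- A polynomial that bounds the running time of the protocol. -/
noncomputable def timePoly (p : Polynomial ℕ) : Polynomial ℕ :=
  serverTime Polynomial.X Polynomial.X p

theorem serverTime_le_timePoly (p : Polynomial ℕ) (n m : ℕ) :
    serverTime m n (p.eval m) ≤ (timePoly p).eval (n + m) := by
  have hp : p.eval m ≤ p.eval (n + m) := by
    simp only [Polynomial.eval_eq_sum_range]
    gcongr
    omega
  have e : (timePoly p).eval (n + m) = serverTime (n + m) (n + m) (p.eval (n + m)) := by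
    simp [timePoly, serverTime]
  rw [e]
  have h1 : m ≤ n + m := by omega
  have h2 : n ≤ n + m := by omega
  unfold serverTime
  gcongr

end RankAgg

namespace RankAgg

/-! ### Costs of rankings -/

section Cost

variable {n m : ℕ}

/-- The fraction of the rankings that put item `i` before item `j`. -/
noncomputable def prefWeight (D : Fin n → Ranking m) (i j : Fin m) : ℝ :=
  (∑ k, ((before (D k) i j).toNat : ℝ)) / n

theorem isProbWeight_prefWeight (hn : 1 ≤ n) (D : Fin n → Ranking m) :
    IsProbWeight (prefWeight D) := by
  have hn0 : (n : ℝ) ≠ 0 := by positivity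
  refine ⟨fun i j => by unfold prefWeight; positivity, fun i j hij => ?_, fun i => ?_⟩
  · have : ∀ k, ((before (D k) i j).toNat : ℝ) + ((before (D k) j i).toNat : ℝ) = 1 := by
      intro k
      rcases lt_or_gt_of_ne ((D k).injective.ne hij) with h | h <;> simp [before, h, h.not_gt]
    rw [prefWeight, prefWeight, ← add_div, ← Finset.sum_add_distrib]
    simp [this, hn0]
  · simp [prefWeight, before]

theorem kemeny_eq_weightCost (D : Fin n → Ranking m) (σ : Ranking m) :
    kemeny D σ = weightCost (prefWeight D) σ := by
  have h : ∀ k, (kendallTau σ (D k) : ℝ) =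
      ∑ i, ∑ j, if σ i < σ j then ((before (D k) j i).toNat : ℝ) else 0 := by
    intro k
    rw [kendallTau, Finset.card_filter, Fintype.sum_prod_type]
    push_cast
    refine Finset.sum_congr rfl fun i _ => Finset.sum_congr rfl fun j _ => ?_
    by_cases h1 : σ i < σ j <;> by_cases h2 : D k j < D k i <;> simp [h1, h2, before]
  simp only [kemeny, h, weightCost, prefWeight, Finset.sum_div]
  rw [Finset.sum_comm]
  refine Finset.sum_congr rfl fun i _ => ?_
  rw [Finset.sum_comm]
  refine Finset.sum_congr rfl fun j _ => ?_
  split_ifs <;> simp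

theorem IsProbWeight.le_one {w : Fin m → Fin m → ℝ} (hw : IsProbWeight w) (i j : Fin m) :
    w i j ≤ 1 := by
  by_cases h : i = j
  · rw [h, hw.diag]; exact zero_le_one
  · linarith [hw.add_eq_one i j h, hw.nonneg j i]

theorem weightCost_nonneg {w : Fin m → Fin m → ℝ} (hw : IsProbWeight w) (σ : Ranking m) :
    0 ≤ weightCost w σ :=
  Finset.sum_nonneg fun i _ => Finset.sum_nonneg fun j _ => by
    split_ifs
    · exact hw.nonneg _ _
    · exact le_rfl

theorem weightCost_le_sq {w : Fin m → Fin m → ℝ} (hw : IsProbWeight w) (σ : Ranking m) :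
    weightCost w σ ≤ (m : ℝ) ^ 2 := by
  calc weightCost w σ ≤ ∑ _i : Fin m, ∑ _j : Fin m, (1 : ℝ) :=
        Finset.sum_le_sum fun i _ => Finset.sum_le_sum fun j _ => by
          split_ifs
          · exact hw.le_one _ _
          · exact zero_le_one
    _ = _ := by simp [sq]

/-- The total difference of two weight matrices. -/
def weightDist (w w' : Fin m → Fin m → ℝ) : ℝ := ∑ i, ∑ j, |w i j - w' i j|

theorem weightDist_comm (w w' : Fin m → Fin m → ℝ) : weightDist w w' = weightDist w' w := by
  simp only [weightDist, abs_sub_comm]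

theorem weightDist_nonneg (w w' : Fin m → Fin m → ℝ) : 0 ≤ weightDist w w' :=
  Finset.sum_nonneg fun _ _ => Finset.sum_nonneg fun _ _ => abs_nonneg _

theorem weightCost_le_add_weightDist (w w' : Fin m → Fin m → ℝ) (σ : Ranking m) :
    weightCost w σ ≤ weightCost w' σ + weightDist w w' := by
  rw [weightDist, Finset.sum_comm, weightCost, weightCost, ← Finset.sum_add_distrib]
  refine Finset.sum_le_sum fun i _ => ?_
  rw [← Finset.sum_add_distrib]
  refine Finset.sum_le_sum fun j _ => ?_
  split_ifs
  · linarith [le_abs_self (w j i - w' j i)]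
  · simp

theorem opt_le (cost : Ranking m → ℝ) (σ : Ranking m) : opt cost ≤ cost σ :=
  ciInf_le (Set.finite_range _).bddBelow σ

theorem exists_eq_opt (cost : Ranking m → ℝ) : ∃ σ, cost σ = opt cost :=
  exists_eq_ciInf_of_finite

theorem opt_le_add_weightDist (w w' : Fin m → Fin m → ℝ) :
    opt (weightCost w) ≤ opt (weightCost w') + weightDist w w' := by
  obtain ⟨σ, hσ⟩ := exists_eq_opt (weightCost w')
  rw [← hσ]
  exact (opt_le _ σ).trans (weightCost_le_add_weightDist w w' σ)

theorem opt_nonneg {w : Fin m → Fin m → ℝ} (hw : IsProbWeight w) : 0 ≤ opt (weightCost w) :=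
  le_ciInf fun σ => weightCost_nonneg hw σ

/-- The average position of item `i`. -/
def avgPos (w : Fin m → Fin m → ℝ) (i : Fin m) : ℝ := ∑ j, w j i

theorem sum_before_eq (σ : Ranking m) (i : Fin m) :
    ∑ j, (if σ j < σ i then (1 : ℝ) else 0) = (σ i : ℕ) := by
  rw [Equiv.sum_comp σ (fun j => if j < σ i then (1 : ℝ) else 0), Finset.sum_boole,
    show (Finset.univ.filter fun j => j < σ i) = Finset.Iio (σ i) by ext; simp, Fin.card_Iio]

/-- The position of `i` in `σ` is the number of items that `σ` puts before `i`. Replacing the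
weights `w j i` by these indicators changes each summand by exactly what `σ` pays for the pair `i,
j`, and these pairs are only some of those that contribute to the cost. -/
theorem abs_avgPos_sub_le {w : Fin m → Fin m → ℝ} (hw : IsProbWeight w) (σ : Ranking m)
    (i : Fin m) : |avgPos w i - (σ i : ℕ)| ≤ weightCost w σ := by
  set f : Fin m → Fin m → ℝ := fun a b => if σ a < σ b then w b a else 0 with hf
  have f0 : ∀ a b, 0 ≤ f a b := fun a b => by
    simp only [hf]; split_ifs
    · exact hw.nonneg _ _
    · exact le_rfl
  have hterm : ∀ j, |w j i - (if σ j < σ i then (1 : ℝ) else 0)| = f i j + f j i := by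
    intro j
    rcases lt_trichotomy (σ j) (σ i) with h | h | h
    · have hne : j ≠ i := fun e => h.ne (congrArg σ e)
      have := hw.add_eq_one j i hne
      simp only [hf, h, if_true, h.not_gt, if_false, zero_add]
      rw [show w j i - 1 = - w i j by linarith, abs_neg, abs_of_nonneg (hw.nonneg _ _)]
    · obtain rfl := σ.injective h
      simp [hf, hw.diag]
    · simp [hf, h, h.not_gt, abs_of_nonneg (hw.nonneg _ _)]
  calc |avgPos w i - (σ i : ℕ)|
      = |∑ j, (w j i - (if σ j < σ i then (1 : ℝ) else 0))| := by
        rw [Finset.sum_sub_distrib, sum_before_eq, avgPos]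
    _ ≤ ∑ j, (f i j + f j i) := by
        refine (Finset.abs_sum_le_sum_abs _ _).trans (Finset.sum_le_sum fun j _ => (hterm j).le)
    _ = ∑ j, f i j + ∑ j ∈ Finset.univ.erase i, f j i := by
        rw [Finset.sum_add_distrib, Finset.sum_erase]
        simp [hf]
    _ ≤ ∑ j, f i j + ∑ j ∈ Finset.univ.erase i, ∑ b, f j b := by
        gcongr with j
        exact Finset.single_le_sum (f := f j) (fun b _ => f0 j b) (Finset.mem_univ i)
    _ = weightCost w σ := Finset.add_sum_erase _ (fun a => ∑ b, f a b) (Finset.mem_univ i)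

/-- Listing the items in the order of `σ`, the ranks are a strictly increasing map of `Fin m` to
itself, hence the identity. -/
theorem lexPerm_eq {C : Fin m → ℕ} {σ : Ranking m} (h : ∀ i j, σ i < σ j → C i < C j) :
    lexPerm C = σ := by
  have hmono : StrictMono fun a => lexPerm C (σ.symm a) := by
    intro a b hab
    have : C (σ.symm a) < C (σ.symm b) := h _ _ (by simpa using hab)
    exact lexRank_lt_lexRank (Or.inl this)
  have := hmono.eq_id
  ext i
  have h1 := congrFun this (σ i)
  simp only [Equiv.symm_apply_apply, id] at h1
  rw [h1]

/-- If the scores `s` are close to the average positions, then sorting by an increasing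
function of the scores gives a cheap ranking. -/
theorem weightCost_lexPerm_le {w : Fin m → Fin m → ℝ} (hw : IsProbWeight w) (hm : 1 ≤ m)
    {C : Fin m → ℕ} {s : Fin m → ℝ} (hC : ∀ i j, s i < s j → C i < C j) :
    weightCost w (lexPerm C) ≤
      3 * (m : ℝ) ^ 2 * opt (weightCost w) + 6 * (m : ℝ) ^ 2 * ∑ i, |s i - avgPos w i| := by
  have hm1 : (1 : ℝ) ≤ (m : ℝ) ^ 2 := one_le_pow₀ (by exact_mod_cast hm)
  have h0 := opt_nonneg hw
  have hs0 : 0 ≤ ∑ i, |s i - avgPos w i| := Finset.sum_nonneg fun _ _ => abs_nonneg _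
  have hsq := weightCost_le_sq hw (lexPerm C)
  by_cases h1 : 1 / 3 ≤ opt (weightCost w)
  -- Here the trivial bound m² on the cost is enough, and similarly when some score is off by at
  -- least 1/6.
  · nlinarith [mul_nonneg (zero_le_one.trans hm1) hs0]
  by_cases h2 : ∃ i, 1 / 6 ≤ |s i - avgPos w i|
  · obtain ⟨i, hi⟩ := h2
    have := Finset.single_le_sum (f := fun i => |s i - avgPos w i|) (fun _ _ => abs_nonneg _)
      (Finset.mem_univ i)
    have h3 : 1 / 6 ≤ ∑ i, |s i - avgPos w i| := hi.trans this
    nlinarith [mul_nonneg (zero_le_one.trans hm1) h0]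
  push Not at h1 h2
  obtain ⟨σ, hσ⟩ := exists_eq_opt (weightCost w)
  have : lexPerm C = σ := by
    -- Each score is within 1/3 + 1/6 = 1/2, strictly, of the position in an optimal ranking.
    -- Positions are integers, so the scores are in the optimal order.
    refine lexPerm_eq fun i j hij => hC i j ?_
    have a1 := abs_le.1 (abs_avgPos_sub_le hw σ i)
    have a2 := abs_le.1 (abs_avgPos_sub_le hw σ j)
    have b1 := abs_lt.1 (h2 i)
    have b2 := abs_lt.1 (h2 j)
    have : ((σ i : ℕ) : ℝ) + 1 ≤ (σ j : ℕ) := by exact_mod_cast hij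
    linarith
  rw [this, hσ]
  nlinarith [mul_nonneg (zero_le_one.trans hm1) hs0]

/-- The cost of an output. -/
noncomputable def outputCost (cost : Ranking m → ℝ) : Option (Ranking m) → ℝ≥0∞
  | none => ⊤
  | some σ => ENNReal.ofReal (cost σ)

theorem expectedCost_eq (μ : PMF (Option (Ranking m))) (cost : Ranking m → ℝ) :
    expectedCost μ cost = ∑' o, μ o * outputCost cost o := by
  unfold expectedCost
  refine tsum_congr fun o => ?_
  cases o <;> rfl

/-- The matrix is exchanged twice: in the cost of the output, which loses the distance once, and in
the optimum, which loses it `α` times. -/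
theorem expectedCost_le_of_isApprox {w w' : Fin m → Fin m → ℝ} (hw : IsProbWeight w)
    {α : ℝ} (hα : 0 ≤ α) {μ : PMF (Option (Ranking m))} (h : IsApprox μ (weightCost w') α 0) :
    expectedCost μ (weightCost w) ≤
      ENNReal.ofReal (α * opt (weightCost w) + (α + 1) * weightDist w' w) := by
  have hd := weightDist_nonneg w' w
  have h0 : 0 ≤ α * (opt (weightCost w) + weightDist w' w) :=
    mul_nonneg hα (add_nonneg (opt_nonneg hw) hd)
  calc expectedCost μ (weightCost w)
      ≤ ∑' o, (μ o * outputCost (weightCost w') o + μ o * ENNReal.ofReal (weightDist w' w)) := by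
        rw [expectedCost_eq]
        refine ENNReal.tsum_le_tsum fun o => ?_
        rw [← mul_add]
        gcongr
        cases o with
        | none => exact le_self_add
        | some σ =>
          simp only [outputCost]
          refine (ENNReal.ofReal_le_ofReal ?_).trans ENNReal.ofReal_add_le
          rw [weightDist_comm]
          exact weightCost_le_add_weightDist w w' σ
    _ = expectedCost μ (weightCost w') + ENNReal.ofReal (weightDist w' w) := by
        rw [ENNReal.tsum_add, ENNReal.tsum_mul_right, PMF.tsum_coe, one_mul, expectedCost_eq]
    _ ≤ ENNReal.ofReal (α * (opt (weightCost w) + weightDist w' w)) +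
          ENNReal.ofReal (weightDist w' w) := by
        gcongr
        refine h.trans (ENNReal.ofReal_le_ofReal ?_)
        rw [add_zero]
        exact mul_le_mul_of_nonneg_left (opt_le_add_weightDist w' w) hα
    _ = _ := by
        rw [← ENNReal.ofReal_add h0 hd]
        congr 1; ring

end Cost

end RankAgg

namespace RankAgg

/-! ### Accuracy of the estimates -/

/-- The unbiased estimate of a user's bit that is obtained from the answer `r`. -/
noncomputable def debias (e : ℝ) (r : Bool) : ℝ := (r.toNat * (2 + e) - 1) / e

theorem sum_rrWeight_mul_debias {e : ℝ} (he : 0 < e) (b : Bool) :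
    ∑ r, rrWeight e b r * debias e r = b.toNat := by
  have : 2 + e ≠ 0 := by positivity
  cases b <;> simp [rrWeight, debias] <;> field_simp <;> ring

theorem debias_sq_le {e : ℝ} (he : 0 < e) (r : Bool) : debias e r ^ 2 ≤ ((1 + e) / e) ^ 2 := by
  unfold debias
  rw [div_pow, div_pow]
  refine div_le_div_of_nonneg_right ?_ (sq_nonneg e)
  refine sq_le_sq' ?_ ?_ <;> cases r <;> simp only [Bool.toNat_false, Bool.toNat_true] <;>
    push_cast <;> linarith

theorem sum_rrWeight_mul_debias_sq {e : ℝ} (he : 0 < e) (b : Bool) :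
    ∑ r, rrWeight e b r * debias e r ^ 2 ≤ ((1 + e) / e) ^ 2 :=
  calc _ ≤ ∑ r, rrWeight e b r * ((1 + e) / e) ^ 2 := by
        exact Finset.sum_le_sum fun r _ =>
          mul_le_mul_of_nonneg_left (debias_sq_le he r) (rrWeight_nonneg he.le _ _)
    _ = _ := by rw [← Finset.sum_mul, sum_rrWeight he.le, one_mul]

theorem abs_clampUnit_sub_le {x w : ℝ} (h0 : 0 ≤ w) (h1 : w ≤ 1) :
    |clampUnit x - w| ≤ |x - w| := by
  unfold clampUnit
  split_ifs with h h'
  · rw [abs_of_nonpos (by linarith), abs_of_nonpos (by linarith)]; linarith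
  · rw [abs_of_nonneg (by linarith), abs_of_nonneg (by linarith)]; linarith
  · exact le_rfl

section Estimates

variable {n m : ℕ} {D : Fin n → Ranking m} {e : ℝ}

/-- The formula used by the server is linear in the answers, so it is a sum of debiased bits over
the group. -/
theorem groupEst_eq (g : Fin n → Fin m) (u : Fin m) (r : Fin n → Bool) :
    groupEst e m n (∑ k : Fin n, if g k = u then (r k).toNat else 0)
      (∑ k : Fin n, if g k = u then 1 else 0) =
      ∑ k, (m / n : ℝ) * if g k = u then debias e (r k) else 0 := by
  rw [groupEst, ← Finset.mul_sum, mul_comm]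
  congr 1
  push_cast
  rw [Finset.sum_mul, ← Finset.sum_sub_distrib, Finset.sum_div]
  refine Finset.sum_congr rfl fun k _ => ?_
  split_ifs <;> simp [debias]

/-- For one user the product of membership in the group `u`, the debiased answer and m/n has mean
1/n times the true bit, and these products are independent over the users. Clamping to the interval
that contains the true weight only reduces the error. -/
theorem expected_entry_error_le (hn : 1 ≤ n) (hm : 1 ≤ m) (he : 0 < e) (u i j : Fin m) :
    (∑ g : Fin n → Fin m, (∏ _k : Fin n, ENNReal.ofReal (1 / m)) * ∑ r, answerWeight D e i j r *
      ENNReal.ofReal |entry g e (u, r) - prefWeight D i j|) ≤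
      ENNReal.ofReal ((1 + e) / e * Real.sqrt (m / n)) := by
  have hm0 : (0 : ℝ) < m := by exact_mod_cast hm
  have hn0 : (0 : ℝ) < n := by exact_mod_cast hn
  set Y := (1 + e) / e with hY
  have hY0 : 0 ≤ Y := by positivity
  set p : Fin n → Fin m × Bool → ℝ := fun k v => (1 / m) * rrWeight e (before (D k) i j) v.2 with hp
  set X : Fin n → Fin m × Bool → ℝ :=
    fun _ v => (m / n : ℝ) * if v.1 = u then debias e v.2 else 0 with hX
  have p0 : ∀ k v, 0 ≤ p k v := fun k v => mul_nonneg (by positivity) (rrWeight_nonneg he.le _ _)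
  have hw := isProbWeight_prefWeight hn D
  have hsum : ∀ k (F : Fin m → Bool → ℝ), ∑ v, p k v * F v.1 v.2 =
      (1 / m) * ∑ a, ∑ r, rrWeight e (before (D k) i j) r * F a r := by
    intro k F
    rw [Fintype.sum_prod_type, Finset.mul_sum]
    refine Finset.sum_congr rfl fun a _ => ?_
    rw [Finset.mul_sum]
    exact Finset.sum_congr rfl fun r _ => by simp only [hp]; ring
  have hsum' : ∀ k (G : Bool → ℝ), ∑ v : Fin m × Bool, p k v * (if v.1 = u then G v.2 else 0) =
      (1 / m) * ∑ r, rrWeight e (before (D k) i j) r * G r := by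
    intro k G
    rw [hsum k fun a r => if a = u then G r else 0]
    simp
  have p1 : ∀ k, ∑ v, p k v = 1 := by
    intro k
    have := hsum k fun _ _ => 1
    simp only [mul_one] at this
    rw [this]
    simp only [sum_rrWeight he.le]
    simp [hm0.ne']
  have key := prodExp_abs_sum_le p0 p1 X (fun k => ((before (D k) i j).toNat : ℝ) / n) ?_
    -- Second moment of one term: (m/n)²·Y² times the probability 1/m of belonging to the group.
    (m * Y ^ 2 / n ^ 2) ?_
  · have hs : Real.sqrt (Fintype.card (Fin n) * (m * Y ^ 2 / n ^ 2)) = Y * Real.sqrt (m / n) := by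
      rw [Fintype.card_fin, show (n : ℝ) * (m * Y ^ 2 / n ^ 2) = Y ^ 2 * (m / n) by field_simp,
        Real.sqrt_mul (sq_nonneg _), Real.sqrt_sq hY0]
    rw [hs] at key
    refine le_trans ?_ (ENNReal.ofReal_le_ofReal key)
    rw [← prodExp_ofReal p0 fun _ => abs_nonneg _]
    have e1 : (fun k v => ENNReal.ofReal (p k v)) = fun k (v : Fin m × Bool) =>
        ENNReal.ofReal (1 / m) * ENNReal.ofReal (rrWeight e (before (D k) i j) v.2) := by
      ext k v
      rw [← ENNReal.ofReal_mul (by positivity)]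
    rw [e1, ← prodExp_prodExp (fun _ _ => ENNReal.ofReal (1 / m))
      (fun k r => ENNReal.ofReal (rrWeight e (before (D k) i j) r))
      (fun g r => ENNReal.ofReal |∑ k, X k (g k, r k) -
        ∑ k, ((before (D k) i j).toNat : ℝ) / n|)]
    refine prodExp_mono _ fun g => prodExp_mono _ fun r => ENNReal.ofReal_le_ofReal ?_
    rw [← Finset.sum_div]
    simp only [hX]
    rw [← groupEst_eq]
    exact abs_clampUnit_sub_le (hw.nonneg i j) (hw.le_one i j)
  · intro k
    have : ∀ v : Fin m × Bool, X k v = if v.1 = u then (m / n : ℝ) * debias e v.2 else 0 :=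
      fun v => by simp only [hX]; split_ifs <;> simp
    simp only [this, hsum' k fun r => (m / n : ℝ) * debias e r, mul_left_comm _ (m / n : ℝ),
      ← Finset.mul_sum, sum_rrWeight_mul_debias he]
    field_simp
  · intro k
    have : ∀ v : Fin m × Bool, X k v ^ 2 = if v.1 = u then (m / n : ℝ) ^ 2 * debias e v.2 ^ 2 else 0 :=
      fun v => by simp only [hX]; split_ifs <;> simp [mul_pow]
    simp only [this, hsum' k fun r => (m / n : ℝ) ^ 2 * debias e r ^ 2,
      mul_left_comm _ ((m / n : ℝ) ^ 2), ← Finset.mul_sum]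
    refine (mul_le_mul_of_nonneg_left (mul_le_mul_of_nonneg_left
      (sum_rrWeight_mul_debias_sq he _) (by positivity)) (by positivity)).trans (le_of_eq ?_)
    rw [← hY]
    field_simp

theorem expected_answer_error_le (hn : 1 ≤ n) (he : 0 < e) (i j : Fin m) :
    ∑ r, answerWeight D e i j r *
      ENNReal.ofReal |(∑ k, debias e (r k)) / n - prefWeight D i j| ≤
      ENNReal.ofReal ((1 + e) / e / Real.sqrt n) := by
  have hn0 : (0 : ℝ) < n := by exact_mod_cast hn
  set Y := (1 + e) / e with hY
  have hY0 : 0 ≤ Y := by positivity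
  have p0 : ∀ (k : Fin n) r, 0 ≤ rrWeight e (before (D k) i j) r :=
    fun k r => rrWeight_nonneg he.le _ _
  have key := prodExp_abs_sum_le p0 (fun k => sum_rrWeight he.le _) (fun _ r => debias e r / n)
    (fun k => ((before (D k) i j).toNat : ℝ) / n) ?_ (Y ^ 2 / n ^ 2) ?_
  · have hs : Real.sqrt (Fintype.card (Fin n) * (Y ^ 2 / n ^ 2)) = Y / Real.sqrt n := by
      rw [Fintype.card_fin, show (n : ℝ) * (Y ^ 2 / n ^ 2) = Y ^ 2 / n by field_simp,
        Real.sqrt_div (sq_nonneg _), Real.sqrt_sq hY0]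
    rw [hs, ← ENNReal.ofReal_le_ofReal_iff (by positivity),
      ← prodExp_ofReal p0 fun _ => abs_nonneg _] at key
    simp only [← Finset.sum_div] at key
    exact key
  · intro k
    simp only [mul_div_assoc', ← Finset.sum_div, sum_rrWeight_mul_debias he]
  · intro k
    simp only [div_pow, mul_div_assoc', ← Finset.sum_div]
    gcongr
    exact sum_rrWeight_mul_debias_sq he _

/-- The estimate of the average position of item `i` obtained from the answers. -/
noncomputable def posEst (e : ℝ) (x : Fin m → Fin n → Bool) : ℝ :=
  ∑ j, (∑ k, debias e (x j k)) / n

theorem posEst_eq (e : ℝ) (x : Fin m → Fin n → Bool) :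
    posEst e x = (answerCount x * (2 + e) - m * n) / e / n := by
  have : ∀ j : Fin m, (∑ k, debias e (x j k)) / n =
      ((∑ k, ((x j k).toNat : ℝ)) * (2 + e) - n) / e / n := by
    intro j
    simp only [debias, ← Finset.sum_div, Finset.sum_sub_distrib, Finset.sum_mul]
    simp
  simp only [posEst, this, answerCount, ← Finset.sum_div, Finset.sum_sub_distrib, ← Finset.sum_mul]
  simp

/-- The estimate is an increasing affine function of the count, so the server can sort by the
natural counts themselves. -/
theorem answerCount_lt_of_posEst_lt (he : 0 < e) {x y : Fin m → Fin n → Bool}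
    (h : posEst e x < posEst e y) : answerCount x < answerCount y := by
  by_contra hle
  have : (answerCount y : ℝ) ≤ answerCount x := by exact_mod_cast not_lt.1 hle
  refine h.not_ge ?_
  rw [posEst_eq, posEst_eq]
  gcongr

theorem expected_posEst_error_le (hn : 1 ≤ n) (he : 0 < e) (i : Fin m) :
    ∑ x : Fin m → Fin n → Bool, (∏ j, answerWeight D e j i (x j)) *
      ENNReal.ofReal |posEst e x - avgPos (prefWeight D) i| ≤
      ENNReal.ofReal (m * ((1 + e) / e / Real.sqrt n)) := by
  have h1 : ∀ j : Fin m, ∑ r, answerWeight D e j i r = 1 := fun j => sum_answerWeight he.le j i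
  calc _ ≤ prodExp (fun j r => answerWeight D e j i r) (fun x : Fin m → Fin n → Bool =>
        ∑ j, ENNReal.ofReal |(∑ k, debias e (x j k)) / n - prefWeight D j i|) := by
        refine prodExp_mono _ fun x => ?_
        rw [← ENNReal.ofReal_sum_of_nonneg fun _ _ => abs_nonneg _]
        refine ENNReal.ofReal_le_ofReal ?_
        rw [posEst, avgPos, ← Finset.sum_sub_distrib]
        exact Finset.abs_sum_le_sum_abs _ _
    _ = ∑ j, ∑ r, answerWeight D e j i r *
          ENNReal.ofReal |(∑ k, debias e (r k)) / n - prefWeight D j i| := by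
        rw [prodExp_sum]
        exact Finset.sum_congr rfl fun j _ => prodExp_marginal (fun j r => answerWeight D e j i r)
          h1 j fun r => ENNReal.ofReal |(∑ k, debias e (r k)) / n - prefWeight D j i|
    _ ≤ ∑ _j : Fin m, ENNReal.ofReal ((1 + e) / e / Real.sqrt n) :=
        Finset.sum_le_sum fun j _ => expected_answer_error_le hn he j i
    _ = _ := by
        rw [← ENNReal.ofReal_sum_of_nonneg fun _ _ => by positivity]
        simp

/-- The expected cost of the fallback ranking. -/
theorem expected_fallback_cost_le (hn : 1 ≤ n) (hm : 1 ≤ m) (he : 0 < e) :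
    ∑ x : Fin m → Fin m → Fin n → Bool, (∏ i, ∏ j, answerWeight D e j i (x i j)) *
      ENNReal.ofReal (weightCost (prefWeight D) (lexPerm fun i => answerCount (x i))) ≤
      ENNReal.ofReal (3 * m ^ 2 * opt (weightCost (prefWeight D)) +
        6 * m ^ 4 * ((1 + e) / e / Real.sqrt n)) := by
  have hw := isProbWeight_prefWeight hn D
  set w := prefWeight D
  set μ : Fin m → (Fin m → Fin n → Bool) → ℝ≥0∞ := fun i x => ∏ j, answerWeight D e j i (x j)
    with hμ
  have h1 : ∀ i, ∑ x, μ i x = 1 := fun i => prodExp_weights (fun (j : Fin m) r =>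
    answerWeight D e j i r) fun j => sum_answerWeight he.le j i
  have h0 := opt_nonneg hw
  calc _ ≤ prodExp μ (fun x => ENNReal.ofReal (3 * m ^ 2 * opt (weightCost w)) +
        ENNReal.ofReal (6 * m ^ 2) * ∑ i, ENNReal.ofReal |posEst e (x i) - avgPos w i|) := by
        refine prodExp_mono _ fun x => ?_
        rw [← ENNReal.ofReal_sum_of_nonneg fun _ _ => abs_nonneg _,
          ← ENNReal.ofReal_mul (by positivity), ← ENNReal.ofReal_add (by positivity)
          (mul_nonneg (by positivity) (Finset.sum_nonneg fun _ _ => abs_nonneg _))]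
        exact ENNReal.ofReal_le_ofReal (weightCost_lexPerm_le hw hm fun i j =>
          answerCount_lt_of_posEst_lt he)
    _ = ENNReal.ofReal (3 * m ^ 2 * opt (weightCost w)) + ENNReal.ofReal (6 * m ^ 2) *
          ∑ i, ∑ x, μ i x * ENNReal.ofReal |posEst e x - avgPos w i| := by
        rw [prodExp_add, prodExp_const μ h1, prodExp_mul_left, prodExp_sum]
        congr 2
        exact Finset.sum_congr rfl fun i _ => prodExp_marginal μ h1 i
          fun x => ENNReal.ofReal |posEst e x - avgPos w i|
    _ ≤ ENNReal.ofReal (3 * m ^ 2 * opt (weightCost w)) + ENNReal.ofReal (6 * m ^ 2) *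
          ∑ _i : Fin m, ENNReal.ofReal (m * ((1 + e) / e / Real.sqrt n)) := by
        gcongr with i
        exact expected_posEst_error_le hn he i
    _ = _ := by
        rw [← ENNReal.ofReal_sum_of_nonneg fun _ _ => by positivity,
          ← ENNReal.ofReal_mul (by positivity), ← ENNReal.ofReal_add (by positivity)
            (by positivity)]
        congr 1
        simp only [Finset.sum_const, Finset.card_univ, Fintype.card_fin, nsmul_eq_mul]
        ring

end Estimates

end RankAgg

namespace RankAgg

/-! ### Accuracy of the protocol -/

theorem toOuterMeasure_compl_le {T : Type} (μ : PMF T) (S : Set T) {x : ℝ}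
    (h : ENNReal.ofReal (1 - x) ≤ μ.toOuterMeasure S) :
    μ.toOuterMeasure Sᶜ ≤ ENNReal.ofReal x := by
  have h1 : μ.toOuterMeasure S + μ.toOuterMeasure Sᶜ = 1 := by
    rw [PMF.toOuterMeasure_apply, PMF.toOuterMeasure_apply, ← ENNReal.tsum_add, ← μ.tsum_coe]
    exact tsum_congr fun t => by rw [← Pi.add_apply, Set.indicator_self_add_compl]
  have h2 : (1 : ℝ≥0∞) ≤ ENNReal.ofReal (1 - x) + ENNReal.ofReal x := by
    calc (1 : ℝ≥0∞) = ENNReal.ofReal ((1 - x) + x) := by simp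
      _ ≤ _ := ENNReal.ofReal_add_le
  have h3 : μ.toOuterMeasure S ≠ ⊤ := fun h => by simp [h] at h1
  refine (ENNReal.add_le_add_iff_left h3).1 ?_
  rw [h1]
  exact h2.trans (add_le_add_left h _)

section Utility

variable {n m : ℕ} {D : Fin n → Ranking m}

theorem chainExp_finalValue (A : Cmd) (t : ℕ → ℕ) (w : Fin m → Fin m → ℝ)
    (c : Option (Ranking m) → ℝ≥0∞) (cF : ℝ≥0∞) (q : ℕ) :
    chainExp (step (weightOracle w)) (finalValue (fun ν => c (readRanking m ν)) cF q) (t m)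
      (Config.start A ([m], [])) = ∑' o, queryOutput A t w o * c o +
        cF * (queryCount A t w).toOuterMeasure {k | k ≤ q}ᶜ := by
  classical
  rw [queryOutput, PMF.tsum_map_mul, queryCount, PMF.toOuterMeasure_map_apply,
    PMF.toOuterMeasure_apply, ← ENNReal.tsum_mul_left, ← ENNReal.tsum_add]
  refine tsum_congr fun s => ?_
  rw [finalValue, mul_add]
  congr 1
  rw [Set.indicator_apply, mul_left_comm]
  simp only [Set.mem_preimage, Set.mem_compl_iff, Set.mem_ofPred_eq, not_le, mul_ite, mul_one,
    mul_zero]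
  rfl

/-- The weight matrix given by the random choices `ω`. -/
noncomputable def drawnWeight (g : Fin n → Fin m) (e : ℝ)
    (ω : Fin m × Fin m → Fin m × (Fin n → Bool)) (i j : Fin m) : ℝ :=
  if i < j then entry g e (ω (i, j)) else if j < i then 1 - entry g e (ω (j, i)) else 0

theorem tableWeight_none (p : SimParams n m) (ω : Fin m × Fin m → Fin m × (Fin n → Bool)) :
    tableWeight p (fun _ _ => none) ω = drawnWeight p.g p.e ω := rfl

/-- For fixed choices `ω` the algorithm faces a fixed legal matrix, so its approximation guarantee
and its bound on the number of queries apply. -/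
theorem tableExp_le {A : Cmd} {t : ℕ → ℕ} {α : ℝ} (hA : QueryApprox A t α) (hα : 0 ≤ α)
    (hn : 1 ≤ n) (hm : 1 ≤ m) {δ : ℝ} (p : SimParams n m) (he : 0 ≤ p.e)
    (hq : ∀ w : Fin m → Fin m → ℝ, IsProbWeight w →
      ENNReal.ofReal (1 - δ) ≤ (queryCount A t w).toOuterMeasure {k | k ≤ p.q}) (cF : ℝ≥0∞) :
    tableExp D p (finalValue (fun ν => outputCost (kemeny D) (readRanking m ν)) cF p.q) (t m)
      (Config.start A ([m], [])) (fun _ _ => none) ≤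
      prodExp (choiceWeight D p.e) (fun ω => ENNReal.ofReal (α * opt (kemeny D) +
        (α + 1) * weightDist (drawnWeight p.g p.e ω) (prefWeight D))) +
      cF * ENNReal.ofReal δ := by
  rw [← prodExp_const (choiceWeight D p.e) (sum_choiceWeight hm he) (cF * ENNReal.ofReal δ),
    ← prodExp_add, tableExp]
  refine prodExp_mono _ fun ω => ?_
  rw [chainExp_finalValue, tableWeight_none]
  have hw : IsProbWeight (drawnWeight p.g p.e ω) := by
    rw [← tableWeight_none]; exact isProbWeight_tableWeight (by simp) ω
  refine add_le_add ?_ (mul_le_mul_right (toOuterMeasure_compl_le _ _ (hq _ hw)) _)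
  have hk : kemeny D = weightCost (prefWeight D) := funext fun σ => kemeny_eq_weightCost D σ
  rw [← expectedCost_eq, hk]
  exact expectedCost_le_of_isApprox (isProbWeight_prefWeight hn D) hα (hA m hm _ hw)

/-- The fallback answers are independent of the simulation and enter its bound only through `cF`.
Hence the expected cost of the fallback is multiplied by the bound on the failure probability. -/
theorem totalBound_le {A : Cmd} {t : ℕ → ℕ} {α : ℝ} (hA : QueryApprox A t α) (hα : 0 ≤ α)
    (hn : 1 ≤ n) (hm : 1 ≤ m) {q : ℕ} {ε δ : ℝ} (hε : 0 < ε)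
    (hq : ∀ w : Fin m → Fin m → ℝ, IsProbWeight w →
      ENNReal.ofReal (1 - δ) ≤ (queryCount A t w).toOuterMeasure {k | k ≤ q}) :
    totalBound A D q ε (t m) (outputCost (kemeny D)) ≤
      (∑ g : Fin n → Fin m, (∏ _k : Fin n, ENNReal.ofReal (1 / m)) *
        prodExp (choiceWeight D (queryEps m q ε)) fun ω => ENNReal.ofReal (α * opt (kemeny D) +
          (α + 1) * weightDist (drawnWeight g (queryEps m q ε) ω) (prefWeight D))) +
      (∑ x : Fin m → Fin m → Fin n → Bool,
        (∏ i, ∏ j, answerWeight D (fallbackEps m ε) j i (x i j)) *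
          ENNReal.ofReal (weightCost (prefWeight D) (lexPerm fun i => answerCount (x i)))) *
        (ENNReal.ofReal δ + potential q (fun _ : Fin m => 0) 0) := by
  have e0 : 0 ≤ queryEps m q ε := by unfold queryEps; positivity
  have e2 : 0 ≤ fallbackEps m ε := by unfold fallbackEps; positivity
  set ν : Fin m → (Fin m → Fin n → Bool) → ℝ≥0∞ :=
    fun i x => ∏ j, answerWeight D (fallbackEps m ε) j i (x j) with hν
  have hν1 : ∀ i, ∑ x, ν i x = 1 := fun i => prodExp_weights (fun (j : Fin m) r =>
    answerWeight D (fallbackEps m ε) j i r) fun j => sum_answerWeight e2 j i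
  have hg : ∑ g : Fin n → Fin m, ∏ _k : Fin n, ENNReal.ofReal (1 / m) = 1 :=
    prodExp_weights (fun (_ : Fin n) (_ : Fin m) => ENNReal.ofReal (1 / m))
      fun _ => sum_inv_card hm
  set K := ENNReal.ofReal δ + potential q (fun _ : Fin m => 0) 0 with hK
  set Q := ∑ g : Fin n → Fin m, (∏ _k : Fin n, ENNReal.ofReal (1 / m)) *
        prodExp (choiceWeight D (queryEps m q ε)) fun ω => ENNReal.ofReal (α * opt (kemeny D) +
          (α + 1) * weightDist (drawnWeight g (queryEps m q ε) ω) (prefWeight D)) with hQ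
  calc totalBound A D q ε (t m) (outputCost (kemeny D))
      ≤ prodExp ν (fun x => Q + K * ENNReal.ofReal
          (weightCost (prefWeight D) (lexPerm fun i => answerCount (x i)))) := by
        refine prodExp_mono _ fun x => ?_
        set cF := outputCost (kemeny D) (some (lexPerm fun i => answerCount (x i))) with hcF
        have hcF' : ENNReal.ofReal (weightCost (prefWeight D)
            (lexPerm fun i => answerCount (x i))) = cF := by
          rw [hcF, outputCost, kemeny_eq_weightCost]
        calc _ ≤ ∑ g : Fin n → Fin m, (∏ _k : Fin n, ENNReal.ofReal (1 / m)) *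
              (prodExp (choiceWeight D (queryEps m q ε)) (fun ω => ENNReal.ofReal
                (α * opt (kemeny D) + (α + 1) *
                  weightDist (drawnWeight g (queryEps m q ε) ω) (prefWeight D))) + K * cF) := by
              refine Finset.sum_le_sum fun g _ => mul_le_mul_right ?_ _
              rw [simBound, if_neg (by simp)]
              refine (add_le_add_left (tableExp_le hA hα hn hm (simParams q ε g x) e0 hq cF)
                _).trans (le_of_eq ?_)
              rw [add_assoc, ← mul_add, mul_comm K]
              rfl
          _ = _ := by
              simp only [mul_add, Finset.sum_add_distrib, ← Finset.sum_mul, hg, one_mul]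
              rw [hcF', hQ, hK]
    _ = Q + (prodExp ν fun x => ENNReal.ofReal
          (weightCost (prefWeight D) (lexPerm fun i => answerCount (x i)))) * K := by
        rw [prodExp_add, prodExp_const ν hν1, prodExp_mul_left, mul_comm K]
    _ = _ := rfl

/-- The entry is averaged over the random group as well. A pair in reverse order has the same error,
since both matrices satisfy the probability constraint. -/
theorem expected_drawnWeight_error_le (hn : 1 ≤ n) (hm : 1 ≤ m) {e : ℝ} (he : 0 < e)
    (i j : Fin m) :
    (∑ g : Fin n → Fin m, (∏ _k : Fin n, ENNReal.ofReal (1 / m)) *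
      prodExp (choiceWeight D e) fun ω =>
        ENNReal.ofReal |drawnWeight g e ω i j - prefWeight D i j|) ≤
      ENNReal.ofReal ((1 + e) / e * Real.sqrt (m / n)) := by
  have hw := isProbWeight_prefWeight hn D
  have key : ∀ i j : Fin m, (∑ g : Fin n → Fin m, (∏ _k : Fin n, ENNReal.ofReal (1 / m)) *
      prodExp (choiceWeight D e) fun ω =>
        ENNReal.ofReal |entry g e (ω (i, j)) - prefWeight D i j|) ≤
      ENNReal.ofReal ((1 + e) / e * Real.sqrt (m / n)) := by
    intro i j
    calc _ = ∑ g : Fin n → Fin m, (∏ _k : Fin n, ENNReal.ofReal (1 / m)) *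
          ∑ u, ENNReal.ofReal (1 / m) * ∑ r, answerWeight D e i j r *
            ENNReal.ofReal |entry g e (u, r) - prefWeight D i j| := by
          refine Finset.sum_congr rfl fun g _ => ?_
          rw [prodExp_marginal (choiceWeight D e) (sum_choiceWeight hm he.le) (i, j)
            fun x => ENNReal.ofReal |entry g e x - prefWeight D i j|, Fintype.sum_prod_type]
          simp only [choiceWeight, Finset.mul_sum, mul_assoc]
      _ = ∑ u : Fin m, ENNReal.ofReal (1 / m) * ∑ g : Fin n → Fin m,
            (∏ _k : Fin n, ENNReal.ofReal (1 / m)) * ∑ r, answerWeight D e i j r *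
            ENNReal.ofReal |entry g e (u, r) - prefWeight D i j| := by
          simp only [Finset.mul_sum (s := (Finset.univ : Finset (Fin m))),
            Finset.mul_sum (s := (Finset.univ : Finset (Fin n → Fin m)))]
          rw [Finset.sum_comm]
          exact Finset.sum_congr rfl fun u _ => Finset.sum_congr rfl fun g _ => mul_left_comm _ _ _
      _ ≤ ∑ _u : Fin m, ENNReal.ofReal (1 / m) *
            ENNReal.ofReal ((1 + e) / e * Real.sqrt (m / n)) := by
          gcongr with u
          exact expected_entry_error_le hn hm he u i j
      _ = _ := by rw [← Finset.sum_mul, sum_inv_card hm, one_mul]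
  rcases lt_trichotomy i j with h | h | h
  · simpa only [drawnWeight, if_pos h] using key i j
  · subst h
    simp [drawnWeight, hw.diag, prodExp]
  · have e1 : ∀ x : ℝ, |1 - x - prefWeight D i j| = |x - prefWeight D j i| := by
      intro x
      rw [← abs_neg]
      congr 1
      linarith [hw.add_eq_one i j h.ne']
    simpa only [drawnWeight, if_pos h, if_neg h.not_gt, e1] using key j i

theorem expected_query_cost_le (hn : 1 ≤ n) (hm : 1 ≤ m) {e a b : ℝ} (he : 0 < e) (ha : 0 ≤ a)
    (hb : 0 ≤ b) :
    (∑ g : Fin n → Fin m, (∏ _k : Fin n, ENNReal.ofReal (1 / m)) *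
      prodExp (choiceWeight D e) fun ω =>
        ENNReal.ofReal (a + b * weightDist (drawnWeight g e ω) (prefWeight D))) ≤
      ENNReal.ofReal (a + b * (m ^ 2 * ((1 + e) / e * Real.sqrt (m / n)))) := by
  have hg : ∑ g : Fin n → Fin m, ∏ _k : Fin n, ENNReal.ofReal (1 / m) = 1 :=
    prodExp_weights (fun (_ : Fin n) (_ : Fin m) => ENNReal.ofReal (1 / m))
      fun _ => sum_inv_card hm
  have split : ∀ (g : Fin n → Fin m) ω,
      ENNReal.ofReal (a + b * weightDist (drawnWeight g e ω) (prefWeight D)) =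
      ENNReal.ofReal a + ENNReal.ofReal b *
        ∑ i, ∑ j, ENNReal.ofReal |drawnWeight g e ω i j - prefWeight D i j| := by
    intro g ω
    rw [ENNReal.ofReal_add ha (mul_nonneg hb (weightDist_nonneg _ _)), ENNReal.ofReal_mul hb,
      weightDist, ENNReal.ofReal_sum_of_nonneg fun _ _ => Finset.sum_nonneg fun _ _ => abs_nonneg _]
    simp only [ENNReal.ofReal_sum_of_nonneg fun _ _ => abs_nonneg _]
  simp only [split, prodExp_add, prodExp_const (choiceWeight D e) (sum_choiceWeight hm he.le),
    prodExp_mul_left, prodExp_sum, mul_add, Finset.sum_add_distrib, ← Finset.sum_mul, hg, one_mul]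
  calc _ = ENNReal.ofReal a + ENNReal.ofReal b * ∑ i : Fin m, ∑ j : Fin m,
        ∑ g : Fin n → Fin m, (∏ _k : Fin n, ENNReal.ofReal (1 / m)) *
          prodExp (choiceWeight D e) fun ω =>
            ENNReal.ofReal |drawnWeight g e ω i j - prefWeight D i j| := by
        congr 1
        simp only [mul_left_comm _ (ENNReal.ofReal b), ← Finset.mul_sum]
        congr 1
        simp only [Finset.mul_sum]
        rw [Finset.sum_comm]
        refine Finset.sum_congr rfl fun i _ => ?_
        rw [Finset.sum_comm]
    _ ≤ ENNReal.ofReal a + ENNReal.ofReal b * ∑ _i : Fin m, ∑ _j : Fin m,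
          ENNReal.ofReal ((1 + e) / e * Real.sqrt (m / n)) := by
        gcongr with i _ j
        exact expected_drawnWeight_error_le hn hm he i j
    _ = _ := by
        rw [ENNReal.ofReal_add ha (by positivity), ENNReal.ofReal_mul hb]
        congr 2
        simp only [Finset.sum_const, Finset.card_univ, Fintype.card_fin,
          ENNReal.ofReal_mul (show (0 : ℝ) ≤ (m : ℝ) ^ 2 by positivity)]
        rw [nsmul_eq_mul, nsmul_eq_mul, ← mul_assoc, sq,
          ENNReal.ofReal_mul (p := m) (by positivity), ENNReal.ofReal_natCast]

end Utility

end RankAgg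

namespace RankAgg

/-! ### Numerical estimates and the assembly of the bound. -/

section Final

variable {n m : ℕ} {D : Fin n → Ranking m}

/-- The initial potential is at most 3m·exp(-4q/m + 2q/m), and 2q/m ≥ 20 log(m/ζ) turns this into
3m(ζ/m)^20. The constant 10 in the hypothesis leaves ample room. -/
theorem potential_zero_le (hm : 2 ≤ m) {q : ℕ} {ζ : ℝ} (h0 : 0 < ζ) (h1 : ζ ≤ 1)
    (hq : 10 * (m : ℝ) * Real.log (m / ζ) ≤ q) :
    potential q (fun _ : Fin m => 0) 0 ≤ ENNReal.ofReal (ζ / (3 * (m : ℝ) ^ 4)) := by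
  have hm2 : (2 : ℝ) ≤ m := by exact_mod_cast hm
  have hm0 : (0 : ℝ) < m := by linarith
  rw [potential, if_pos (Nat.zero_le _)]
  refine ENNReal.ofReal_le_ofReal ?_
  simp only [Nat.cast_zero, Real.exp_zero, Finset.sum_const, Finset.card_univ, Fintype.card_fin,
    nsmul_eq_mul, mul_one, Nat.sub_zero]
  have a1 : (1 + 2 / m : ℝ) ^ q ≤ Real.exp (2 * q / m) := by
    refine (one_add_pow_le_exp (by positivity) q).trans (le_of_eq ?_)
    congr 1; ring
  have a2 : Real.exp (-(4 * q / m)) * Real.exp (2 * q / m) ≤ (ζ / m) ^ 20 := by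
    rw [← Real.exp_add]
    have : (ζ / m : ℝ) ^ 20 = Real.exp (-(20 * Real.log (m / ζ))) := by
      rw [← inv_div (m : ℝ) ζ, inv_pow, Real.exp_neg, show (20 : ℝ) = (20 : ℕ) by norm_num,
        Real.exp_nat_mul, Real.exp_log (by positivity)]
    rw [this]
    refine Real.exp_le_exp.2 ?_
    have : 20 * Real.log (m / ζ) ≤ 2 * q / m := by
      rw [le_div_iff₀ hm0]; linarith
    have e : -(4 * q / m : ℝ) + 2 * q / m = -(2 * q / m) := by ring
    rw [e]; linarith
  have a3 : (ζ / m) ^ 20 ≤ ζ / (m : ℝ) ^ 20 := by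
    rw [div_pow]
    gcongr
    exact pow_le_of_le_one h0.le h1 (by norm_num)
  calc (m : ℝ) * (Real.exp 1 * Real.exp (-(4 * q / m)) * (1 + 2 / m) ^ q)
      ≤ m * (3 * Real.exp (-(4 * q / m)) * Real.exp (2 * q / m)) := by
        gcongr
        linarith [Real.exp_one_lt_d9]
    _ = m * 3 * (Real.exp (-(4 * q / m)) * Real.exp (2 * q / m)) := by ring
    _ ≤ m * 3 * (ζ / (m : ℝ) ^ 20) := by
        gcongr
        exact a2.trans a3
    _ ≤ ζ / (3 * (m : ℝ) ^ 4) := by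
        -- What remains to be shown is 9 ≤ m^15, which is where m ≥ 2 enters.
        have h15 : (2 : ℝ) ^ 15 ≤ (m : ℝ) ^ 15 := pow_le_pow_left₀ (by norm_num) hm2 15
        rw [mul_div_assoc', div_le_div_iff₀ (by positivity) (by positivity)]
        have : m * 3 * ζ * (3 * (m : ℝ) ^ 4) = ζ * (m : ℝ) ^ 5 * 9 := by ring
        rw [this, show ζ * (m : ℝ) ^ 20 = ζ * (m : ℝ) ^ 5 * (m : ℝ) ^ 15 by ring]
        gcongr
        linarith

theorem rpow_three_halves {x : ℝ} (hx : 0 < x) : x ^ (3 / 2 : ℝ) = x * Real.sqrt x := by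
  rw [Real.sqrt_eq_rpow, ← Real.rpow_one_add' hx.le (by norm_num)]
  norm_num

/-- Since ε ≤ q/m, the parameter e of an answer is at most 1, so (1+e)/e ≤ 2/e = 16q/(εm). -/
theorem query_error_le (hn : 1 ≤ n) (hm : 1 ≤ m) {q : ℕ} {ε : ℝ} (hε : 0 < ε) (hq : 0 < q)
    (hεq : ε ≤ q / m) :
    (m : ℝ) ^ 2 * ((1 + queryEps m q ε) / queryEps m q ε * Real.sqrt (m / n)) ≤
      16 * ((m : ℝ) ^ (3 / 2 : ℝ) * q / (ε * Real.sqrt n)) := by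
  have hm0 : (0 : ℝ) < m := by exact_mod_cast hm
  have hn0 : (0 : ℝ) < n := by exact_mod_cast hn
  have hq0 : (0 : ℝ) < q := by exact_mod_cast hq
  have e0 : 0 < queryEps m q ε := by unfold queryEps; positivity
  have e1 : queryEps m q ε ≤ 1 := by
    rw [queryEps, div_le_one (by positivity)]
    rw [le_div_iff₀ hm0] at hεq
    linarith
  calc (m : ℝ) ^ 2 * ((1 + queryEps m q ε) / queryEps m q ε * Real.sqrt (m / n))
      ≤ (m : ℝ) ^ 2 * (2 / queryEps m q ε * Real.sqrt (m / n)) := by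
        gcongr
        linarith
    _ = _ := by
        rw [rpow_three_halves hm0, Real.sqrt_div hm0.le, queryEps]
        field_simp
        ring

/-- Multiplied by ε√n, the left side is 8ε + 16m², and both ε and m² are at most mq. -/
theorem fallback_error_le (hn : 1 ≤ n) (hm : 1 ≤ m) {q : ℕ} {ε : ℝ} (hε : 0 < ε)
    (hmq : (m : ℝ) ≤ q) (hεq : ε ≤ q / m) :
    8 * ((1 + fallbackEps m ε) / fallbackEps m ε / Real.sqrt n) ≤
      24 * ((m : ℝ) ^ (3 / 2 : ℝ) * q / (ε * Real.sqrt n)) := by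
  have hm1 : (1 : ℝ) ≤ m := by exact_mod_cast hm
  have hm0 : (0 : ℝ) < m := by linarith
  have hn0 : (0 : ℝ) < Real.sqrt n := Real.sqrt_pos.2 (by exact_mod_cast hn)
  have hs : 1 ≤ Real.sqrt m := Real.one_le_sqrt.2 hm1
  rw [le_div_iff₀ hm0] at hεq
  have h1 : 8 * ε + 16 * (m : ℝ) ^ 2 ≤ 24 * (m * q) := by nlinarith
  have h2 : (m : ℝ) * q ≤ m * Real.sqrt m * q := by
    have : (m : ℝ) * 1 * q ≤ m * Real.sqrt m * q := by gcongr
    linarith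
  calc 8 * ((1 + fallbackEps m ε) / fallbackEps m ε / Real.sqrt n)
      = (8 * ε + 16 * (m : ℝ) ^ 2) / (ε * Real.sqrt n) := by
        unfold fallbackEps; field_simp; ring
    _ ≤ 24 * (m * Real.sqrt m * q) / (ε * Real.sqrt n) := by
        gcongr
        linarith
    _ = _ := by rw [rpow_three_halves hm0]; ring

theorem totalBound_le_of_two_le {A : Cmd} {t : ℕ → ℕ} {α : ℝ} (hA : QueryApprox A t α)
    (hα : 0 ≤ α) (hn : 1 ≤ n) (hm : 2 ≤ m) {q : ℕ} {ε ζ : ℝ} (hζ : 0 < ζ) (hζ1 : ζ ≤ 1)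
    (hε : 0 < ε) (hεq : ε ≤ max 1 ((q : ℝ) / m)) (hlog : 10 * (m : ℝ) * Real.log (m / ζ) ≤ q)
    (hq : ∀ w : Fin m → Fin m → ℝ, IsProbWeight w →
      ENNReal.ofReal (1 - ζ / (m : ℝ) ^ 4) ≤ (queryCount A t w).toOuterMeasure {k | k ≤ q}) :
    totalBound A D q ε (t m) (outputCost (kemeny D)) ≤
      ENNReal.ofReal ((α + ζ) * opt (kemeny D) +
        (16 * α + 40) * ((m : ℝ) ^ (3 / 2 : ℝ) * q / (ε * Real.sqrt n))) := by
  have hm1 : 1 ≤ m := by omega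
  have hm2 : (2 : ℝ) ≤ m := by exact_mod_cast hm
  have hm0 : (0 : ℝ) < m := by linarith
  have hL : Real.log 2 ≤ Real.log (m / ζ) := by
    refine Real.log_le_log (by norm_num) (hm2.trans ?_)
    exact le_div_self hm0.le hζ hζ1
  -- As 10 log 2 > 1, the bound on `q` forces q ≥ m, so the maximum in the condition on ε is q/m.
  have hmq : (m : ℝ) ≤ q := by nlinarith [Real.log_two_gt_d9]
  have hqm : ε ≤ q / m := by rwa [max_eq_right ((one_le_div₀ hm0).2 hmq)] at hεq
  have hq0 : 0 < q := by
    have : (0 : ℝ) < q := by linarith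
    exact_mod_cast this
  have hk : kemeny D = weightCost (prefWeight D) := funext fun σ => kemeny_eq_weightCost D σ
  have hopt : 0 ≤ opt (kemeny D) := hk ▸ opt_nonneg (isProbWeight_prefWeight hn D)
  set R := (m : ℝ) ^ (3 / 2 : ℝ) * q / (ε * Real.sqrt n)
  set Y := (1 + fallbackEps m ε) / fallbackEps m ε / Real.sqrt n with hY
  have e1 : 0 < queryEps m q ε := by unfold queryEps; positivity
  have e2 : 0 < fallbackEps m ε := by unfold fallbackEps; positivity
  have hY0 : 0 ≤ Y := by positivity
  have hR := query_error_le hn hm1 hε hq0 hqm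
  have hR2 := fallback_error_le hn hm1 hε hmq hqm
  rw [← hY] at hR2
  refine (totalBound_le hA hα hn hm1 hε hq).trans ?_
  refine (add_le_add (expected_query_cost_le hn hm1 e1 (mul_nonneg hα hopt) (by linarith))
    (mul_le_mul' (expected_fallback_cost_le hn hm1 e2)
      (add_le_add_right (potential_zero_le hm hζ hζ1 hlog) _))).trans ?_
  rw [← hk, ← hY, ← ENNReal.ofReal_add (by positivity) (by positivity),
    ← ENNReal.ofReal_mul (by positivity), ← ENNReal.ofReal_add (by positivity) (by positivity)]
  refine ENNReal.ofReal_le_ofReal ?_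
  -- The failure probability of order ζ/m⁴ cancels the polynomial factors of the fallback; the rest
  -- 4/m² in front of ζ·OPT is at most 1 because m ≥ 2.
  have t1 : (3 * (m : ℝ) ^ 2 * opt (kemeny D) + 6 * (m : ℝ) ^ 4 * Y) *
      (ζ / (m : ℝ) ^ 4 + ζ / (3 * (m : ℝ) ^ 4)) =
      ζ * opt (kemeny D) * (4 / (m : ℝ) ^ 2) + ζ * (8 * Y) := by
    field_simp; ring
  have t2 : ζ * opt (kemeny D) * (4 / (m : ℝ) ^ 2) ≤ ζ * opt (kemeny D) := by
    refine mul_le_of_le_one_right (by positivity) ?_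
    rw [div_le_one (by positivity)]
    nlinarith
  have t3 : ζ * (8 * Y) ≤ 24 * R := (mul_le_of_le_one_left (by positivity) hζ1).trans hR2
  rw [t1]
  nlinarith [mul_le_mul_of_nonneg_left hR (show 0 ≤ α + 1 by linarith)]

theorem weightCost_eq_zero {m : ℕ} (hm : m = 1) (w : Fin m → Fin m → ℝ) (σ : Ranking m) :
    weightCost w σ = 0 := by
  subst hm
  simp [weightCost]

/-- With a single item all costs vanish. The bound still has content, since an output that is not a
ranking would cost ⊤. -/
theorem totalBound_eq_zero {A : Cmd} {t : ℕ → ℕ} {α : ℝ} (hA : QueryApprox A t α)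
    (hα : 0 ≤ α) (hn : 1 ≤ n) (hm : m = 1) {q : ℕ} {ε δ : ℝ} (hε : 0 < ε)
    (hq : ∀ w : Fin m → Fin m → ℝ, IsProbWeight w →
      ENNReal.ofReal (1 - δ) ≤ (queryCount A t w).toOuterMeasure {k | k ≤ q}) :
    totalBound A D q ε (t m) (outputCost (kemeny D)) ≤ 0 := by
  have hk : ∀ σ, kemeny D σ = 0 := fun σ => by rw [kemeny_eq_weightCost, weightCost_eq_zero hm]
  have hopt : opt (kemeny D) = 0 := by
    obtain ⟨σ, hσ⟩ := exists_eq_opt (kemeny D)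
    rw [← hσ, hk]
  refine (totalBound_le hA hα hn hm.ge hε hq).trans (le_of_eq ?_)
  have hd : ∀ (g : Fin n → Fin m) e ω, weightDist (drawnWeight g e ω) (prefWeight D) = 0 := by
    intro g e ω
    have hw := isProbWeight_prefWeight hn D
    subst hm
    simp [weightDist, drawnWeight, hw.diag]
  simp [weightCost_eq_zero hm, hd, hopt, prodExp]

end Final

end RankAgg

open RankAgg
theorem mainTheorem9 (α : ℝ) (hα : 0 < α) :
    ∃ C : ℝ, 0 < C ∧
      ∀ (A : Cmd) (p : Polynomial ℕ),
        QueryRunsIn A (fun m => p.eval m) →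
        QueryApprox A (fun m => p.eval m) α →
        ∃ (B : Protocol) (p' : Polynomial ℕ),
          B.RunsIn (fun N => p'.eval N) ∧
          (∀ n m q : ℕ, 1 ≤ n → 1 ≤ m → ∀ ε : ℝ, 0 < ε →
            IsPureDP (fun D : Fin n → Ranking m =>
              B.transcript (fun N => p'.eval N) q ε D) ε) ∧
          ∀ (n m q : ℕ) (ε ζ : ℝ), 1 ≤ n → 1 ≤ m → 0 < ζ → ζ ≤ 1 → 0 < ε →
            ε ≤ max 1 ((q : ℝ) / m) →
            10 * (m : ℝ) * Real.log (m / ζ) ≤ q →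
            (∀ w : Fin m → Fin m → ℝ, IsProbWeight w →
              ENNReal.ofReal (1 - ζ / (m : ℝ) ^ 4) ≤
                (queryCount A (fun m => p.eval m) w).toOuterMeasure {k | k ≤ q}) →
            ∀ D : Fin n → Ranking m,
              IsApprox (B.output (fun N => p'.eval N) q ε D) (kemeny D) (α + ζ)
                (C * ((m : ℝ) ^ (3 / 2 : ℝ) * q / (ε * Real.sqrt n))) := by
  -- The constant is 16(α + 1) from the estimated weights plus 24 from the fallback ranking.
  refine ⟨16 * α + 40, by positivity, fun A p hA hα' =>
    ⟨rrProtocol (serverProg A), timePoly p, ?_, ?_, ?_⟩⟩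
  · intro n m q _ hm ε hε D s hs
    exact (halted_and_private hm hε (hA m hm) (serverTime_le_timePoly p n m) hs).1
  · intro n m q _ hm ε hε
    exact isPureDP_transcript fun D s hs =>
      halted_and_private hm hε (hA m hm) (serverTime_le_timePoly p n m) hs
  · intro n m q ε ζ hn hm hζ hζ1 hε hεq hlog hq D
    rw [IsApprox, expectedCost_eq]
    refine (tsum_output_le hm hε (hA m hm) (serverTime_le_timePoly p n m) _).trans ?_
    -- For m = 1 the logarithm may vanish and `q` may be 0, so the estimates for m ≥ 2 are not
    -- available.
    rcases Nat.lt_or_ge 1 m with h2 | h1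
    · exact totalBound_le_of_two_le hα' hα.le hn h2 hζ hζ1 hε hεq hlog hq
    · exact (totalBound_eq_zero hα' hα.le hn (le_antisymm h1 hm) hε hq).trans zero_le
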